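/- Let $M$ be a (second countable, Hausdorff) $\mathcal C^\infty$ Riemannian manifold of dimension $m$, let $V\to M$ be a $\mathcal C^\infty$ real vector bundle of rank $k$, equipped with a smooth fibre metric and a connection $\nabla$, and let $n$ be a natural number. Let $\mathcal S$ be a finite dimensional vector space of $\mathcal C^\infty$ sections of $V$, identified with $\mathbb R^d$ by a choice of basis, and let $\mu=\rho\,dc$ be a probability measure on $\mathcal S$ with $\rho:\mathbb R^d\to[0,\infty)$ continuous and $\rho(0)>0$. Put $$M_n=\{z=(z^1,\dots,z^n)\in M^n:\ z^p\neq z^q\ \text{for}\ p\neq q\},\qquad s(z)=(s(z^p))_p,\quad \nabla s(z)=(\nabla s(z^p))_p ,$$ and let $dz$ be the (product) Riemannian volume on $M^n$, and $dx$, $d\xi$ the Lebesgue measures on $\prod_pV_{z^p}$ and on $\prod_p(T^*_M\otimes V)_{z^p}=\prod_p\mathrm{Hom}(T_{M,z^p},V_{z^p})$ induced by the metrics. For $s\in\mathcal S$ let $|Z_s|$ be the measure on $M$ given by Riemannian $(m-k)$-volume along the regular points of the zero set $Z_s=\{s=0\}$, that is, along the zeros $x$ of $s$ at which $\nabla s(x):T_{M,x}\to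 V_x$ is surjective, and let $|Z_s|^n$ be the $n$-fold product measure (if $k>m$, there are no regular points, and $|Z_s|=0$). Suppose that * for every $z\in M_n$ the linear map $J_z:\mathcal S\to\prod_pV_{z^p}\times\prod_p(T^*_M\otimes V)_{z^p}$, $s\mapsto(s(z),\nabla s(z))$, is surjective; * the volumes $|Z_s|$ are locally uniformly bounded above: every point of $M$ has a neighbourhood $U$ for which there is $C<\infty$ with $|Z_s|(U)\le C$ for $\mu$-almost every $s\in\mathcal S$. For $z\in M_n$ let $D_n(x,\xi,z)\in[0,\infty]$ be the density of $J_{z*}\mu$ given by integration of the continuous volume form $\rho\,dc$ over the fibres of $J_z$: $$D_n(x,\xi,z)=\det(aa^{\mathsf T})^{-1/2}\int_{J_z^{-1}(x,\xi)}\rho ,$$ where $a$ is the matrix of $J_z$ in the standard basis of $\mathbb R^d$ and an orthonormal basis of the target, and the integral is with respect to Lebesgue measure on the affine subspace $J_z^{-1}(x,\xi)\subset\mathbb R^d$. Then $D_n$ is the $n$-point density of $\mu$, i.e. for every $z\in M_n$ the random variable $(s(z),\nabla s(z))$ has the law $D_n(x,\xi,z)\,dx\,d\xi$, and on $M_n$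 $$\mathbf E\,|Z_s|^n=K_n(z)\,dz,\qquad K_n(z)=\int D_n(0,\xi,z)\prod_{p=1}^n\sqrt{\det\bigl(\xi^p\xi^{p*}\bigr)}\;d\xi .$$ That is, $K_n$ is measurable on $M_n$ and, for every Borel set $B\subset M_n$, the function $s\mapsto|Z_s|^n(B)$ is $\mu$-measurable and $\int_{\mathcal S}|Z_s|^n(B)\,d\mu(s)=\int_BK_n(z)\,dz$. This measure is finite on the compact subsets of $M_n$. -/

import Mathlib

open MeasureTheory Module Bundle Set Filter
open scoped Manifold ContDiff ENNReal NNReal Topology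

noncomputable section

namespace ZeroCorrelation

section LinearAlgebra

variable (T W : Type*)
  [NormedAddCommGroup T] [InnerProductSpace ℝ T] [FiniteDimensional ℝ T]
  [NormedAddCommGroup W] [InnerProductSpace ℝ W] [FiniteDimensional ℝ W]

/-- The basis `e_q^* ⊗ f_j` of `T^* ⊗ W = Hom(T, W)` built from orthonormal bases `e_q` of `T`
and `f_j` of `W`. It is orthonormal for the metric induced on `T^* ⊗ W`. -/
def homBasis : Basis (Fin (finrank ℝ W) × Fin (finrank ℝ T)) ℝ (T →L[ℝ] W) :=
  ((stdOrthonormalBasis ℝ T).toBasis.linearMap (stdOrthonormalBasis ℝ W).toBasis).map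
    LinearMap.toContinuousLinearMap

/-- The intrinsic volume measure `dξ` on `T^* ⊗ W = Hom(T, W)` induced by the inner products:
Lebesgue measure in the coordinates with respect to an orthonormal basis. -/
def homVolume : Measure (T →L[ℝ] W) := (homBasis T W).addHaar

variable {T W}

/-- `√(det (ξ ξ^*))`, where `ξ ξ^*` is the endomorphism of `W` obtained from `ξ : T → W` and its
adjoint `ξ^* : W → T`. -/
def sqrtDet (ξ : T →L[ℝ] W) : ℝ :=
  Real.sqrt (LinearMap.det ((ξ : T →ₗ[ℝ] W) ∘ₗ LinearMap.adjoint (ξ : T →ₗ[ℝ] W)))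

end LinearAlgebra

/-- Let `A : ℝ^d → Y` be a surjective linear map, let `B` be a basis of `Y`, and let `dy` be the
Lebesgue measure on `Y` in the coordinates of `B`. For a continuous density `ρ` on `ℝ^d`, this is
the density at `y` of the push-forward `A_* (ρ dc)` with respect to `dy`, given by integration of
the volume form `ρ dc` over the fibre `A⁻¹(y)`:
`det (A Aᵗ)^(-1/2) ∫_{A⁻¹(y)} ρ`, the integral being with respect to the `(d - dim Y)`-dimensional
Lebesgue measure of the affine subspace `A⁻¹(y)` of `ℝ^d`. -/
def fiberDensity {d : ℕ} {Y ι : Type*} [AddCommGroup Y] [Module ℝ Y] [Fintype ι] [DecidableEq ι]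
    (B : Basis ι ℝ Y) (A : EuclideanSpace ℝ (Fin d) →ₗ[ℝ] Y)
    (ρ : EuclideanSpace ℝ (Fin d) → ℝ) (y : Y) : ℝ≥0∞ :=
  let a : Matrix ι (Fin d) ℝ :=
    LinearMap.toMatrix (EuclideanSpace.basisFun (Fin d) ℝ).toBasis B A
  (ENNReal.ofReal (Real.sqrt (a * a.transpose).det))⁻¹ *
    ∫⁻ c in A ⁻¹' {y}, ENNReal.ofReal (ρ c) ∂μHE[d - Fintype.card ι]

/-- The punctured product `M_n` of `n`-tuples of pairwise distinct points. -/
def puncturedProduct (M : Type*) (n : ℕ) : Set (Fin n → M) :=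
  {z | ∀ p q, p ≠ q → z p ≠ z q}

section Bundle

variable {m k n d : ℕ} {M : Type*} [EMetricSpace M]
  [ChartedSpace (EuclideanSpace ℝ (Fin m)) M] [IsManifold (𝓡 m) ∞ M]
  [RiemannianBundle (fun x : M ↦ TangentSpace (𝓡 m) x)]
  {V : M → Type*} [TopologicalSpace (TotalSpace (EuclideanSpace ℝ (Fin k)) V)]
  [∀ x, NormedAddCommGroup (V x)] [∀ x, InnerProductSpace ℝ (V x)]
  [FiberBundle (EuclideanSpace ℝ (Fin k)) V] [VectorBundle ℝ (EuclideanSpace ℝ (Fin k)) V]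

instance finiteDimensional_tangentSpace (x : M) :
    FiniteDimensional ℝ (TangentSpace (𝓡 m) x) :=
  inferInstanceAs (FiniteDimensional ℝ (EuclideanSpace ℝ (Fin m)))

theorem finiteDimensional_fiber (k : ℕ) {X : Type*} [TopologicalSpace X] (V : X → Type*)
    [TopologicalSpace (TotalSpace (EuclideanSpace ℝ (Fin k)) V)]
    [∀ x, NormedAddCommGroup (V x)] [∀ x, InnerProductSpace ℝ (V x)]
    [FiberBundle (EuclideanSpace ℝ (Fin k)) V] [VectorBundle ℝ (EuclideanSpace ℝ (Fin k)) V]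
    (x : X) : FiniteDimensional ℝ (V x) :=
  VectorBundle.finiteDimensional ℝ (EuclideanSpace ℝ (Fin k)) V x

/-- The measure `|Z_s|` on `M`: the Riemannian `(m - k)`-volume along the regular points of the
zero set `Z_s` of the section `s`, i.e. along the zeros of `s` at which the derivative
`∇s(x) : T_x M → V_x` is surjective. (At a zero of `s` the derivative does not depend on the
connection, and near such a zero `Z_s` is a submanifold of codimension `k`.) The Riemannian
`(m - k)`-volume of a submanifold is its `(m - k)`-dimensional Hausdorff measure for the Riemannian
distance of `M`, normalised so as to agree with Lebesgue measure on Euclidean space. -/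
def zeroMeasure [MeasurableSpace M] [BorelSpace M]
    (cov : CovariantDerivative (𝓡 m) (EuclideanSpace ℝ (Fin k)) V)
    (s : Cₛ^∞⟮𝓡 m; EuclideanSpace ℝ (Fin k), V⟯) : Measure M :=
  μHE[m - k].restrict {x | s x = 0 ∧ Function.Surjective (cov s x)}

/-- The Riemannian volume `dz = dz^1 ⋯ dz^n` on `M^n`, where the Riemannian volume of the
`m`-dimensional manifold `M` is the `m`-dimensional Hausdorff measure for the Riemannian distance,
normalised so as to agree with Lebesgue measure on Euclidean space. -/
def productVolume (m n : ℕ) (M : Type*) [EMetricSpace M] [MeasurableSpace M] [BorelSpace M] :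
    Measure (Fin n → M) :=
  Measure.pi fun _ ↦ (μHE[m] : Measure M)

/-- The product measure `|Z_s|^n = |Z_s| × ⋯ × |Z_s|`. -/
def zeroMeasurePow [MeasurableSpace M] [BorelSpace M]
    (cov : CovariantDerivative (𝓡 m) (EuclideanSpace ℝ (Fin k)) V)
    (s : Cₛ^∞⟮𝓡 m; EuclideanSpace ℝ (Fin k), V⟯) (n : ℕ) : Measure (Fin n → M) :=
  Measure.pi fun _ ↦ zeroMeasure cov s

/-- The random section with coordinates `c` in a given basis of the space of sections. -/
def randomSection {S : Submodule ℝ Cₛ^∞⟮𝓡 m; EuclideanSpace ℝ (Fin k), V⟯}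
    (b : Basis (Fin d) ℝ S) :
    EuclideanSpace ℝ (Fin d) →ₗ[ℝ] Cₛ^∞⟮𝓡 m; EuclideanSpace ℝ (Fin k), V⟯ :=
  S.subtype ∘ₗ b.equivFun.symm.toLinearMap ∘ₗ (WithLp.linearEquiv 2 ℝ (Fin d → ℝ)).toLinearMap

/-- The jet map `s ↦ (s(z), ∇s(z)) = ((s(z^p))_p, (∇s(z^p))_p)` at `z = (z^1, …, z^n)`. -/
def jet (cov : CovariantDerivative (𝓡 m) (EuclideanSpace ℝ (Fin k)) V) (z : Fin n → M) :
    Cₛ^∞⟮𝓡 m; EuclideanSpace ℝ (Fin k), V⟯ →ₗ[ℝ]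
      ((p : Fin n) → V (z p)) × ((p : Fin n) → TangentSpace (𝓡 m) (z p) →L[ℝ] V (z p)) where
  toFun s := (fun p ↦ s (z p), fun p ↦ cov s (z p))
  map_add' s t := by
    refine Prod.ext rfl (funext fun p ↦ ?_)
    exact cov.isCovariantDerivativeOnUniv.add
      (s.contMDiff.mdifferentiable (by simp) (z p)) (t.contMDiff.mdifferentiable (by simp) (z p))
  map_smul' r s := by
    refine Prod.ext rfl (funext fun p ↦ ?_)
    exact cov.isCovariantDerivativeOnUniv.smul_const r
      (s.contMDiff.mdifferentiable (by simp) (z p))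

variable (k V) in
/-- The volume `dx = dx^1 ⋯ dx^n` on `V_{z^1} × ⋯ × V_{z^n}`, each `dx^p` being the Lebesgue
measure of the inner product space `V_{z^p}`. -/
def valueVolume [∀ x, MeasurableSpace (V x)] [∀ x, BorelSpace (V x)] (z : Fin n → M) :
    Measure ((p : Fin n) → V (z p)) :=
  haveI := finiteDimensional_fiber k V
  Measure.pi fun p ↦ (volume : Measure (V (z p)))

variable (m k V) in
/-- The volume `dξ = dξ^1 ⋯ dξ^n` on the product of the spaces `(T^*M ⊗ V)_{z^p}`. -/
def derivVolume (z : Fin n → M) :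
    Measure ((p : Fin n) → TangentSpace (𝓡 m) (z p) →L[ℝ] V (z p)) :=
  haveI := finiteDimensional_fiber k V
  Measure.pi fun p ↦ homVolume (TangentSpace (𝓡 m) (z p)) (V (z p))

/-- The `n`-point density `D_n(x, ξ, z)` of the measure `μ = ρ dc` on the space of sections, i.e.
the density of the law of `(s(z), ∇s(z))` with respect to `dx dξ`. Of the densities of this law,
which agree only up to a null set, it is the one given by fibre integration of the continuous
volume form `ρ dc`, so that its value at `x = 0` is meaningful. -/
def nPointDensity (cov : CovariantDerivative (𝓡 m) (EuclideanSpace ℝ (Fin k)) V)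
    {S : Submodule ℝ Cₛ^∞⟮𝓡 m; EuclideanSpace ℝ (Fin k), V⟯} (b : Basis (Fin d) ℝ S)
    (ρ : EuclideanSpace ℝ (Fin d) → ℝ) (z : Fin n → M) (x : (p : Fin n) → V (z p))
    (ξ : (p : Fin n) → TangentSpace (𝓡 m) (z p) →L[ℝ] V (z p)) : ℝ≥0∞ :=
  haveI := finiteDimensional_fiber k V
  fiberDensity
    ((Pi.basis fun p ↦ (stdOrthonormalBasis ℝ (V (z p))).toBasis).prod
      (Pi.basis fun p ↦ homBasis (TangentSpace (𝓡 m) (z p)) (V (z p))))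
    (jet cov z ∘ₗ randomSection b) ρ (x, ξ)

/-- The `n`-point zero correlation function
`K_n(z) = ∫ D_n(0, ξ, z) ∏_p √(det (ξ^p ξ^{p*})) dξ`. -/
def zeroCorrelation (cov : CovariantDerivative (𝓡 m) (EuclideanSpace ℝ (Fin k)) V)
    {S : Submodule ℝ Cₛ^∞⟮𝓡 m; EuclideanSpace ℝ (Fin k), V⟯} (b : Basis (Fin d) ℝ S)
    (ρ : EuclideanSpace ℝ (Fin d) → ℝ) (z : Fin n → M) : ℝ≥0∞ :=
  haveI := finiteDimensional_fiber k V
  ∫⁻ ξ, nPointDensity cov b ρ z 0 ξ * ∏ p, ENNReal.ofReal (sqrtDet (ξ p)) ∂(derivVolume m k V z)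

end Bundle

end ZeroCorrelation

end

set_option linter.unusedSectionVars false

noncomputable section

/-! The statement is a coarea formula on the incidence set of pairs `(c, z)` for which every `z^p`
is a regular zero of the section with parameter `c`. Slicing this set by `c` gives the tuples of
regular zeros of one section, and hence `|Z_s|^n`. Slicing it by `z` gives the parameters whose
sections vanish at all `z^p`, an affine fibre of the evaluation map, and hence `K_n(z)`. The
expectation formula is the equality of these two iterated integrals.

The incidence set is never parametrised by the implicit function theorem. Every comparison is made
up to a factor `t > 1` (`EqUpTo`), and `t` tends to `1` at the end
(`lintegral_eq_of_forall_eqUpTo`), which also yields measurability. Near a base point `(c₀, z₀)`, in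
charts and frames that are isometric at the points `z₀^p`, strict differentiability makes increments
between two points of the incidence set satisfy `A c + D_p v_p ≈ 0` for every `p`
(`eventually_norm_sectionEval_add_le`), where `A` evaluates sections at `z₀` and `D_p` is the
surjective derivative at `z₀^p`. The set thus has two natural coordinate systems: `c` with the
components of `v_p` in `ker D_p`, or the component of `c` in `ker A` with the positions `v_p`.
`paramLevel` and `paramPosition` send both into `ker A × ∏ (ker D_p × Y)`. There they differ only by
`-A c` against `D_p v_p`, so the images have nearly equal volume (`eqUpTo_addHaar_image`). The
linear maps contribute the coarea constant of `A` and the product of the `√det (D_p D_p^*)`, and the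
slices are nearly isometric to subsets of the kernels. This is `exists_local_comparison`.

`exists_nhds_eqUpTo` inserts `ρ`, which is nearly constant locally, and
`lintegral_zeroMeasurePow_eq` sums over a countable partition of the incidence set. On the linear
side, the coarea formula for surjective maps gives the law of the jet. Integrating out `ξ`
(`lintegral_coareaConst_prod`) turns `K_n(z)` into an integral over the parameters vanishing at `z`
(`zeroCorrelation_eq`), with an integrand that is zero off the regular tuples.

The bound on the volumes makes `|Z_s|` σ-finite almost surely, so that its product measure behaves
as expected, and gives finiteness on compact sets by covering with finitely many boxes. -/

namespace ZeroCorrelation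

/-! ### Extended nonnegative numbers that agree up to a factor -/

/-- The extended nonnegative numbers `a` and `b` agree up to the factor `t`. -/
def EqUpTo (t : ℝ≥0) (a b : ℝ≥0∞) : Prop := a ≤ t * b ∧ b ≤ t * a

namespace EqUpTo

variable {t u : ℝ≥0} {a b c a' b' : ℝ≥0∞}

theorem of_eq (ht : 1 ≤ t) (h : a = b) : EqUpTo t a b := by
  subst h
  have : (1 : ℝ≥0∞) ≤ t := by exact_mod_cast ht
  exact ⟨le_mul_of_one_le_left zero_le this, le_mul_of_one_le_left zero_le this⟩

theorem symm (h : EqUpTo t a b) : EqUpTo t b a := ⟨h.2, h.1⟩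

theorem mono (h : EqUpTo t a b) (htu : t ≤ u) : EqUpTo u a b :=
  ⟨h.1.trans (by gcongr), h.2.trans (by gcongr)⟩

theorem trans (h : EqUpTo t a b) (h' : EqUpTo u b c) : EqUpTo (t * u) a c := by
  constructor
  · refine h.1.trans ?_
    rw [ENNReal.coe_mul, mul_assoc]
    gcongr
    exact h'.1
  · refine h'.2.trans ?_
    rw [ENNReal.coe_mul, mul_comm (t : ℝ≥0∞), mul_assoc]
    gcongr
    exact h.2

theorem mul (h : EqUpTo t a b) (h' : EqUpTo u a' b') : EqUpTo (t * u) (a * a') (b * b') := by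
  constructor
  · rw [ENNReal.coe_mul, mul_mul_mul_comm]
    exact mul_le_mul' h.1 h'.1
  · rw [ENNReal.coe_mul, mul_mul_mul_comm]
    exact mul_le_mul' h.2 h'.2

theorem const_mul (c : ℝ≥0∞) (h : EqUpTo t a b) : EqUpTo t (c * a) (c * b) := by
  constructor <;> rw [mul_left_comm] <;> gcongr
  exacts [h.1, h.2]

theorem mul_const (h : EqUpTo t a b) (c : ℝ≥0∞) : EqUpTo t (a * c) (b * c) := by
  rw [mul_comm a, mul_comm b]
  exact h.const_mul c

theorem inv (ht : t ≠ 0) (h : EqUpTo t a b) : EqUpTo t a⁻¹ b⁻¹ := by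
  have key : ∀ {a b : ℝ≥0∞}, b ≤ t * a → a⁻¹ ≤ t * b⁻¹ := by
    intro a b hab
    have ht' : (t : ℝ≥0∞) ≠ 0 := by exact_mod_cast ht
    have := ENNReal.inv_le_inv.2 hab
    rw [ENNReal.mul_inv (Or.inl ht') (Or.inl ENNReal.coe_ne_top)] at this
    calc a⁻¹ = t * ((t : ℝ≥0∞)⁻¹ * a⁻¹) := by
          rw [← mul_assoc, ENNReal.mul_inv_cancel ht' ENNReal.coe_ne_top, one_mul]
      _ ≤ t * b⁻¹ := by gcongr
  exact ⟨key h.2, key h.1⟩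

theorem prod {ι : Type*} {s : Finset ι} {t : ι → ℝ≥0} {a b : ι → ℝ≥0∞}
    (h : ∀ i ∈ s, EqUpTo (t i) (a i) (b i)) :
    EqUpTo (∏ i ∈ s, t i) (∏ i ∈ s, a i) (∏ i ∈ s, b i) := by
  classical
  induction s using Finset.induction_on with
  | empty => simpa using of_eq le_rfl rfl
  | insert i s hi ih =>
    rw [Finset.prod_insert hi, Finset.prod_insert hi, Finset.prod_insert hi]
    exact (h i (Finset.mem_insert_self i s)).mul
      (ih fun j hj ↦ h j (Finset.mem_insert_of_mem hj))

theorem tsum {ι : Type*} {a b : ι → ℝ≥0∞} (h : ∀ i, EqUpTo t (a i) (b i)) :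
    EqUpTo t (∑' i, a i) (∑' i, b i) := by
  constructor <;> rw [← ENNReal.tsum_mul_left] <;> refine ENNReal.tsum_le_tsum fun i ↦ ?_
  exacts [(h i).1, (h i).2]

theorem lintegral {α : Type*} [MeasurableSpace α] {μ : Measure α} {f g : α → ℝ≥0∞}
    (h : ∀ᵐ x ∂μ, EqUpTo t (f x) (g x)) : EqUpTo t (∫⁻ x, f x ∂μ) (∫⁻ x, g x ∂μ) := by
  constructor <;> rw [← lintegral_const_mul' _ _ ENNReal.coe_ne_top] <;>
    refine lintegral_mono_ae (h.mono fun x hx ↦ ?_)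
  exacts [hx.1, hx.2]

theorem of_measure {α : Type*} [MeasurableSpace α] {μ ν : Measure α}
    (h : ∀ s, MeasurableSet s → EqUpTo t (μ s) (ν s)) (f : α → ℝ≥0∞) :
    EqUpTo t (∫⁻ x, f x ∂μ) (∫⁻ x, f x ∂ν) := by
  have key : ∀ {μ ν : Measure α}, (∀ s, MeasurableSet s → EqUpTo t (μ s) (ν s)) →
      ∫⁻ x, f x ∂μ ≤ t * ∫⁻ x, f x ∂ν := by
    intro μ ν h
    rw [← smul_eq_mul, ← lintegral_smul_measure]
    refine lintegral_mono' (Measure.le_iff.2 fun s hs ↦ ?_) le_rfl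
    simpa using (h s hs).1
  exact ⟨key h, key fun s hs ↦ (h s hs).symm⟩

theorem ofReal {a b t : ℝ} (ha : a ≤ t * b) (hb : b ≤ t * a) (ht : 0 ≤ t) :
    EqUpTo t.toNNReal (ENNReal.ofReal a) (ENNReal.ofReal b) := by
  constructor
  · refine (ENNReal.ofReal_le_ofReal ha).trans ?_
    rw [ENNReal.ofReal_mul ht]
    rfl
  · refine (ENNReal.ofReal_le_ofReal hb).trans ?_
    rw [ENNReal.ofReal_mul ht]
    rfl

end EqUpTo

/-- A positive limit is attained up to any factor larger than one. -/
theorem eventually_eqUpTo {α : Type*} {l : Filter α} {f : α → ℝ} {a : ℝ} (ha : 0 < a)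
    (hf : Tendsto f l (𝓝 a)) {t : ℝ≥0} (ht : 1 < t) :
    ∀ᶠ x in l, EqUpTo t (ENNReal.ofReal (f x)) (ENNReal.ofReal a) := by
  have ht' : (1 : ℝ) < t := by exact_mod_cast ht
  have h1 : a < t * a := by nlinarith
  have h2 : a / t < a := div_lt_self ha ht'
  filter_upwards [hf.eventually (gt_mem_nhds h1), hf.eventually (lt_mem_nhds h2)] with x hx hx'
  have := EqUpTo.ofReal (a := f x) (b := a) (t := t) hx.le
    (by rw [div_lt_iff₀ (by positivity)] at hx'; nlinarith) t.2
  simpa using this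

/-- Error factors multiply, and the number of factors in each comparison is bounded by the
dimensions and the number of points. This distributes a total error `t` over `N` such factors. -/
theorem exists_one_lt_pow_le (N : ℕ) {t : ℝ≥0} (ht : 1 < t) : ∃ u : ℝ≥0, 1 < u ∧ u ^ N ≤ t := by
  have : Tendsto (fun u : ℝ≥0 ↦ u ^ N) (𝓝[>] 1) (𝓝 (1 ^ N)) :=
    ((continuous_pow N).tendsto 1).mono_left nhdsWithin_le_nhds
  rw [one_pow] at this
  have hne : (𝓝[>] (1 : ℝ≥0)).NeBot := nhdsGT_neBot_of_exists_gt ⟨t, ht⟩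
  obtain ⟨u, hu, hu'⟩ := ((this.eventually (gt_mem_nhds ht)).and self_mem_nhdsWithin).exists
  exact ⟨u, hu', hu.le⟩

theorem le_of_forall_one_lt_le_mul {a b : ℝ≥0∞} (h : ∀ t : ℝ≥0, 1 < t → a ≤ t * b) : a ≤ b := by
  rcases eq_or_ne b ⊤ with rfl | hb
  · exact le_top
  have h1 : Tendsto (fun t : ℝ≥0 ↦ (t : ℝ≥0∞) * b) (𝓝[>] 1) (𝓝 ((1 : ℝ≥0) * b)) :=
    ENNReal.Tendsto.mul_const
      ((ENNReal.continuous_coe.tendsto 1).mono_left nhdsWithin_le_nhds) (Or.inr hb)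
  have : (𝓝[>] (1 : ℝ≥0)).NeBot := nhdsGT_neBot_of_exists_gt ⟨2, one_lt_two⟩
  rw [ENNReal.coe_one, one_mul] at h1
  exact ge_of_tendsto h1 (eventually_mem_nhdsWithin.mono fun t ht ↦ h t ht)

/-- Along a sequence of factors decreasing to `1`, the measurable approximants are squeezed between
`t⁻¹ F` and `t F`, so they converge to `F` almost everywhere. -/
theorem aemeasurable_of_forall_eqUpTo {γ : Type*} [MeasurableSpace γ] {κ : Measure γ}
    {F : γ → ℝ≥0∞}
    (h : ∀ t : ℝ≥0, 1 < t → ∃ f : γ → ℝ≥0∞, AEMeasurable f κ ∧ ∀ᵐ x ∂κ, EqUpTo t (F x) (f x)) :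
    AEMeasurable F κ := by
  obtain ⟨t, -, ht1, ht⟩ := exists_seq_strictAnti_tendsto (1 : ℝ≥0)
  choose f hf hfF using fun n ↦ h (t n) (ht1 n)
  refine aemeasurable_of_tendsto_metrizable_ae atTop hf ?_
  filter_upwards [ae_all_iff.2 hfF] with x hx
  have hct : Tendsto (fun n ↦ (t n : ℝ≥0∞)) atTop (𝓝 1) := by
    rw [← ENNReal.coe_one]
    exact (ENNReal.continuous_coe.tendsto 1).comp ht
  have hu : Tendsto (fun n ↦ (t n : ℝ≥0∞) * F x) atTop (𝓝 (F x)) := by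
    simpa using ENNReal.Tendsto.mul_const hct (Or.inl one_ne_zero) (b := F x)
  have hl : Tendsto (fun n ↦ (t n : ℝ≥0∞)⁻¹ * F x) atTop (𝓝 (F x)) := by
    have : Tendsto (fun n ↦ (t n : ℝ≥0∞)⁻¹) atTop (𝓝 1) := by
      simpa using tendsto_inv_iff.2 hct
    simpa using ENNReal.Tendsto.mul_const this (Or.inl one_ne_zero) (b := F x)
  refine tendsto_of_tendsto_of_tendsto_of_le_of_le hl hu (fun n ↦ ?_) (fun n ↦ (hx n).2)
  have h0 : (t n : ℝ≥0∞) ≠ 0 := by exact_mod_cast (zero_lt_one.trans (ht1 n)).ne'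
  calc (t n : ℝ≥0∞)⁻¹ * F x ≤ (t n : ℝ≥0∞)⁻¹ * (t n * f n x) := by
        gcongr
        exact (hx n).1
    _ = f n x := by rw [← mul_assoc, ENNReal.inv_mul_cancel h0 ENNReal.coe_ne_top, one_mul]

/-- If two functions can be approximated, up to every factor larger than one, by measurable
functions with comparable integrals, then they are measurable and have the same integral. -/
theorem lintegral_eq_of_forall_eqUpTo {α β : Type*} [MeasurableSpace α] [MeasurableSpace β]
    {μ : Measure α} {ν : Measure β} {F : α → ℝ≥0∞} {G : β → ℝ≥0∞}
    (h : ∀ t : ℝ≥0, 1 < t → ∃ (f : α → ℝ≥0∞) (g : β → ℝ≥0∞), AEMeasurable f μ ∧ AEMeasurable g ν ∧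
      (∀ᵐ x ∂μ, EqUpTo t (F x) (f x)) ∧ (∀ᵐ y ∂ν, EqUpTo t (G y) (g y)) ∧
      EqUpTo t (∫⁻ x, f x ∂μ) (∫⁻ y, g y ∂ν)) :
    AEMeasurable F μ ∧ AEMeasurable G ν ∧ ∫⁻ x, F x ∂μ = ∫⁻ y, G y ∂ν := by
  refine ⟨aemeasurable_of_forall_eqUpTo fun t ht ↦ ?_, aemeasurable_of_forall_eqUpTo fun t ht ↦ ?_, ?_⟩
  · obtain ⟨f, g, hf, -, hF, -⟩ := h t ht
    exact ⟨f, hf, hF⟩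
  · obtain ⟨f, g, -, hg, -, hG, -⟩ := h t ht
    exact ⟨g, hg, hG⟩
  have key : ∀ t : ℝ≥0, 1 < t → EqUpTo t (∫⁻ x, F x ∂μ) (∫⁻ y, G y ∂ν) := by
    intro t ht
    -- Three factors: from `F` to `f`, from the integral of `f` to that of `g`, and from `g` to `G`.
    obtain ⟨u, hu, hut⟩ := exists_one_lt_pow_le 3 ht
    obtain ⟨f, g, -, -, hF, hG, hfg⟩ := h u hu
    refine (((EqUpTo.lintegral hF).trans hfg).trans (EqUpTo.lintegral hG).symm).mono ?_
    rwa [pow_three'] at hut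
  exact le_antisymm (le_of_forall_one_lt_le_mul fun t ht ↦ (key t ht).1)
    (le_of_forall_one_lt_le_mul fun t ht ↦ (key t ht).2)

/-! ### Hausdorff measures under bilipschitz maps -/

section Bilipschitz

variable {α β γ : Type*} [EMetricSpace α] [EMetricSpace β] [EMetricSpace γ]

/-- The map `g` distorts the distances between the points of `Z` at most by the factor `t`. -/
def BilipschitzOn (t : ℝ≥0) (g : α → β) (Z : Set α) : Prop :=
  ∀ x ∈ Z, ∀ y ∈ Z, EqUpTo t (edist (g x) (g y)) (edist x y)

namespace BilipschitzOn

variable {t : ℝ≥0} {g : α → β} {Z W : Set α}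

theorem injOn (h : BilipschitzOn t g Z) : InjOn g Z := by
  intro x hx y hy hxy
  have := (h x hx y hy).2
  rw [hxy, edist_self, mul_zero, nonpos_iff_eq_zero] at this
  exact edist_eq_zero.1 this

theorem lipschitzOnWith (h : BilipschitzOn t g Z) : LipschitzOnWith t g Z :=
  fun x hx y hy ↦ (h x hx y hy).1

theorem mono (h : BilipschitzOn t g Z) (hW : W ⊆ Z) : BilipschitzOn t g W :=
  fun x hx y hy ↦ h x (hW hx) y (hW hy)

theorem lipschitzOnWith_invFunOn [Nonempty α] (h : BilipschitzOn t g Z) :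
    LipschitzOnWith t (Function.invFunOn g Z) (g '' Z) := by
  rintro _ ⟨x, hx, rfl⟩ _ ⟨y, hy, rfl⟩
  rw [h.injOn.leftInvOn_invFunOn hx, h.injOn.leftInvOn_invFunOn hy]
  exact (h x hx y hy).2

variable [MeasurableSpace α] [BorelSpace α] [MeasurableSpace β] [BorelSpace β]

theorem _root_.LipschitzOnWith.euclideanHausdorffMeasure_image_le {K : ℝ≥0} {f : α → β} {s : Set α}
    (h : LipschitzOnWith K f s) (r : ℕ) :
    (μHE[r] : Measure β) (f '' s) ≤ (K : ℝ≥0∞) ^ r * μHE[r] s := by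
  rw [Measure.euclideanHausdorffMeasure_def, Measure.euclideanHausdorffMeasure_def,
    Measure.smul_apply, Measure.smul_apply, ENNReal.smul_def, ENNReal.smul_def, smul_eq_mul,
    smul_eq_mul, mul_left_comm]
  gcongr
  simpa using h.hausdorffMeasure_image_le (d := r) (by positivity)

/-- A Lipschitz map of constant `t` enlarges `r`-dimensional Hausdorff measure at most by `t ^ r`.
This is applied to `g` and to its inverse on the image, so no measurability is needed. -/
theorem eqUpTo_euclideanHausdorffMeasure (h : BilipschitzOn t g Z) (r : ℕ) :
    EqUpTo (t ^ r) ((μHE[r] : Measure α) Z) ((μHE[r] : Measure β) (g '' Z)) := by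
  rcases Z.eq_empty_or_nonempty with rfl | ⟨z, hz⟩
  · simp [EqUpTo]
  have : Nonempty α := ⟨z⟩
  refine ⟨?_, ?_⟩
  · have := h.lipschitzOnWith_invFunOn.euclideanHausdorffMeasure_image_le r
    rw [h.injOn.invFunOn_image Subset.rfl] at this
    simpa using this
  · simpa using h.lipschitzOnWith.euclideanHausdorffMeasure_image_le r

end BilipschitzOn

end Bilipschitz

/-! ### Products of measures -/

section Pi

variable {ι : Type*} [Fintype ι] {α : ι → Type*} [∀ i, MeasurableSpace (α i)]

/-- `Measure.pi ν` arises from the largest outer measure bounded by the products on boxes, so a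
comparison on boxes is enough. Only the smaller family has to be σ-finite. -/
theorem pi_le_pi {μ ν : ∀ i, Measure (α i)} [∀ i, SigmaFinite (μ i)] (h : ∀ i, μ i ≤ ν i) :
    Measure.pi μ ≤ Measure.pi ν := by
  have key : (Measure.pi μ).toOuterMeasure ≤ OuterMeasure.pi fun i ↦ (ν i).toOuterMeasure := by
    refine OuterMeasure.le_pi.2 fun s _ ↦ ?_
    have := Measure.pi_pi μ s
    rw [Measure.toOuterMeasure_apply, this]
    exact Finset.prod_le_prod' fun i _ ↦ h i (s i)
  refine Measure.le_iff.2 fun s hs ↦ ?_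
  conv_rhs => rw [Measure.pi]
  rw [toMeasure_apply _ _ hs]
  exact key s

theorem pi_smul (c : ι → ℝ≥0) (μ : ∀ i, Measure (α i)) [∀ i, SigmaFinite (μ i)] :
    Measure.pi (fun i ↦ c i • μ i) = (∏ i, c i) • Measure.pi μ := by
  refine Measure.pi_eq fun s _ ↦ ?_
  rw [Measure.smul_apply, Measure.pi_pi, ENNReal.smul_def, ENNReal.ofNNReal_finsetProd, smul_eq_mul,
    ← Finset.prod_mul_distrib]
  rfl

theorem eqUpTo_pi {μ ν : ∀ i, Measure (α i)} [∀ i, SigmaFinite (μ i)] [∀ i, SigmaFinite (ν i)]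
    {t : ι → ℝ≥0} (h : ∀ i s, MeasurableSet s → EqUpTo (t i) (μ i s) (ν i s))
    (s : Set (∀ i, α i)) : EqUpTo (∏ i, t i) (Measure.pi μ s) (Measure.pi ν s) := by
  have key : ∀ {μ ν : ∀ i, Measure (α i)} [∀ i, SigmaFinite (μ i)] [∀ i, SigmaFinite (ν i)],
      (∀ i s, MeasurableSet s → EqUpTo (t i) (μ i s) (ν i s)) →
      Measure.pi μ s ≤ ((∏ i, t i : ℝ≥0) : ℝ≥0∞) * Measure.pi ν s := by
    intro μ ν _ _ h
    have := pi_le_pi (μ := μ) (ν := fun i ↦ t i • ν i)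
      (fun i ↦ Measure.le_iff.2 fun s hs ↦ (h i s hs).1) s
    rwa [pi_smul] at this
  exact ⟨key h, key fun i s hs ↦ (h i s hs).symm⟩

/-- The product of the Hausdorff measures of the sets `Z i` compared with Lebesgue measure, in
bilipschitz coordinates. -/
theorem BilipschitzOn.eqUpTo_pi {M R : ι → Type*} [∀ i, EMetricSpace (M i)]
    [∀ i, MeasurableSpace (M i)] [∀ i, BorelSpace (M i)] [∀ i, StandardBorelSpace (M i)]
    [∀ i, NormedAddCommGroup (R i)] [∀ i, InnerProductSpace ℝ (R i)]
    [∀ i, FiniteDimensional ℝ (R i)] [∀ i, MeasurableSpace (R i)] [∀ i, BorelSpace (R i)]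
    {t : ℝ≥0} {g : ∀ i, M i → R i} {Z : ∀ i, Set (M i)} {r : ι → ℕ}
    (hr : ∀ i, finrank ℝ (R i) = r i)
    (hg : ∀ i, BilipschitzOn t (g i) (Z i)) (hgm : ∀ i, Measurable (g i))
    (hZ : ∀ i, MeasurableSet (Z i)) (hfin : ∀ i, volume (g i '' Z i) ≠ ⊤)
    {A : Set (∀ i, M i)} (hA : A ⊆ univ.pi Z) (hAm : MeasurableSet A) :
    EqUpTo (∏ i, t ^ r i)
      (Measure.pi (fun i ↦ (μHE[r i] : Measure (M i)).restrict (Z i)) A)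
      (volume ((fun z i ↦ g i (z i)) '' A)) := by
  classical
  rcases A.eq_empty_or_nonempty with rfl | ⟨z, -⟩
  · simp [EqUpTo]
  have : ∀ i, Nonempty (M i) := fun i ↦ ⟨z i⟩
  have hY : ∀ i, MeasurableSet (g i '' Z i) := fun i ↦
    (hZ i).image_of_measurable_injOn (hgm i) (hg i).injOn
  -- A measurable left inverse of `g i` on `Z i`, with a constant value off the image. Through it
  -- the restricted Hausdorff measure is compared with a push-forward of Lebesgue measure, one
  -- factor at a time.
  let h : ∀ i, R i → M i := fun i ↦
    (g i '' Z i).piecewise (Function.invFunOn (g i) (Z i)) (fun _ ↦ z i)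
  have hm : ∀ i, Measurable (h i) := fun i ↦
    (hg i).lipschitzOnWith_invFunOn.continuousOn.measurable_piecewise continuousOn_const (hY i)
  have hh : ∀ i, ∀ x ∈ Z i, h i (g i x) = x := fun i x hx ↦ by
    simp only [h, piecewise_eq_of_mem _ _ _ (mem_image_of_mem _ hx)]
    exact (hg i).injOn.leftInvOn_invFunOn hx
  have : ∀ i, IsFiniteMeasure ((volume : Measure (R i)).restrict (g i '' Z i)) := fun i ↦
    ⟨by simpa using (hfin i).lt_top⟩
  have key : ∀ i s, MeasurableSet s → EqUpTo (t ^ r i)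
      ((μHE[r i] : Measure (M i)).restrict (Z i) s)
      (((volume : Measure (R i)).restrict (g i '' Z i)).map (h i) s) := by
    intro i s hs
    rw [Measure.map_apply (hm i) hs, Measure.restrict_apply (hm i hs), Measure.restrict_apply hs,
      ← InnerProductSpace.euclideanHausdorffMeasure_eq_volume, hr i]
    have : h i ⁻¹' s ∩ g i '' Z i = g i '' (s ∩ Z i) := by
      ext y
      constructor
      · rintro ⟨h1, x, hx, rfl⟩
        rw [mem_preimage, hh i x hx] at h1
        exact ⟨x, ⟨h1, hx⟩, rfl⟩
      · rintro ⟨x, ⟨hxs, hx⟩, rfl⟩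
        exact ⟨by rwa [mem_preimage, hh i x hx], x, hx, rfl⟩
    rw [this]
    exact ((hg i).mono inter_subset_right).eqUpTo_euclideanHausdorffMeasure (r i)
  have : ∀ i, IsFiniteMeasure ((μHE[r i] : Measure (M i)).restrict (Z i)) := fun i ↦
    ⟨((key i univ MeasurableSet.univ).1).trans_lt
      (ENNReal.mul_lt_top ENNReal.coe_lt_top (measure_lt_top _ _))⟩
  have h1 := ZeroCorrelation.eqUpTo_pi key A
  rw [← Measure.pi_map_pi fun i ↦ (hm i).aemeasurable, ← Measure.restrict_pi_pi (fun i ↦ (volume : Measure (R i))),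
    Measure.map_apply (by fun_prop) hAm, Measure.restrict_apply' (MeasurableSet.univ_pi hY)] at h1
  have himage : (fun z i ↦ g i (z i)) '' A =
      (fun x i ↦ h i (x i)) ⁻¹' A ∩ univ.pi fun i ↦ g i '' Z i := by
    ext y
    constructor
    · rintro ⟨x, hx, rfl⟩
      refine ⟨?_, fun i _ ↦ ⟨x i, hA hx i trivial, rfl⟩⟩
      have : (fun i ↦ h i (g i (x i))) = x := funext fun i ↦ hh i _ (hA hx i trivial)
      rwa [mem_preimage, this]
    · rintro ⟨h1, h2⟩
      choose x hx hxy using fun i ↦ h2 i trivial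
      refine ⟨x, ?_, funext hxy⟩
      have : (fun i ↦ h i (y i)) = x := funext fun i ↦ by rw [← hxy i, hh i _ (hx i)]
      rwa [mem_preimage, this] at h1
  rw [himage]
  exact h1

end Pi

/-! ### Images under nearly equal maps -/

/-- The hypothesis makes `a ∘ b⁻¹` well defined on `b '' E` and close to the identity in the sense
of `ApproximatesLinearOn`, so it enlarges volumes at most by `t`. The hypothesis is symmetric in `a`
and `b`, which gives the other inequality. The constant `θ` does not depend on `E`, and `E` need not
be measurable. -/
theorem eqUpTo_addHaar_image {H : Type*} [NormedAddCommGroup H] [NormedSpace ℝ H]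
    [FiniteDimensional ℝ H] [MeasurableSpace H] [BorelSpace H] (μ : Measure H) [μ.IsAddHaarMeasure]
    {t : ℝ≥0} (ht : 1 < t) (α : Type*) :
    ∃ θ : ℝ, 0 < θ ∧ ∀ (E : Set α) (a b : α → H),
      (∀ x ∈ E, ∀ y ∈ E,
        ‖(a x - a y) - (b x - b y)‖ ≤ θ * max ‖a x - a y‖ ‖b x - b y‖) →
      EqUpTo t (μ (a '' E)) (μ (b '' E)) := by
  have hdet : ENNReal.ofReal |(ContinuousLinearMap.id ℝ H).det| < t := by
    simpa [ContinuousLinearMap.det] using ht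
  obtain ⟨δ, hδ, hδ0⟩ := ((addHaar_image_le_mul_of_det_lt μ (ContinuousLinearMap.id ℝ H) hdet).and
    self_mem_nhdsWithin).exists
  have hδ0' : (0 : ℝ) < δ := hδ0
  -- The bound `1 / 2` forces the increments of `a` to be at most twice those of `b`. The maximum is
  -- then at most twice the increment of `b`, and `δ / 2` becomes `δ`.
  refine ⟨min (δ / 2) (1 / 2), by positivity, ?_⟩
  have key : ∀ (E : Set α) (a b : α → H), (∀ x ∈ E, ∀ y ∈ E,
        ‖(a x - a y) - (b x - b y)‖ ≤ min (δ / 2 : ℝ) (1 / 2) * max ‖a x - a y‖ ‖b x - b y‖) →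
      μ (a '' E) ≤ t * μ (b '' E) := by
    intro E a b h
    rcases E.eq_empty_or_nonempty with rfl | ⟨e, -⟩
    · simp
    have : Nonempty α := ⟨e⟩
    have h2 : ∀ x ∈ E, ∀ y ∈ E, ‖(a x - a y) - (b x - b y)‖ ≤ δ * ‖b x - b y‖ := by
      intro x hx y hy
      have h1 := h x hx y hy
      have h3 : ‖a x - a y‖ ≤ 2 * ‖b x - b y‖ := by
        have h4 : ‖a x - a y‖ ≤ ‖(a x - a y) - (b x - b y)‖ + ‖b x - b y‖ := by
          simpa using norm_add_le ((a x - a y) - (b x - b y)) (b x - b y)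
        rcases le_total ‖a x - a y‖ ‖b x - b y‖ with h5 | h5
        · linarith [norm_nonneg (b x - b y)]
        · rw [max_eq_left h5] at h1
          have : min (δ / 2 : ℝ) (1 / 2) * ‖a x - a y‖ ≤ 1 / 2 * ‖a x - a y‖ := by
            gcongr
            exact min_le_right _ _
          linarith
      have h4 : max ‖a x - a y‖ ‖b x - b y‖ ≤ 2 * ‖b x - b y‖ :=
        max_le h3 (by linarith [norm_nonneg (b x - b y)])
      calc _ ≤ min (δ / 2 : ℝ) (1 / 2) * max ‖a x - a y‖ ‖b x - b y‖ := h1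
        _ ≤ (δ / 2 : ℝ) * (2 * ‖b x - b y‖) := by
            gcongr
            exact min_le_left _ _
        _ = δ * ‖b x - b y‖ := by ring
    have hinj : ∀ x ∈ E, ∀ y ∈ E, b x = b y → a x = a y := by
      intro x hx y hy hxy
      have := h2 x hx y hy
      rw [hxy] at this
      simpa [sub_eq_zero] using this
    let f : H → H := fun y ↦ a (Function.invFunOn b E y)
    have hf : ∀ x ∈ E, f (b x) = a x := fun x hx ↦
      hinj _ (Function.invFunOn_mem ⟨x, hx, rfl⟩) x hx (Function.invFunOn_eq ⟨x, hx, rfl⟩)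
    have hfa : ApproximatesLinearOn f (ContinuousLinearMap.id ℝ H) (b '' E) δ := by
      rintro _ ⟨x, hx, rfl⟩ _ ⟨y, hy, rfl⟩
      rw [hf x hx, hf y hy]
      exact h2 x hx y hy
    have := hδ (b '' E) f hfa
    rwa [image_image, image_congr hf] at this
  intro E a b h
  refine ⟨key E a b h, key E b a fun x hx y hy ↦ ?_⟩
  rw [norm_sub_rev, max_comm]
  exact h x hx y hy

/-! ### The coarea formula for surjective linear maps -/

section LinearCoarea

variable {X Y : Type*} [NormedAddCommGroup X] [InnerProductSpace ℝ X] [FiniteDimensional ℝ X]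

section KerProj

variable [NormedAddCommGroup Y] [NormedSpace ℝ Y]

/-- The orthogonal projection onto the kernel of `A`. -/
def kerProj (A : X →L[ℝ] Y) : X →L[ℝ] A.ker := A.ker.orthogonalProjectionOnto

/-- A surjective linear map and the orthogonal projection onto its kernel identify the source with
the product of the kernel and the target. -/
def kerProdEquiv [FiniteDimensional ℝ Y] (A : X →L[ℝ] Y) (hA : Function.Surjective A) :
    X ≃L[ℝ] A.ker × Y :=
  (LinearEquiv.ofBijective ((kerProj A).prod A).toLinearMap (by
    constructor
    · refine LinearMap.ker_eq_bot.1 (LinearMap.ker_eq_bot'.2 fun v hv ↦ ?_)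
      have h1 : kerProj A v = 0 := congrArg Prod.fst hv
      have h2 : A v = 0 := congrArg Prod.snd hv
      have h3 := A.ker.orthogonalProjectionOnto_mem_subspace_eq_self ⟨v, h2⟩
      rw [kerProj] at h1
      simpa [h1] using congrArg Subtype.val h3.symm
    · rintro ⟨u, y⟩
      obtain ⟨x, rfl⟩ := hA y
      refine ⟨x - kerProj A x + u, ?_⟩
      have h1 : ∀ w : A.ker, kerProj A w = w :=
        A.ker.orthogonalProjectionOnto_mem_subspace_eq_self
      have h2 : ∀ w : A.ker, A w = 0 := fun w ↦ w.2
      refine Prod.ext ?_ ?_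
      · simp [h1]
      · simp [h2])).toContinuousLinearEquiv

@[simp]
theorem kerProdEquiv_apply [FiniteDimensional ℝ Y] (A : X →L[ℝ] Y) (hA : Function.Surjective A)
    (c : X) : kerProdEquiv A hA c = (kerProj A c, A c) := rfl

theorem norm_kerProj_apply_le (A : X →L[ℝ] Y) (v : X) : ‖kerProj A v‖ ≤ ‖v‖ :=
  A.ker.norm_orthogonalProjectionOnto_apply_le v

/-- The part of `v` outside the kernel is recovered linearly from `A v`. The constant is the norm of
that inverse, increased by one to be positive. A vector with small `A v` is therefore controlled by
its projection onto the kernel. -/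
theorem exists_norm_le_add_mul [FiniteDimensional ℝ Y] (A : X →L[ℝ] Y)
    (hA : Function.Surjective A) : ∃ κ : ℝ, 0 < κ ∧ ∀ v, ‖v‖ ≤ ‖kerProj A v‖ + κ * ‖A v‖ := by
  refine ⟨‖((kerProdEquiv A hA).symm : A.ker × Y →L[ℝ] X)‖ + 1, by positivity, fun v ↦ ?_⟩
  have h1 : v = kerProj A v + (kerProdEquiv A hA).symm (0, A v) := by
    apply (kerProdEquiv A hA).injective
    rw [map_add, ContinuousLinearEquiv.apply_symm_apply]
    have h1 : kerProj A (kerProj A v) = kerProj A v :=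
      A.ker.orthogonalProjectionOnto_mem_subspace_eq_self _
    have h2 : A (kerProj A v) = 0 := (kerProj A v).2
    simp [h1, h2]
  have h2 : ‖(kerProdEquiv A hA).symm (0, A v)‖ ≤
      ‖((kerProdEquiv A hA).symm : A.ker × Y →L[ℝ] X)‖ * ‖A v‖ := by
    refine (((kerProdEquiv A hA).symm : A.ker × Y →L[ℝ] X).le_opNorm _).trans_eq ?_
    simp [Prod.norm_def]
  calc ‖v‖ ≤ ‖(kerProj A v : X)‖ + ‖(kerProdEquiv A hA).symm (0, A v)‖ := by
        conv_lhs => rw [h1]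
        exact norm_add_le _ _
    _ ≤ _ := by
        have := norm_nonneg (A v)
        rw [Submodule.coe_norm]
        nlinarith

end KerProj

section Inner

variable [NormedAddCommGroup Y] [InnerProductSpace ℝ Y] [FiniteDimensional ℝ Y]

/-- Since `A` only sees the component orthogonal to its kernel, its adjoint takes values in that
complement. This reduces `A A^*` to an isomorphism. -/
theorem adjoint_apply_eq_coe_adjoint (A : X →L[ℝ] Y) (y : Y) :
    LinearMap.adjoint (A : X →ₗ[ℝ] Y) y =
      (LinearMap.adjoint ((A : X →ₗ[ℝ] Y) ∘ₗ A.kerᗮ.subtype) y : X) := by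
  refine ext_inner_right ℝ fun v ↦ ?_
  have hv : A v = A (A.kerᗮ.orthogonalProjectionOnto v) := by
    have h1 : v - A.kerᗮ.starProjection v ∈ A.kerᗮᗮ := A.kerᗮ.sub_starProjection_mem_orthogonal v
    rw [Submodule.orthogonal_orthogonal] at h1
    have h2 : A (v - A.kerᗮ.starProjection v) = 0 := h1
    rw [map_sub, sub_eq_zero] at h2
    exact h2
  rw [LinearMap.adjoint_inner_left, ← Submodule.inner_orthogonalProjectionOnto_eq_of_mem_left,
    LinearMap.adjoint_inner_left]
  simp only [ContinuousLinearMap.coe_coe, LinearMap.coe_comp, Function.comp_apply,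
    Submodule.subtype_apply]
  rw [hv]

/-- A surjective linear map restricts to an isomorphism on the complement of its kernel. -/
def complEquiv (A : X →L[ℝ] Y) (hA : Function.Surjective A) : A.kerᗮ ≃ₗ[ℝ] Y :=
  LinearEquiv.ofBijective ((A : X →ₗ[ℝ] Y) ∘ₗ A.kerᗮ.subtype) (by
    constructor
    · refine LinearMap.ker_eq_bot.1 (LinearMap.ker_eq_bot'.2 fun v hv ↦ ?_)
      have h1 : (v : X) ∈ A.ker := hv
      have h2 : (v : X) ∈ A.ker ⊓ A.kerᗮ := ⟨h1, v.2⟩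
      rw [Submodule.inf_orthogonal_eq_bot] at h2
      exact Subtype.ext h2
    · intro y
      obtain ⟨x, rfl⟩ := hA y
      refine ⟨A.kerᗮ.orthogonalProjectionOnto x, ?_⟩
      have h1 : x - A.kerᗮ.starProjection x ∈ A.kerᗮᗮ := A.kerᗮ.sub_starProjection_mem_orthogonal x
      rw [Submodule.orthogonal_orthogonal] at h1
      have h2 : A (x - A.kerᗮ.starProjection x) = 0 := h1
      rw [map_sub, sub_eq_zero] at h2
      exact h2.symm)

@[simp]
theorem complEquiv_apply (A : X →L[ℝ] Y) (hA : Function.Surjective A) (w : A.kerᗮ) :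
    complEquiv A hA w = A w := rfl

/-- With `g` the restriction of `A` to the complement of the kernel, `A A^* = g g^*`. This is
conjugate under `g` to `g^* g`, whose determinant is the square of the volume distortion of `g`. -/
theorem sqrtDet_eq_normDet (A : X →L[ℝ] Y) (hA : Function.Surjective A) :
    sqrtDet A = (complEquiv A hA : A.kerᗮ →ₗ[ℝ] Y).normDet := by
  set g : A.kerᗮ →ₗ[ℝ] Y := (complEquiv A hA : A.kerᗮ →ₗ[ℝ] Y) with hg
  have h1 : (A : X →ₗ[ℝ] Y) ∘ₗ LinearMap.adjoint (A : X →ₗ[ℝ] Y) = g ∘ₗ LinearMap.adjoint g := by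
    ext y
    simp only [LinearMap.coe_comp, Function.comp_apply, adjoint_apply_eq_coe_adjoint]
    rfl
  have h2 : LinearMap.det (g ∘ₗ LinearMap.adjoint g) = LinearMap.det (LinearMap.adjoint g ∘ₗ g) := by
    rw [← LinearMap.det_conj (LinearMap.adjoint g ∘ₗ g) (complEquiv A hA)]
    congr 1
    ext y
    simp [hg]
  have h3 := g.normDet_sq
  rw [sqrtDet, h1, h2, ← h3]
  simp [Real.sqrt_sq g.normDet_nonneg]

theorem sqrtDet_pos (A : X →L[ℝ] Y) (hA : Function.Surjective A) : 0 < sqrtDet A := by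
  rw [sqrtDet_eq_normDet A hA]
  refine (LinearMap.normDet_nonneg _).lt_of_ne' fun h ↦ ?_
  rw [LinearMap.normDet_eq_zero_iff_ker_ne_bot] at h
  exact h (LinearEquiv.ker _)

theorem surjective_of_sqrtDet_ne_zero {A : X →L[ℝ] Y} (h : sqrtDet A ≠ 0) :
    Function.Surjective A := by
  have h1 : LinearMap.det ((A : X →ₗ[ℝ] Y) ∘ₗ LinearMap.adjoint (A : X →ₗ[ℝ] Y)) ≠ 0 := by
    intro h0
    rw [sqrtDet, h0, Real.sqrt_zero] at h
    exact h rfl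
  have h2 := (LinearMap.isUnit_iff_isUnit_det _).2 h1.isUnit
  have h3 := ((Module.End.isUnit_iff _).1 h2).2
  exact Function.Surjective.of_comp h3

theorem finrank_compl_eq (A : X →L[ℝ] Y) (hA : Function.Surjective A) :
    finrank ℝ A.kerᗮ = finrank ℝ Y := (complEquiv A hA).finrank_eq

theorem image_ball_eq (A : X →L[ℝ] Y) (hA : Function.Surjective A) (r : ℝ) :
    A '' Metric.ball 0 r = complEquiv A hA '' Metric.ball 0 r := by
  ext y
  constructor
  · rintro ⟨x, hx, rfl⟩
    refine ⟨A.kerᗮ.orthogonalProjectionOnto x, ?_, ?_⟩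
    · rw [mem_ball_zero_iff] at hx ⊢
      exact (A.kerᗮ.norm_orthogonalProjectionOnto_apply_le x).trans_lt hx
    · have h1 : x - A.kerᗮ.starProjection x ∈ A.kerᗮᗮ :=
        A.kerᗮ.sub_starProjection_mem_orthogonal x
      rw [Submodule.orthogonal_orthogonal] at h1
      have h2 : A (x - A.kerᗮ.starProjection x) = 0 := h1
      rw [map_sub, sub_eq_zero] at h2
      exact h2.symm
  · rintro ⟨w, hw, rfl⟩
    exact ⟨w, by simpa using hw, rfl⟩

variable [MeasurableSpace X] [BorelSpace X] [MeasurableSpace Y] [BorelSpace Y]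

theorem volume_image_complEquiv (A : X →L[ℝ] Y) (hA : Function.Surjective A) (s : Set A.kerᗮ) :
    volume (complEquiv A hA '' s) = ENNReal.ofReal (sqrtDet A) * volume s := by
  have h := LinearMap.euclideanHausdorffMeasure_image_eq_normDet_mul_volume
    (complEquiv A hA : A.kerᗮ →ₗ[ℝ] Y) s
  rw [finrank_compl_eq A hA, InnerProductSpace.euclideanHausdorffMeasure_eq_volume,
    ← sqrtDet_eq_normDet] at h
  exact h

/-- The linear coarea formula in measure form: volume splits orthogonally over the kernel and its
complement, and `A` scales volume on the complement by `sqrtDet A`. -/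
theorem map_kerProdEquiv_volume (A : X →L[ℝ] Y) (hA : Function.Surjective A) :
    (volume : Measure X).map (kerProdEquiv A hA) =
      (ENNReal.ofReal (sqrtDet A))⁻¹ • (volume : Measure A.ker).prod (volume : Measure Y) := by
  have hpos := sqrtDet_pos A hA
  set g := (complEquiv A hA).toContinuousLinearEquiv with hg
  have hgv : (volume : Measure A.kerᗮ).map g =
      (ENNReal.ofReal (sqrtDet A))⁻¹ • (volume : Measure Y) := by
    ext s hs
    rw [Measure.map_apply g.continuous.measurable hs, Measure.smul_apply, smul_eq_mul]
    have h1 := volume_image_complEquiv A hA (g ⁻¹' s)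
    have h2 : complEquiv A hA '' (g ⁻¹' s) = s := image_preimage_eq s g.surjective
    rw [h2] at h1
    rw [h1, ← mul_assoc, ENNReal.inv_mul_cancel (by simpa using hpos) ENNReal.ofReal_ne_top,
      one_mul]
  have h0 := A.ker.measurePreserving_measurableEquivProd (0 : X)
  rw [InnerProductSpace.euclideanHausdorffMeasure_eq_volume] at h0
  have hfun : ⇑(kerProdEquiv A hA) = Prod.map id g ∘ A.ker.measurableEquivProd (0 : X) := by
    ext c
    · simp [kerProj]
    · have h1 : c - A.kerᗮ.starProjection c ∈ A.kerᗮᗮ :=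
        A.kerᗮ.sub_starProjection_mem_orthogonal c
      rw [Submodule.orthogonal_orthogonal] at h1
      have h2 : A (c - A.kerᗮ.starProjection c) = 0 := h1
      rw [map_sub, sub_eq_zero] at h2
      simpa [hg] using h2
  rw [hfun, ← Measure.map_map (by fun_prop) h0.measurable, h0.map_eq, Measure.volume_eq_prod,
    ← Measure.map_prod_map _ _ measurable_id g.continuous.measurable, Measure.map_id, hgv,
    Measure.prod_smul_right]

theorem volume_ball_eq_volume_ball_euclideanSpace (r : ℝ) :
    volume (Metric.ball (0 : Y) r) =
      volume (Metric.ball (0 : EuclideanSpace ℝ (Fin (finrank ℝ Y))) r) := by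
  rw [← (stdOrthonormalBasis ℝ Y).measurePreserving_repr.measure_preimage
    Metric.isOpen_ball.measurableSet.nullMeasurableSet]
  congr 1
  ext v
  simp

/-- The volume of the image of the unit ball under a linear map. -/
theorem volume_image_ball (A : X →L[ℝ] Y) :
    volume (A '' Metric.ball 0 1) = ENNReal.ofReal (sqrtDet A) *
      volume (Metric.ball (0 : EuclideanSpace ℝ (Fin (finrank ℝ Y))) 1) := by
  by_cases hA : Function.Surjective A
  · rw [image_ball_eq A hA, volume_image_complEquiv, volume_ball_eq_volume_ball_euclideanSpace,
      finrank_compl_eq A hA]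
  · have h0 : sqrtDet A = 0 := by
      by_contra h
      exact hA (surjective_of_sqrtDet_ne_zero h)
    have h1 : A.range ≠ ⊤ := fun h ↦ hA (LinearMap.range_eq_top.1 h)
    rw [h0, ENNReal.ofReal_zero, zero_mul]
    refine measure_mono_null ?_ (Measure.addHaar_submodule volume A.range h1)
    rintro _ ⟨x, -, rfl⟩
    exact ⟨x, rfl⟩

end Inner

end LinearCoarea

/-! ### Behaviour of `√det (ξ ξ^*)` under nearly isometric changes of source and target -/

section Distortion

variable {T T' W W' : Type*}
  [NormedAddCommGroup T] [InnerProductSpace ℝ T] [FiniteDimensional ℝ T]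
  [NormedAddCommGroup T'] [InnerProductSpace ℝ T'] [FiniteDimensional ℝ T']
  [NormedAddCommGroup W] [InnerProductSpace ℝ W] [FiniteDimensional ℝ W]
  [NormedAddCommGroup W'] [InnerProductSpace ℝ W'] [FiniteDimensional ℝ W']

/-- By `volume_image_ball`, `sqrtDet` is the volume of the image of the unit ball relative to that
of a unit ball. As `φ` sends the unit ball into the ball of radius `t`, the image under `ψ ξ φ` lies
in the image of `ξ(ball)` under the map `w ↦ ψ (t w)`, which has Lipschitz constant `t ^ 2`.
Surjectivity of `ξ` plays no role. -/
theorem ofReal_sqrtDet_comp_comp_le {t : ℝ≥0} (ht : 0 < t) (φ : T' →L[ℝ] T) (ψ : W →L[ℝ] W')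
    (hW : finrank ℝ W = finrank ℝ W')
    (hφ : ∀ v, ‖φ v‖ ≤ t * ‖v‖) (hψ : ∀ v, ‖ψ v‖ ≤ t * ‖v‖) (ξ : T →L[ℝ] W) :
    ENNReal.ofReal (sqrtDet (ψ ∘L ξ ∘L φ)) ≤
      ((t ^ 2) ^ finrank ℝ W : ℝ≥0) * ENNReal.ofReal (sqrtDet ξ) := by
  borelize T T' W W'
  set v₀ := volume (Metric.ball (0 : EuclideanSpace ℝ (Fin (finrank ℝ W))) 1) with hv₀
  have h0 : v₀ ≠ 0 := (Metric.measure_ball_pos _ _ one_pos).ne'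
  have h1 : v₀ ≠ ⊤ := measure_ball_lt_top.ne
  have hL : LipschitzWith (t ^ 2) (fun w ↦ ψ ((t : ℝ) • w)) := by
    refine LipschitzWith.of_dist_le_mul fun x y ↦ ?_
    rw [dist_eq_norm, dist_eq_norm, ← map_sub, ← smul_sub]
    refine (hψ _).trans_eq ?_
    rw [norm_smul, Real.norm_of_nonneg t.coe_nonneg]
    push_cast
    ring
  have hsub : (ψ ∘L ξ ∘L φ) '' Metric.ball 0 1 ⊆
      (fun w ↦ ψ ((t : ℝ) • w)) '' (ξ '' Metric.ball 0 1) := by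
    rintro _ ⟨x, hx, rfl⟩
    have ht' : (0 : ℝ) < t := ht
    refine ⟨ξ ((t : ℝ)⁻¹ • φ x), ⟨(t : ℝ)⁻¹ • φ x, ?_, rfl⟩, ?_⟩
    · rw [mem_ball_zero_iff] at hx ⊢
      rw [norm_smul, norm_inv, Real.norm_of_nonneg t.coe_nonneg, inv_mul_lt_iff₀ ht', mul_one]
      calc ‖φ x‖ ≤ t * ‖x‖ := hφ x
        _ < t := by nlinarith
    · simp [smul_smul, ht'.ne']
  have h2 := (measure_mono hsub).trans
    (hL.lipschitzOnWith.euclideanHausdorffMeasure_image_le (s := ξ '' Metric.ball 0 1)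
      (finrank ℝ W))
  rw [InnerProductSpace.euclideanHausdorffMeasure_eq_volume, hW,
    InnerProductSpace.euclideanHausdorffMeasure_eq_volume, volume_image_ball, volume_image_ball,
    ← hW, ← hv₀, ← mul_assoc, ENNReal.mul_le_mul_iff_left h0 h1] at h2
  simpa using h2

theorem eqUpTo_sqrtDet_comp_comp {t : ℝ≥0} (ht : 0 < t) (φ : T' ≃L[ℝ] T) (ψ : W ≃L[ℝ] W')
    (hφ : ∀ v, ‖φ v‖ ≤ t * ‖v‖) (hφ' : ∀ v, ‖φ.symm v‖ ≤ t * ‖v‖)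
    (hψ : ∀ v, ‖ψ v‖ ≤ t * ‖v‖) (hψ' : ∀ v, ‖ψ.symm v‖ ≤ t * ‖v‖) (ξ : T →L[ℝ] W) :
    EqUpTo ((t ^ 2) ^ finrank ℝ W)
      (ENNReal.ofReal (sqrtDet ((ψ : W →L[ℝ] W') ∘L ξ ∘L (φ : T' →L[ℝ] T))))
      (ENNReal.ofReal (sqrtDet ξ)) := by
  have hW : finrank ℝ W = finrank ℝ W' := ψ.toLinearEquiv.finrank_eq
  refine ⟨ofReal_sqrtDet_comp_comp_le ht _ _ hW hφ hψ ξ, ?_⟩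
  have h := ofReal_sqrtDet_comp_comp_le ht (φ.symm : T →L[ℝ] T') (ψ.symm : W' →L[ℝ] W) hW.symm
    hφ' hψ' ((ψ : W →L[ℝ] W') ∘L ξ ∘L (φ : T' →L[ℝ] T))
  rw [← hW] at h
  have h1 : (ψ.symm : W' →L[ℝ] W) ∘L ((ψ : W →L[ℝ] W') ∘L ξ ∘L (φ : T' →L[ℝ] T)) ∘L
      (φ.symm : T →L[ℝ] T') = ξ := by
    ext v
    simp
  rwa [h1] at h

theorem continuous_sqrtDet : Continuous (sqrtDet : (T →L[ℝ] W) → ℝ) := by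
  have h : (sqrtDet : (T →L[ℝ] W) → ℝ) = fun ξ ↦
      Real.sqrt (ξ ∘L ContinuousLinearMap.adjoint ξ).det := by
    funext ξ
    rw [sqrtDet, LinearMap.adjoint_eq_toCLM_adjoint]
    rfl
  rw [h]
  have h1 : Continuous fun ξ : T →L[ℝ] W ↦ ξ ∘L ContinuousLinearMap.adjoint ξ :=
    continuous_id.clm_comp (ContinuousLinearMap.adjoint (𝕜 := ℝ) (E := T) (F := W)).continuous
  exact Real.continuous_sqrt.comp (ContinuousLinearMap.continuous_det.comp h1)

end Distortion

/-! ### Fibre integrals of linear maps -/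

theorem setLIntegral_comp_isometry {α β : Type*} [MetricSpace α] [MeasurableSpace α] [BorelSpace α]
    [MetricSpace β] [MeasurableSpace β] [BorelSpace β] [CompleteSpace α] {i : α → β}
    (hi : Isometry i) (q : ℕ) {S : Set β} (hS : S ⊆ range i) (F : β → ℝ≥0∞) :
    ∫⁻ u in i ⁻¹' S, F (i u) ∂μHE[q] = ∫⁻ c in S, F c ∂μHE[q] := by
  have he : MeasurableEmbedding i := hi.isClosedEmbedding.measurableEmbedding
  rw [← he.lintegral_map, ← he.restrict_map, hi.map_euclideanHausdorffMeasure,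
    Measure.restrict_restrict_of_subset hS]

section Fiber

variable {X Y : Type*} [NormedAddCommGroup X] [InnerProductSpace ℝ X] [FiniteDimensional ℝ X]
  [MeasurableSpace X] [BorelSpace X]
  [NormedAddCommGroup Y] [NormedSpace ℝ Y] [FiniteDimensional ℝ Y]
  [MeasurableSpace Y] [BorelSpace Y]

/-- The constant of the coarea formula for the linear map `A` and the measure `ν` on its target:
the inverse of the volume distortion of `A` on the complement of its kernel. -/
def coareaConst {X : Type*} [NormedAddCommGroup X] [InnerProductSpace ℝ X]
    (A : X →L[ℝ] Y) (ν : Measure Y) : ℝ≥0∞ :=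
  volume (Metric.ball (0 : EuclideanSpace ℝ (Fin (finrank ℝ Y))) 1) / ν (A '' Metric.ball 0 1)

theorem isometry_add_const {Z : Type*} [NormedAddCommGroup Z] [InnerProductSpace ℝ Z]
    (N : Submodule ℝ Z) (x : Z) : Isometry fun u : N ↦ (u : Z) + x :=
  Isometry.of_dist_eq fun u v ↦ by simp [Subtype.dist_eq]

theorem setLIntegral_fiber (A : X →L[ℝ] Y) (x : X) (F : X → ℝ≥0∞) :
    ∫⁻ c in A ⁻¹' {A x}, F c ∂μHE[finrank ℝ A.ker] = ∫⁻ u : A.ker, F (u + x) := by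
  have h := setLIntegral_comp_isometry (isometry_add_const A.ker x) (finrank ℝ A.ker)
    (S := A ⁻¹' {A x}) (fun c hc ↦ ⟨⟨c - x, ?_⟩, ?_⟩) F
  · rw [← h, InnerProductSpace.euclideanHausdorffMeasure_eq_volume]
    have : (fun u : A.ker ↦ (u : X) + x) ⁻¹' (A ⁻¹' {A x}) = univ := by
      refine eq_univ_of_forall fun u ↦ ?_
      have hu : A u = 0 := u.2
      simp [hu]
    rw [this, Measure.restrict_univ]
  · have hc' : A c = A x := hc
    simp [hc']
  · simp

theorem kerProdEquiv_symm_apply (A : X →L[ℝ] Y) (hA : Function.Surjective A) (u : A.ker) (y : Y) :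
    (kerProdEquiv A hA).symm (u, y) = u + (kerProdEquiv A hA).symm (0, y) := by
  apply (kerProdEquiv A hA).injective
  rw [map_add, ContinuousLinearEquiv.apply_symm_apply, ContinuousLinearEquiv.apply_symm_apply]
  have h1 : kerProj A u = u := A.ker.orthogonalProjectionOnto_mem_subspace_eq_self u
  have h2 : A u = 0 := u.2
  simp [h1, h2]

theorem apply_kerProdEquiv_symm (A : X →L[ℝ] Y) (hA : Function.Surjective A) (p : A.ker × Y) :
    A ((kerProdEquiv A hA).symm p) = p.2 :=
  congrArg Prod.snd ((kerProdEquiv A hA).apply_symm_apply p)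

/-- All fibres are parametrised by the one space `A.ker`, so a fibre integral becomes a section
integral on a product, to which Tonelli's theorem applies. -/
theorem setLIntegral_fiber_eq_kerProdEquiv (A : X →L[ℝ] Y) (hA : Function.Surjective A) (y : Y)
    (F : X → ℝ≥0∞) :
    ∫⁻ c in A ⁻¹' {y}, F c ∂μHE[finrank ℝ A.ker] =
      ∫⁻ u : A.ker, F ((kerProdEquiv A hA).symm (u, y)) := by
  have h := setLIntegral_fiber A ((kerProdEquiv A hA).symm (0, y)) F
  rw [apply_kerProdEquiv_symm] at h
  rw [h]
  exact lintegral_congr fun u ↦ by rw [kerProdEquiv_symm_apply A hA u y]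

/-- The kernel is a separate variable `N` because the formula is used for a map that has the same
kernel as another one, without transporting the projection along an equality of types. -/
theorem map_prod_orthogonalProjectionOnto {Z : Type*} [NormedAddCommGroup Z]
    [InnerProductSpace ℝ Z] [FiniteDimensional ℝ Z] [MeasurableSpace Z] [BorelSpace Z]
    (A : X →L[ℝ] Z) (hA : Function.Surjective A) {N : Submodule ℝ X} (hN : N = A.ker) :
    (volume : Measure X).map (fun c ↦ (N.orthogonalProjectionOnto c, A c)) =
      (ENNReal.ofReal (sqrtDet A))⁻¹ • (volume : Measure N).prod (volume : Measure Z) := by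
  subst hN
  exact map_kerProdEquiv_volume A hA

/-- A linear coordinate system on the target of `A`, in which `ν` is a multiple of Lebesgue
measure. -/
theorem exists_euclidean_coordinates (ν : Measure Y) [ν.IsAddHaarMeasure] :
    ∃ (e : Y ≃L[ℝ] EuclideanSpace ℝ (Fin (finrank ℝ Y))) (r : ℝ≥0), r ≠ 0 ∧
      ν.map e = r • (volume : Measure (EuclideanSpace ℝ (Fin (finrank ℝ Y)))) := by
  let e : Y ≃L[ℝ] EuclideanSpace ℝ (Fin (finrank ℝ Y)) :=
    ContinuousLinearEquiv.ofFinrankEq (by simp)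
  have : (ν.map e).IsAddHaarMeasure := e.isAddHaarMeasure_map ν
  refine ⟨e, _, ?_, Measure.isAddLeftInvariant_eq_smul (ν.map e) volume⟩
  exact (Measure.addHaarScalarFactor_pos_of_isAddHaarMeasure _ _).ne'

/-- Reduces a target with an arbitrary Haar measure and norm to Euclidean space. Products of fibres
and spaces of linear maps carry norms that come from no inner product, so `sqrtDet` is not available
for them directly. -/
theorem coareaConst_eq (A : X →L[ℝ] Y) (ν : Measure Y)
    {e : Y ≃L[ℝ] EuclideanSpace ℝ (Fin (finrank ℝ Y))} {r : ℝ≥0}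
    (hν : ν.map e = r • (volume : Measure (EuclideanSpace ℝ (Fin (finrank ℝ Y))))) :
    coareaConst A ν = (r * ENNReal.ofReal
      (sqrtDet ((e : Y →L[ℝ] EuclideanSpace ℝ (Fin (finrank ℝ Y))) ∘L A)))⁻¹ := by
  have h1 : ν (A '' Metric.ball 0 1) = ν.map e (e '' (A '' Metric.ball 0 1)) := by
    have := e.toHomeomorph.toMeasurableEquiv.map_apply (μ := ν) (e '' (A '' Metric.ball 0 1))
    refine (Eq.trans this ?_).symm
    congr 1
    exact preimage_image_eq _ e.injective
  have h2 : e '' (A '' Metric.ball 0 1) =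
      ((e : Y →L[ℝ] EuclideanSpace ℝ (Fin (finrank ℝ Y))) ∘L A) '' Metric.ball 0 1 := by
    rw [image_image]
    rfl
  have h0 : volume (Metric.ball (0 : EuclideanSpace ℝ (Fin (finrank ℝ Y))) 1) ≠ 0 :=
    (Metric.measure_ball_pos _ _ one_pos).ne'
  have h0' : volume (Metric.ball (0 : EuclideanSpace ℝ (Fin (finrank ℝ Y))) 1) ≠ ⊤ :=
    measure_ball_lt_top.ne
  rw [coareaConst, h1, hν, Measure.smul_apply, h2, volume_image_ball, ENNReal.smul_def,
    smul_eq_mul, finrank_euclideanSpace_fin, ← mul_assoc]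
  rw [ENNReal.div_eq_inv_mul, ENNReal.mul_inv (Or.inr h0') (Or.inr h0), mul_assoc,
    ENNReal.inv_mul_cancel h0 h0', mul_one]

theorem coareaConst_pos_and_lt_top (A : X →L[ℝ] Y) (hA : Function.Surjective A)
    (ν : Measure Y) [ν.IsAddHaarMeasure] : coareaConst A ν ≠ 0 ∧ coareaConst A ν ≠ ⊤ := by
  obtain ⟨e, r, hr, hν⟩ := exists_euclidean_coordinates ν
  have h := sqrtDet_pos ((e : Y →L[ℝ] EuclideanSpace ℝ (Fin (finrank ℝ Y))) ∘L A)
    (e.surjective.comp hA)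
  rw [coareaConst_eq A ν hν]
  constructor
  · exact ENNReal.inv_ne_zero.2 (ENNReal.mul_ne_top ENNReal.coe_ne_top ENNReal.ofReal_ne_top)
  · refine ENNReal.inv_ne_top.2 (mul_ne_zero (by exact_mod_cast hr) ?_)
    simpa using h

theorem map_kerProdEquiv (A : X →L[ℝ] Y) (hA : Function.Surjective A)
    (ν : Measure Y) [ν.IsAddHaarMeasure] :
    (volume : Measure X).map (kerProdEquiv A hA) =
      coareaConst A ν • (volume : Measure A.ker).prod ν := by
  obtain ⟨e, r, hr, hν⟩ := exists_euclidean_coordinates ν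
  set E := EuclideanSpace ℝ (Fin (finrank ℝ Y))
  set A' : X →L[ℝ] E := (e : Y →L[ℝ] E) ∘L A with hA'
  have hker : A.ker = A'.ker := by
    ext v
    simp [hA']
  have h1 := map_prod_orthogonalProjectionOnto A' (e.surjective.comp hA) hker
  have h2 : ⇑(kerProdEquiv A hA) =
      Prod.map id e.symm ∘ fun c ↦ (A.ker.orthogonalProjectionOnto c, A' c) := by
    ext c
    · rfl
    · simp [hA']
  have h3 : (volume : Measure E).map e.symm = (r : ℝ≥0∞)⁻¹ • ν := by
    have h4 : ν = (ν.map e).map e.symm := by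
      rw [Measure.map_map e.symm.continuous.measurable e.continuous.measurable]
      simp
    rw [h4, hν, Measure.map_smul, ENNReal.smul_def, smul_smul,
      ENNReal.inv_mul_cancel (by exact_mod_cast hr) ENNReal.coe_ne_top, one_smul]
  rw [h2, ← Measure.map_map (measurable_id.prodMap e.symm.continuous.measurable) (by fun_prop), h1,
    Measure.map_smul, ← Measure.map_prod_map _ _ measurable_id e.symm.continuous.measurable,
    Measure.map_id, h3, Measure.prod_smul_right, smul_smul, coareaConst_eq A ν hν,
    ENNReal.mul_inv (Or.inr ENNReal.ofReal_ne_top) (Or.inl ENNReal.coe_ne_top), mul_comm]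

theorem measurable_setLIntegral_fiber (A : X →L[ℝ] Y) (hA : Function.Surjective A)
    {F : X → ℝ≥0∞} (hF : Measurable F) :
    Measurable fun y ↦ ∫⁻ c in A ⁻¹' {y}, F c ∂μHE[finrank ℝ A.ker] := by
  simp_rw [setLIntegral_fiber_eq_kerProdEquiv A hA]
  exact Measurable.lintegral_prod_left' (f := fun p ↦ F ((kerProdEquiv A hA).symm p))
    (hF.comp (kerProdEquiv A hA).symm.continuous.measurable)

theorem lintegral_eq_coareaConst_mul (A : X →L[ℝ] Y) (hA : Function.Surjective A)
    (ν : Measure Y) [ν.IsAddHaarMeasure] {F : X → ℝ≥0∞} (hF : Measurable F) :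
    ∫⁻ c, F c = coareaConst A ν *
      ∫⁻ y, ∫⁻ c in A ⁻¹' {y}, F c ∂μHE[finrank ℝ A.ker] ∂ν := by
  have hm : Measurable fun p ↦ F ((kerProdEquiv A hA).symm p) :=
    hF.comp (kerProdEquiv A hA).symm.continuous.measurable
  have h1 : ∫⁻ c, F c = ∫⁻ p, F ((kerProdEquiv A hA).symm p)
      ∂((volume : Measure X).map (kerProdEquiv A hA)) := by
    rw [lintegral_map hm (kerProdEquiv A hA).continuous.measurable]
    simp_rw [ContinuousLinearEquiv.symm_apply_apply]
  rw [h1, map_kerProdEquiv A hA ν, lintegral_smul_measure, smul_eq_mul,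
    lintegral_prod_symm _ hm.aemeasurable]
  simp_rw [setLIntegral_fiber_eq_kerProdEquiv A hA]

theorem coareaConst_volume {Z : Type*} [NormedAddCommGroup Z]
    [InnerProductSpace ℝ Z] [FiniteDimensional ℝ Z] [MeasurableSpace Z] [BorelSpace Z]
    (A : X →L[ℝ] Z) : coareaConst A volume = (ENNReal.ofReal (sqrtDet A))⁻¹ := by
  have h0 : volume (Metric.ball (0 : EuclideanSpace ℝ (Fin (finrank ℝ Z))) 1) ≠ 0 :=
    (Metric.measure_ball_pos _ _ one_pos).ne'
  have h0' : volume (Metric.ball (0 : EuclideanSpace ℝ (Fin (finrank ℝ Z))) 1) ≠ ⊤ :=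
    measure_ball_lt_top.ne
  rw [coareaConst, volume_image_ball, ENNReal.div_eq_inv_mul,
    ENNReal.mul_inv (Or.inr h0') (Or.inr h0), mul_assoc, ENNReal.inv_mul_cancel h0 h0', mul_one]

/-- The coarea constant is continuous at surjective linear maps. -/
theorem eventually_eqUpTo_coareaConst (A : X →L[ℝ] Y) (hA : Function.Surjective A)
    (ν : Measure Y) [ν.IsAddHaarMeasure] {t : ℝ≥0} (ht : 1 < t) :
    ∀ᶠ A' in 𝓝 A, EqUpTo t (coareaConst A' ν) (coareaConst A ν) := by
  obtain ⟨e, r, hr, hν⟩ := exists_euclidean_coordinates ν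
  set E := EuclideanSpace ℝ (Fin (finrank ℝ Y))
  have h1 : Continuous fun A' : X →L[ℝ] Y ↦ sqrtDet ((e : Y →L[ℝ] E) ∘L A') :=
    continuous_sqrtDet.comp (continuous_const.clm_comp continuous_id)
  filter_upwards [eventually_eqUpTo (sqrtDet_pos _ (e.surjective.comp hA)) (h1.tendsto A) ht]
    with A' hA'
  rw [coareaConst_eq A' ν hν, coareaConst_eq A ν hν]
  exact (hA'.const_mul _).inv (zero_lt_one.trans ht).ne'

end Fiber

/-! ### The density of the image of `ρ dc` under a surjective linear map -/

section Density

variable {d : ℕ} {Y ι : Type*} [NormedAddCommGroup Y] [NormedSpace ℝ Y] [FiniteDimensional ℝ Y]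
  [MeasurableSpace Y] [BorelSpace Y] [Fintype ι] [DecidableEq ι]

/-- In the coordinates of `B`, the measure `B.addHaar` is Lebesgue measure and `A` becomes a map of
Euclidean spaces with the same matrix `a`, for which `A A^*` has matrix `a aᵀ`. This identifies the
normalisation in `fiberDensity` with the coarea constant. -/
theorem coareaConst_basis (B : Basis ι ℝ Y) (A : EuclideanSpace ℝ (Fin d) →L[ℝ] Y) :
    coareaConst A B.addHaar = (ENNReal.ofReal (Real.sqrt
      (LinearMap.toMatrix (EuclideanSpace.basisFun (Fin d) ℝ).toBasis B A *
        (LinearMap.toMatrix (EuclideanSpace.basisFun (Fin d) ℝ).toBasis B A).transpose).det))⁻¹ := by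
  let e : Y ≃L[ℝ] EuclideanSpace ℝ ι :=
    (B.equivFun.trans (WithLp.linearEquiv 2 ℝ (ι → ℝ)).symm).toContinuousLinearEquiv
  set A' : EuclideanSpace ℝ (Fin d) →L[ℝ] EuclideanSpace ℝ ι :=
    (e : Y →L[ℝ] EuclideanSpace ℝ ι) ∘L A with hA'
  have hB : B.map (e : Y ≃ₗ[ℝ] EuclideanSpace ℝ ι) = (EuclideanSpace.basisFun ι ℝ).toBasis := by
    refine Basis.eq_of_apply_eq fun i ↦ ?_
    ext j
    simp [e, Finsupp.single_apply, eq_comm]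
  have hmap : B.addHaar.map e = volume := by
    rw [B.map_addHaar, hB, OrthonormalBasis.addHaar_eq_volume]
  have h1 : B.addHaar (A '' Metric.ball 0 1) = volume (A' '' Metric.ball 0 1) := by
    rw [← hmap]
    have := e.toHomeomorph.toMeasurableEquiv.map_apply (μ := B.addHaar) (A' '' Metric.ball 0 1)
    refine Eq.trans ?_ this.symm
    congr 1
    have h2 : A' '' Metric.ball 0 1 = e '' (A '' Metric.ball 0 1) := by
      rw [image_image]
      rfl
    rw [h2]
    exact (preimage_image_eq _ e.injective).symm
  have hdim : finrank ℝ Y = finrank ℝ (EuclideanSpace ℝ ι) := e.toLinearEquiv.finrank_eq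
  have h2 : coareaConst A B.addHaar = coareaConst A' volume := by
    rw [coareaConst, coareaConst, h1]
    exact congrArg (fun q : ℕ ↦ volume (Metric.ball (0 : EuclideanSpace ℝ (Fin q)) 1) / _) hdim
  rw [h2, coareaConst_volume, sqrtDet]
  congr 3
  have h3 : LinearMap.toMatrix (EuclideanSpace.basisFun (Fin d) ℝ).toBasis B A =
      LinearMap.toMatrix (EuclideanSpace.basisFun (Fin d) ℝ).toBasis
        (EuclideanSpace.basisFun ι ℝ).toBasis (A' : EuclideanSpace ℝ (Fin d) →ₗ[ℝ] _) := by
    ext i j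
    simp [LinearMap.toMatrix_apply, hA', e]
  rw [h3, ← LinearMap.det_toMatrix (EuclideanSpace.basisFun ι ℝ).toBasis,
    LinearMap.toMatrix_comp _ (EuclideanSpace.basisFun (Fin d) ℝ).toBasis,
    LinearMap.toMatrix_adjoint, Matrix.conjTranspose_eq_transpose_of_trivial]

theorem card_basis_add_finrank_ker (B : Basis ι ℝ Y) (A : EuclideanSpace ℝ (Fin d) →L[ℝ] Y)
    (hA : Function.Surjective A) : d - Fintype.card ι = finrank ℝ A.ker := by
  have h1 := LinearMap.finrank_range_add_finrank_ker (A : EuclideanSpace ℝ (Fin d) →ₗ[ℝ] Y)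
  rw [LinearMap.range_eq_top.2 hA, finrank_top, finrank_eq_card_basis B,
    finrank_euclideanSpace_fin] at h1
  omega

theorem fiberDensity_eq (B : Basis ι ℝ Y) (A : EuclideanSpace ℝ (Fin d) →L[ℝ] Y)
    (hA : Function.Surjective A) (ρ : EuclideanSpace ℝ (Fin d) → ℝ) (y : Y) :
    fiberDensity B (A : EuclideanSpace ℝ (Fin d) →ₗ[ℝ] Y) ρ y = coareaConst A B.addHaar *
      ∫⁻ c in A ⁻¹' {y}, ENNReal.ofReal (ρ c) ∂μHE[finrank ℝ A.ker] := by
  rw [coareaConst_basis, ← card_basis_add_finrank_ker B A hA]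
  rfl

/-- The push-forward of `ρ dc` under a surjective linear map has the fibre integrals of `ρ` as its
density. -/
theorem map_withDensity_eq_withDensity_fiberDensity (B : Basis ι ℝ Y)
    (A : EuclideanSpace ℝ (Fin d) →L[ℝ] Y)
    (hA : Function.Surjective A) {ρ : EuclideanSpace ℝ (Fin d) → ℝ} (hρ : Measurable ρ) :
    (volume.withDensity fun c ↦ ENNReal.ofReal (ρ c)).map A =
      B.addHaar.withDensity (fiberDensity B (A : EuclideanSpace ℝ (Fin d) →ₗ[ℝ] Y) ρ) := by
  ext S hS
  have hAS : MeasurableSet (A ⁻¹' S) := A.continuous.measurable hS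
  rw [Measure.map_apply A.continuous.measurable hS, withDensity_apply _ hAS,
    withDensity_apply _ hS, ← lintegral_indicator hAS, ← lintegral_indicator hS,
    lintegral_eq_coareaConst_mul A hA B.addHaar (hρ.ennreal_ofReal.indicator hAS),
    ← lintegral_const_mul _
      (measurable_setLIntegral_fiber A hA (hρ.ennreal_ofReal.indicator hAS))]
  refine lintegral_congr fun y ↦ ?_
  have hm : MeasurableSet (A ⁻¹' {y}) := A.continuous.measurable (measurableSet_singleton y)
  by_cases hy : y ∈ S
  · rw [indicator_of_mem hy, fiberDensity_eq B A hA]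
    congr 1
    refine setLIntegral_congr_fun hm fun c hc ↦ indicator_of_mem ?_ _
    have hc' : A c = y := hc
    rwa [mem_preimage, hc']
  · rw [indicator_of_notMem hy]
    have : ∫⁻ c in A ⁻¹' {y}, (A ⁻¹' S).indicator (fun c ↦ ENNReal.ofReal (ρ c)) c
        ∂μHE[finrank ℝ A.ker] = ∫⁻ c in A ⁻¹' {y}, 0 ∂μHE[finrank ℝ A.ker] := by
      refine setLIntegral_congr_fun hm fun c hc ↦ indicator_of_notMem ?_ _
      have hc' : A c = y := hc
      rwa [mem_preimage, hc']
    rw [this, lintegral_zero, mul_zero]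

end Density

/-! ### Successive disintegration along the two components of a linear map -/

section Disintegration

variable {X Y₁ Y₂ : Type*} [NormedAddCommGroup X] [InnerProductSpace ℝ X] [FiniteDimensional ℝ X]
  [MeasurableSpace X] [BorelSpace X]
  [NormedAddCommGroup Y₁] [NormedSpace ℝ Y₁] [FiniteDimensional ℝ Y₁]
  [MeasurableSpace Y₁] [BorelSpace Y₁]
  [NormedAddCommGroup Y₂] [NormedSpace ℝ Y₂] [FiniteDimensional ℝ Y₂]
  [MeasurableSpace Y₂] [BorelSpace Y₂]

theorem surjective_restrict_ker {A₁ : X →L[ℝ] Y₁} {A₂ : X →L[ℝ] Y₂}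
    (hA : Function.Surjective (A₁.prod A₂)) : Function.Surjective (A₂ ∘L A₁.ker.subtypeL) := by
  intro ξ
  obtain ⟨c, hc⟩ := hA (0, ξ)
  exact ⟨⟨c, congrArg Prod.fst hc⟩, congrArg Prod.snd hc⟩

theorem finrank_ker_restrict_ker (A₁ : X →L[ℝ] Y₁) (A₂ : X →L[ℝ] Y₂)
    (hA : Function.Surjective (A₁.prod A₂)) :
    finrank ℝ (A₂ ∘L A₁.ker.subtypeL).ker = finrank ℝ (A₁.prod A₂).ker := by
  have h1 := LinearMap.finrank_range_add_finrank_ker ((A₂ ∘L A₁.ker.subtypeL) : A₁.ker →ₗ[ℝ] Y₂)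
  have h2 := LinearMap.finrank_range_add_finrank_ker (A₁ : X →ₗ[ℝ] Y₁)
  have h3 := LinearMap.finrank_range_add_finrank_ker (A₁.prod A₂).toLinearMap
  have hA₁ : Function.Surjective A₁ := Prod.fst_surjective.comp hA
  rw [LinearMap.range_eq_top.2 (surjective_restrict_ker hA), finrank_top] at h1
  rw [LinearMap.range_eq_top.2 hA₁, finrank_top] at h2
  rw [LinearMap.range_eq_top.2 hA, finrank_top, finrank_prod] at h3
  omega

/-- The fibre of `A₁` is a translate of `ker A₁`. The coarea formula for `A₂` restricted to that
kernel slices it into the fibres of `(A₁, A₂)`, along each of which `h ∘ A₂` is constant. -/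
theorem setLIntegral_fiber_mul (A₁ : X →L[ℝ] Y₁) (A₂ : X →L[ℝ] Y₂)
    (hA : Function.Surjective (A₁.prod A₂)) (ν : Measure Y₂) [ν.IsAddHaarMeasure] (y : Y₁)
    {F : X → ℝ≥0∞} (hF : Measurable F) {h : Y₂ → ℝ≥0∞} (hh : Measurable h) :
    ∫⁻ c in A₁ ⁻¹' {y}, F c * h (A₂ c) ∂μHE[finrank ℝ A₁.ker] =
      coareaConst (A₂ ∘L A₁.ker.subtypeL) ν *
        ∫⁻ ξ, (∫⁻ c in A₁.prod A₂ ⁻¹' {(y, ξ)}, F c ∂μHE[finrank ℝ (A₁.prod A₂).ker]) * h ξ ∂ν := by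
  obtain ⟨x, hx⟩ : ∃ x, A₁ x = y := (Prod.fst_surjective.comp hA) y
  have ha := surjective_restrict_ker hA
  have hm : Measurable fun u : A₁.ker ↦ F (u + x) * h (A₂ (u + x)) := by
    have : Measurable fun u : A₁.ker ↦ (u : X) + x := by fun_prop
    exact (hF.comp this).mul ((hh.comp A₂.continuous.measurable).comp this)
  have hm' : Measurable fun u : A₁.ker ↦ F (u + x) := by
    have : Measurable fun u : A₁.ker ↦ (u : X) + x := by fun_prop
    exact hF.comp this
  rw [← hx, setLIntegral_fiber, lintegral_eq_coareaConst_mul _ ha ν hm]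
  congr 1
  -- On the translate by `x` the values of `A₂` are shifted by `A₂ x`; invariance of `ν` absorbs the
  -- shift.
  conv_rhs => rw [← lintegral_add_right_eq_self _ (A₂ x)]
  refine lintegral_congr fun ξ ↦ ?_
  have h1 := setLIntegral_comp_isometry (isometry_add_const A₁.ker x)
    (finrank ℝ (A₁.prod A₂).ker) (S := A₁.prod A₂ ⁻¹' {(A₁ x, ξ + A₂ x)})
    (fun c hc ↦ ⟨⟨c - x, ?_⟩, ?_⟩) F
  · have h2 : (fun u : A₁.ker ↦ (u : X) + x) ⁻¹' (A₁.prod A₂ ⁻¹' {(A₁ x, ξ + A₂ x)}) =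
        (A₂ ∘L A₁.ker.subtypeL) ⁻¹' {ξ} := by
      ext u
      have hu : A₁ u = 0 := u.2
      simp [hu]
    have hms : MeasurableSet ((A₂ ∘L A₁.ker.subtypeL) ⁻¹' {ξ}) :=
      (A₂ ∘L A₁.ker.subtypeL).continuous.measurable (measurableSet_singleton ξ)
    rw [← h1, h2, ← finrank_ker_restrict_ker A₁ A₂ hA, ← lintegral_mul_const _ hm']
    refine setLIntegral_congr_fun hms fun u hu ↦ ?_
    have hu' : A₂ u = ξ := hu
    simp [hu']
  · have hc' : A₁ c = A₁ x := congrArg Prod.fst hc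
    simp [hc']
  · simp

/-- The volume of the unit ball is computed in one step by `(A₁, A₂)` and in two steps by `A₁` and
then `A₂` on its kernel. The same integral `J` appears in both, and it is positive and finite
because the volume of the ball and the coarea constant of `(A₁, A₂)` are, so it cancels. -/
theorem coareaConst_prod (A₁ : X →L[ℝ] Y₁) (A₂ : X →L[ℝ] Y₂)
    (hA : Function.Surjective (A₁.prod A₂)) (ν₁ : Measure Y₁) [ν₁.IsAddHaarMeasure]
    (ν₂ : Measure Y₂) [ν₂.IsAddHaarMeasure] :
    coareaConst (A₁.prod A₂) (ν₁.prod ν₂) =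
      coareaConst A₁ ν₁ * coareaConst (A₂ ∘L A₁.ker.subtypeL) ν₂ := by
  have hA₁ : Function.Surjective A₁ := Prod.fst_surjective.comp hA
  set F : X → ℝ≥0∞ := (Metric.ball (0 : X) 1).indicator 1 with hFdef
  have hF : Measurable F := measurable_one.indicator Metric.isOpen_ball.measurableSet
  have hFint : ∫⁻ c, F c = volume (Metric.ball (0 : X) 1) :=
    lintegral_indicator_one Metric.isOpen_ball.measurableSet
  set J := ∫⁻ y, ∫⁻ c in A₁.prod A₂ ⁻¹' {y}, F c ∂μHE[finrank ℝ (A₁.prod A₂).ker] ∂(ν₁.prod ν₂)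
    with hJ
  have hm := measurable_setLIntegral_fiber (A₁.prod A₂) hA hF
  have h1 : ∫⁻ c, F c = coareaConst (A₁.prod A₂) (ν₁.prod ν₂) * J :=
    lintegral_eq_coareaConst_mul (A₁.prod A₂) hA (ν₁.prod ν₂) hF
  have h2 : ∫⁻ c, F c = coareaConst A₁ ν₁ * coareaConst (A₂ ∘L A₁.ker.subtypeL) ν₂ * J := by
    rw [lintegral_eq_coareaConst_mul A₁ hA₁ ν₁ hF, mul_assoc, hJ, lintegral_prod _ hm.aemeasurable,
      ← lintegral_const_mul _ hm.lintegral_prod_right']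
    congr 1
    refine lintegral_congr fun y ↦ ?_
    simpa using setLIntegral_fiber_mul A₁ A₂ hA ν₂ y hF (h := fun _ ↦ 1) measurable_const
  have h3 : ∫⁻ c, F c ≠ 0 := by
    rw [hFint]
    exact (Metric.measure_ball_pos _ _ one_pos).ne'
  have h4 : ∫⁻ c, F c ≠ ⊤ := by
    rw [hFint]
    exact measure_ball_lt_top.ne
  have hJ0 : J ≠ 0 := fun h ↦ h3 (by rw [h1, h, mul_zero])
  have hJt : J ≠ ⊤ := fun h ↦ h4 (by
    rw [h1, h, ENNReal.mul_top (coareaConst_pos_and_lt_top _ hA _).1])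
  rw [h1] at h2
  exact (ENNReal.mul_left_inj hJ0 hJt).1 h2

/-- Integrating the fibre integrals of `(A₁, A₂)` over the second coordinate gives a fibre integral
of `A₁`. -/
theorem lintegral_coareaConst_prod (A₁ : X →L[ℝ] Y₁) (A₂ : X →L[ℝ] Y₂)
    (hA : Function.Surjective (A₁.prod A₂)) (ν₁ : Measure Y₁) [ν₁.IsAddHaarMeasure]
    (ν₂ : Measure Y₂) [ν₂.IsAddHaarMeasure] (y : Y₁)
    {F : X → ℝ≥0∞} (hF : Measurable F) {h : Y₂ → ℝ≥0∞} (hh : Measurable h) :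
    ∫⁻ ξ, coareaConst (A₁.prod A₂) (ν₁.prod ν₂) *
        (∫⁻ c in A₁.prod A₂ ⁻¹' {(y, ξ)}, F c ∂μHE[finrank ℝ (A₁.prod A₂).ker]) * h ξ ∂ν₂ =
      coareaConst A₁ ν₁ * ∫⁻ c in A₁ ⁻¹' {y}, F c * h (A₂ c) ∂μHE[finrank ℝ A₁.ker] := by
  rw [setLIntegral_fiber_mul A₁ A₂ hA ν₂ y hF hh, ← mul_assoc, ← coareaConst_prod A₁ A₂ hA]
  simp_rw [mul_assoc]
  have hm := (measurable_setLIntegral_fiber (A₁.prod A₂) hA hF).comp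
    (measurable_prodMk_left (x := y))
  exact lintegral_const_mul _ (hm.mul hh)

end Disintegration

/-! ### Comparison of the two disintegrations of a nearly linear incidence relation -/

theorem map_pi_prod {ι : Type*} [Fintype ι] {α β : ι → Type*} [∀ i, MeasurableSpace (α i)]
    [∀ i, MeasurableSpace (β i)] (μ : ∀ i, Measure (α i)) (ν : ∀ i, Measure (β i))
    [∀ i, SigmaFinite (μ i)] [∀ i, SigmaFinite (ν i)] :
    ((Measure.pi μ).prod (Measure.pi ν)).map (fun p i ↦ (p.1 i, p.2 i)) =
      Measure.pi fun i ↦ (μ i).prod (ν i) := by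
  symm
  refine Measure.pi_eq_generateFrom
    (C := fun i ↦ image2 (· ×ˢ ·) {s : Set (α i) | MeasurableSet s} {t : Set (β i) | MeasurableSet t})
    (fun i ↦ generateFrom_prod) (fun i ↦ isPiSystem_prod)
    (fun i ↦ (μ i).toFiniteSpanningSetsIn.prod (ν i).toFiniteSpanningSetsIn) fun s hs ↦ ?_
  choose a ha b hb hab using hs
  have hm : Measurable fun (p : (∀ i, α i) × ∀ i, β i) i ↦ (p.1 i, p.2 i) := by fun_prop
  rw [Measure.map_apply hm (MeasurableSet.univ_pi fun i ↦ hab i ▸ (ha i).prod (hb i))]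
  have : (fun (p : (∀ i, α i) × ∀ i, β i) i ↦ (p.1 i, p.2 i)) ⁻¹' univ.pi s =
      univ.pi a ×ˢ univ.pi b := by
    ext p
    simp only [← hab, mem_preimage, mem_univ_pi, mem_prod, forall_and]
  rw [this, Measure.prod_prod, Measure.pi_pi, Measure.pi_pi, ← Finset.prod_mul_distrib]
  exact Finset.prod_congr rfl fun i _ ↦ by rw [← hab i, Measure.prod_prod]

theorem countablySeparated_of_standardBorelSpace {α : Type*} [MeasurableSpace α]
    [StandardBorelSpace α] : MeasurableSpace.CountablySeparated α := inferInstance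

section Incidence

variable {X T Y ι : Type*} [Fintype ι]
  [NormedAddCommGroup X] [InnerProductSpace ℝ X] [FiniteDimensional ℝ X]
  [MeasurableSpace X] [BorelSpace X]
  [NormedAddCommGroup T] [InnerProductSpace ℝ T] [FiniteDimensional ℝ T]
  [MeasurableSpace T] [BorelSpace T]
  [NormedAddCommGroup Y] [InnerProductSpace ℝ Y] [FiniteDimensional ℝ Y]
  [MeasurableSpace Y] [BorelSpace Y]
  (A : X →L[ℝ] ι → Y) (D : ι → T →L[ℝ] Y)

/-- The space in which the two parametrisations of the incidence relation are compared. -/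
abbrev ComparisonSpace : Type _ := A.ker × (∀ p, (D p).ker × Y)

instance borelSpace_comparisonSpace : BorelSpace (ComparisonSpace A D) := inferInstance

instance isAddHaarMeasure_comparisonSpace :
    (volume : Measure (ComparisonSpace A D)).IsAddHaarMeasure := by
  have h0 : (volume : Measure A.ker).IsAddHaarMeasure := inferInstance
  have h1 : ∀ p, (volume : Measure ((D p).ker × Y)).IsAddHaarMeasure := fun p ↦
    Measure.prod.instIsAddHaarMeasure _ _
  have h : (volume : Measure (∀ p, (D p).ker × Y)).IsAddHaarMeasure :=
    Measure.pi.isAddHaarMeasure _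
  exact Measure.prod.instIsAddHaarMeasure _ _

/-- Standard Borel spaces are needed because images of measurable sets under injective measurable
maps must be measurable (Lusin–Souslin). -/
instance standardBorelSpace_comparisonSpace : StandardBorelSpace (ComparisonSpace A D) := by
  have h1 : ∀ p, StandardBorelSpace ((D p).ker × Y) := fun p ↦ StandardBorelSpace.prod
  have h2 : StandardBorelSpace (∀ p, (D p).ker × Y) := StandardBorelSpace.pi_countable
  exact StandardBorelSpace.prod

instance countablySeparated_comparisonSpace :
    MeasurableSpace.CountablySeparated (ComparisonSpace A D) :=
  countablySeparated_of_standardBorelSpace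

/-- The coordinates coming from the parametrisation by `c` and the kernels of `D p`. -/
def paramLevel (x : X × (∀ p, (D p).ker)) : ComparisonSpace A D :=
  (kerProj A x.1, fun p ↦ (x.2 p, -A x.1 p))

/-- The coordinates coming from the parametrisation by the kernel of `A` and the positions. -/
def paramPosition (x : A.ker × (ι → T)) : ComparisonSpace A D :=
  (x.1, fun p ↦ (kerProj (D p) (x.2 p), D p (x.2 p)))

theorem measurable_paramLevel : Measurable (paramLevel A D) := by
  unfold paramLevel
  fun_prop

theorem measurable_paramPosition : Measurable (paramPosition A D) := by
  unfold paramPosition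
  fun_prop

variable {A D}

theorem injective_paramLevel (hA : Function.Surjective A) :
    Function.Injective (paramLevel A D) := by
  rintro ⟨c, q⟩ ⟨c', q'⟩ h
  have h1 : kerProj A c = kerProj A c' := congrArg (fun x : ComparisonSpace A D ↦ x.1) h
  have h2 : ∀ p, (q p, -A c p) = (q' p, -A c' p) := fun p ↦
    congrArg (fun x : ComparisonSpace A D ↦ x.2 p) h
  have h3 : A c = A c' := funext fun p ↦ neg_injective (congrArg Prod.snd (h2 p))
  have h4 : c = c' := (kerProdEquiv A hA).injective <| by
    rw [kerProdEquiv_apply, kerProdEquiv_apply, h1, h3]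
  have h5 : q = q' := funext fun p ↦ congrArg Prod.fst (h2 p)
  rw [h4, h5]

theorem injective_paramPosition (hD : ∀ p, Function.Surjective (D p)) :
    Function.Injective (paramPosition A D) := by
  rintro ⟨u, v⟩ ⟨u', v'⟩ h
  have h1 : u = u' := congrArg (fun x : ComparisonSpace A D ↦ x.1) h
  have h2 : v = v' := funext fun p ↦ (kerProdEquiv (D p) (hD p)).injective <| by
    rw [kerProdEquiv_apply, kerProdEquiv_apply]
    exact congrArg (fun x : ComparisonSpace A D ↦ x.2 p) h
  rw [h1, h2]

/-- The only volume distortion is that of splitting `c` into its kernel component and `A c`. The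
sign change and the regrouping of coordinates preserve volume. -/
theorem map_paramLevel (hA : Function.Surjective A) :
    (volume : Measure (X × (∀ p, (D p).ker))).map (paramLevel A D) =
      coareaConst A volume • (volume : Measure (ComparisonSpace A D)) := by
  have h1 : (volume : Measure (X × (∀ p, (D p).ker))).map (Prod.map (kerProdEquiv A hA) id) =
      coareaConst A volume • ((volume : Measure A.ker).prod (volume : Measure (ι → Y))).prod
        (volume : Measure (∀ p, (D p).ker)) := by
    rw [Measure.volume_eq_prod, ← Measure.map_prod_map _ _
      (kerProdEquiv A hA).continuous.measurable measurable_id, map_kerProdEquiv A hA volume,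
      Measure.map_id, Measure.prod_smul_left]
  let g : (ι → Y) × (∀ p, (D p).ker) → ∀ p, (D p).ker × Y := fun y p ↦ (y.2 p, -y.1 p)
  have hg : Measurable g := by fun_prop
  have h2 : ((volume : Measure (ι → Y)).prod (volume : Measure (∀ p, (D p).ker))).map g =
      (volume : Measure (∀ p, (D p).ker × Y)) := by
    have h3 : g = (fun (p : (∀ i, (D i).ker) × (ι → Y)) i ↦ (p.1 i, p.2 i)) ∘ Prod.swap ∘
        Prod.map Neg.neg id := rfl
    rw [h3, ← Measure.map_map (by fun_prop) (by fun_prop), ← Measure.map_map (by fun_prop)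
      (by fun_prop), ← Measure.map_prod_map _ _ measurable_neg measurable_id, Measure.map_id]
    have h4 : (volume : Measure (ι → Y)).map Neg.neg = volume := Measure.map_neg_eq_self volume
    rw [h4, Measure.prod_swap]
    exact map_pi_prod _ _
  have h3 : paramLevel A D =
      Prod.map id g ∘ MeasurableEquiv.prodAssoc ∘ Prod.map (kerProdEquiv A hA) id := rfl
  rw [h3, ← Measure.map_map (by fun_prop) (by fun_prop), ← Measure.map_map (by fun_prop)
    ((kerProdEquiv A hA).continuous.measurable.prodMap measurable_id), h1, Measure.map_smul,
    Measure.map_smul, Measure.prodAssoc_prod, ← Measure.map_prod_map _ _ measurable_id hg, h2,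
    Measure.map_id, Measure.volume_eq_prod]

/-- Each position is split by its own `D p`, independently of the others, which is where the product
of the factors `sqrtDet (D p)` in the correlation function comes from. -/
theorem map_paramPosition (hD : ∀ p, Function.Surjective (D p)) :
    (volume : Measure (A.ker × (ι → T))).map (paramPosition A D) =
      (∏ p, (ENNReal.ofReal (sqrtDet (D p)))⁻¹) • (volume : Measure (ComparisonSpace A D)) := by
  have hpos : ∀ p, ENNReal.ofReal (sqrtDet (D p)) ≠ 0 := fun p ↦ by
    simpa using sqrtDet_pos (D p) (hD p)
  have h1 : ∀ p, (volume : Measure T).map (kerProdEquiv (D p) (hD p)) =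
      (sqrtDet (D p)).toNNReal⁻¹ • (volume : Measure (D p).ker).prod (volume : Measure Y) := by
    intro p
    rw [map_kerProdEquiv_volume (D p) (hD p), ENNReal.smul_def, ENNReal.coe_inv]
    · rfl
    · simpa [ENNReal.ofReal] using hpos p
  have h2 : (volume : Measure (ι → T)).map (fun v p ↦ kerProdEquiv (D p) (hD p) (v p)) =
      (∏ p, (sqrtDet (D p)).toNNReal⁻¹) • (volume : Measure (∀ p, (D p).ker × Y)) := by
    have h3 := pi_smul (fun p ↦ (sqrtDet (D p)).toNNReal⁻¹)
      fun p ↦ (volume : Measure (D p).ker).prod (volume : Measure Y)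
    have : ∀ p, SigmaFinite ((volume : Measure T).map (kerProdEquiv (D p) (hD p))) := fun p ↦ by
      rw [h1]
      infer_instance
    rw [volume_pi, Measure.pi_map_pi fun p ↦
      (kerProdEquiv (D p) (hD p)).continuous.measurable.aemeasurable]
    simp_rw [h1]
    exact h3
  have h3 : paramPosition A D =
      Prod.map id (fun v p ↦ kerProdEquiv (D p) (hD p) (v p)) := rfl
  have hm : Measurable fun (v : ι → T) p ↦ kerProdEquiv (D p) (hD p) (v p) :=
    measurable_pi_lambda _ fun p ↦
      (kerProdEquiv (D p) (hD p)).continuous.measurable.comp (measurable_pi_apply p)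
  rw [h3, Measure.volume_eq_prod, ← Measure.map_prod_map _ _ measurable_id hm, h2, Measure.map_id,
    Measure.prod_smul_right, Measure.volume_eq_prod, ENNReal.smul_def, ENNReal.ofNNReal_finsetProd]
  congr 1
  refine Finset.prod_congr rfl fun p _ ↦ ?_
  rw [ENNReal.coe_inv]
  · rfl
  · simpa [ENNReal.ofReal] using hpos p

theorem volume_eq_volume_image_paramLevel (hA : Function.Surjective A)
    {S : Set (X × (∀ p, (D p).ker))} (hS : MeasurableSet S) :
    volume S = coareaConst A volume * volume (paramLevel A D '' S) := by
  have hm : MeasurableSet (paramLevel A D '' S) :=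
    hS.image_of_measurable_injOn (measurable_paramLevel A D) (injective_paramLevel hA).injOn
  have h := congrArg (fun ν ↦ ν (paramLevel A D '' S)) (map_paramLevel (A := A) (D := D) hA)
  simp only [Measure.map_apply (measurable_paramLevel A D) hm] at h
  rwa [preimage_image_eq _ (injective_paramLevel hA)] at h

theorem volume_image_paramPosition (hD : ∀ p, Function.Surjective (D p))
    {S : Set (A.ker × (ι → T))} (hS : MeasurableSet S) :
    volume (paramPosition A D '' S) = (∏ p, ENNReal.ofReal (sqrtDet (D p))) * volume S := by
  have hm : MeasurableSet (paramPosition A D '' S) :=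
    hS.image_of_measurable_injOn (measurable_paramPosition A D) (injective_paramPosition hD).injOn
  have h := congrArg (fun ν ↦ ν (paramPosition A D '' S)) (map_paramPosition (A := A) (D := D) hD)
  simp only [Measure.map_apply (measurable_paramPosition A D) hm] at h
  rw [preimage_image_eq _ (injective_paramPosition hD)] at h
  have h1 : (∏ p, ENNReal.ofReal (sqrtDet (D p))) * ∏ p, (ENNReal.ofReal (sqrtDet (D p)))⁻¹ = 1 := by
    rw [← Finset.prod_mul_distrib]
    exact Finset.prod_eq_one fun p _ ↦
      ENNReal.mul_inv_cancel (by simpa using sqrtDet_pos (D p) (hD p)) ENNReal.ofReal_ne_top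
  rw [h, Measure.smul_apply, smul_eq_mul, ← mul_assoc, h1, one_mul]

/-- The two parametrisations share all components except those in `Y`, which are `-A c p` and `D p
(v p)`. Their discrepancy is exactly the quantity bounded in `h`. The increments of `c` are
recovered from `a` and those of `v` from `b`, at the cost of the factor `1 + κ`, which is why the
maximum of both norms appears. -/
theorem norm_sub_paramLevel_sub_paramPosition_le {η κ : ℝ} (hη : 0 ≤ η) (hκ0 : 0 ≤ κ)
    (hκA : ∀ v, ‖v‖ ≤ ‖kerProj A v‖ + κ * ‖A v‖)
    (hκD : ∀ p v, ‖v‖ ≤ ‖kerProj (D p) v‖ + κ * ‖D p v‖) {c c' : X} {v v' : ι → T}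
    (h : ∀ p, ‖A (c - c') p + D p (v p - v' p)‖ ≤ η * max ‖c - c'‖ ‖v p - v' p‖)
    {a a' b b' : ComparisonSpace A D}
    (ha : a = paramLevel A D (c, fun p ↦ kerProj (D p) (v p)))
    (ha' : a' = paramLevel A D (c', fun p ↦ kerProj (D p) (v' p)))
    (hb : b = paramPosition A D (kerProj A c, v)) (hb' : b' = paramPosition A D (kerProj A c', v')) :
    ‖(a - a') - (b - b')‖ ≤ η * (1 + κ) * max ‖a - a'‖ ‖b - b'‖ := by
  set R := max ‖a - a'‖ ‖b - b'‖ with hR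
  have hR0 : 0 ≤ R := (norm_nonneg _).trans (le_max_left _ _)
  have hda1 : (a - a').1 = kerProj A (c - c') := by
    rw [ha, ha', map_sub]
    rfl
  have hda2 : ∀ p, (a - a').2 p = (kerProj (D p) (v p - v' p), -(A (c - c') p)) := fun p ↦ by
    have : -(A (c - c') p) = -A c p - -A c' p := by
      rw [map_sub, Pi.sub_apply]
      abel
    rw [ha, ha', map_sub, this]
    rfl
  have hdb1 : (b - b').1 = kerProj A (c - c') := by
    rw [hb, hb', map_sub]
    rfl
  have hdb2 : ∀ p, (b - b').2 p = (kerProj (D p) (v p - v' p), D p (v p - v' p)) := fun p ↦ by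
    rw [hb, hb', map_sub, map_sub]
    rfl
  have hc : ‖c - c'‖ ≤ (1 + κ) * R := by
    have h1 : ‖kerProj A (c - c')‖ ≤ R := by
      rw [← hda1]
      exact (norm_fst_le _).trans (le_max_left _ _)
    have h2 : ‖A (c - c')‖ ≤ R := by
      refine (pi_norm_le_iff_of_nonneg hR0).2 fun p ↦ ?_
      have h3 : ‖(a - a').2 p‖ ≤ R :=
        (norm_le_pi_norm (a - a').2 p).trans ((norm_snd_le _).trans (le_max_left _ _))
      rw [hda2 p] at h3
      have h4 : ‖-(A (c - c') p)‖ ≤ R := (norm_snd_le _).trans h3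
      rwa [norm_neg] at h4
    calc _ ≤ _ := hκA _
      _ ≤ R + κ * R := by gcongr
      _ = _ := by ring
  have hv : ∀ p, ‖v p - v' p‖ ≤ (1 + κ) * R := by
    intro p
    have h3 : ‖(b - b').2 p‖ ≤ R :=
      (norm_le_pi_norm (b - b').2 p).trans ((norm_snd_le _).trans (le_max_right _ _))
    rw [hdb2 p] at h3
    have h1 := (norm_fst_le _).trans h3
    have h2 := (norm_snd_le _).trans h3
    calc _ ≤ _ := hκD p _
      _ ≤ R + κ * R := by gcongr
      _ = _ := by ring
  have h5 : ‖((a - a') - (b - b')).1‖ ≤ η * (1 + κ) * R := by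
    rw [Prod.fst_sub, hda1, hdb1, sub_self, norm_zero]
    positivity
  have h6 : ‖((a - a') - (b - b')).2‖ ≤ η * (1 + κ) * R := by
    refine (pi_norm_le_iff_of_nonneg (by positivity)).2 fun p ↦ ?_
    rw [Prod.snd_sub, Pi.sub_apply, hda2, hdb2, Prod.mk_sub_mk, sub_self, Prod.norm_def, norm_zero,
      ← norm_neg (_ - _), neg_sub, sub_neg_eq_add, add_comm (D p _)]
    refine max_le (by positivity) ?_
    calc _ ≤ η * max ‖c - c'‖ ‖v p - v' p‖ := h p
      _ ≤ η * ((1 + κ) * R) := by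
          gcongr
          exact max_le hc (hv p)
      _ = η * (1 + κ) * R := by ring
  exact max_le h5 h6

end Incidence

/-! ### Local double counting on a nearly linear incidence set -/

section LocalComparison

variable {X T Y ι M : Type*} [Fintype ι]
  [NormedAddCommGroup X] [InnerProductSpace ℝ X] [FiniteDimensional ℝ X]
  [MeasurableSpace X] [BorelSpace X]
  [NormedAddCommGroup T] [InnerProductSpace ℝ T] [FiniteDimensional ℝ T]
  [MeasurableSpace T] [BorelSpace T]
  [NormedAddCommGroup Y] [InnerProductSpace ℝ Y] [FiniteDimensional ℝ Y]
  [MeasurableSpace Y] [BorelSpace Y]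
  [EMetricSpace M] [MeasurableSpace M] [BorelSpace M] [StandardBorelSpace M]

theorem eqUpTo_edist_of_norm_le {E F : Type*} [NormedAddCommGroup E] [NormedAddCommGroup F]
    {t : ℝ≥0} {x y : E} {x' y' : F} (h : ‖x - y‖ ≤ t * ‖x' - y'‖) (h' : ‖x' - y'‖ ≤ t * ‖x - y‖) :
    EqUpTo t (edist x y) (edist x' y') := by
  rw [edist_dist, edist_dist, dist_eq_norm, dist_eq_norm]
  have := EqUpTo.ofReal h h' t.coe_nonneg
  rwa [Real.toNNReal_coe] at this

/-- A vector that `A` nearly kills is nearly in the kernel. The condition on `κ * η` allows the term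
`κ * ‖A v‖` to be absorbed into the left side. -/
theorem norm_le_of_norm_apply_le (A : X →L[ℝ] Y) {κ η : ℝ} {t : ℝ≥0} (ht : 1 < t)
    (hκ : ∀ v, ‖v‖ ≤ ‖kerProj A v‖ + κ * ‖A v‖) (hκ0 : 0 ≤ κ)
    (hη : κ * η ≤ 1 - (t : ℝ)⁻¹) {v : X} (hv : ‖A v‖ ≤ η * ‖v‖) : ‖v‖ ≤ t * ‖kerProj A v‖ := by
  have ht0 : (0 : ℝ) < t := by
    have : (0 : ℝ≥0) < t := zero_lt_one.trans ht
    exact_mod_cast this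
  have h1 : ‖v‖ ≤ ‖kerProj A v‖ + (1 - (t : ℝ)⁻¹) * ‖v‖ :=
    calc ‖v‖ ≤ ‖kerProj A v‖ + κ * ‖A v‖ := hκ v
      _ ≤ ‖kerProj A v‖ + κ * (η * ‖v‖) := by gcongr
      _ = ‖kerProj A v‖ + κ * η * ‖v‖ := by ring
      _ ≤ _ := by gcongr
  have h2 : (t : ℝ)⁻¹ * ‖v‖ ≤ ‖kerProj A v‖ := by linarith
  calc ‖v‖ = t * ((t : ℝ)⁻¹ * ‖v‖) := by field_simp
    _ ≤ _ := by gcongr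

theorem isFiniteMeasure_restrict_of_bilipschitzOn {t : ℝ≥0} {φ : M → T} {U : Set M}
    (hφ : BilipschitzOn t φ U) (hbd : Bornology.IsBounded (φ '' U)) :
    IsFiniteMeasure ((μHE[finrank ℝ T] : Measure M).restrict U) := by
  refine ⟨?_⟩
  rw [Measure.restrict_apply_univ]
  refine (hφ.eqUpTo_euclideanHausdorffMeasure (finrank ℝ T)).1.trans_lt ?_
  rw [InnerProductSpace.euclideanHausdorffMeasure_eq_volume]
  exact ENNReal.mul_lt_top ENNReal.coe_lt_top hbd.measure_lt_top

theorem pi_restrict_eq_restrict {α : ι → Type*} [∀ i, MeasurableSpace (α i)]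
    (μ : ∀ i, Measure (α i)) {s : ∀ i, Set (α i)} (hs : ∀ i, MeasurableSet (s i))
    [∀ i, SigmaFinite ((μ i).restrict (s i))] :
    Measure.pi (fun i ↦ (μ i).restrict (s i)) =
      (Measure.pi fun i ↦ (μ i).restrict (s i)).restrict (univ.pi s) := by
  rw [Measure.restrict_pi_pi]
  congr 1
  funext i
  rw [Measure.restrict_restrict (hs i), inter_self]

theorem map_pi_restrict_eqUpTo {t : ℝ≥0} {φ : ι → M → T} {U : ι → Set M}
    (hφm : ∀ p, Measurable (φ p)) (hUm : ∀ p, MeasurableSet (U p))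
    (hφ : ∀ p, BilipschitzOn t (φ p) (U p)) (hbd : ∀ p, Bornology.IsBounded (φ p '' U p))
    {s : Set (ι → T)} (hs : MeasurableSet s) :
    EqUpTo (∏ _p : ι, t ^ finrank ℝ T)
      ((Measure.pi fun p ↦ (μHE[finrank ℝ T] : Measure M).restrict (U p)).map
        (fun z p ↦ φ p (z p)) s)
      ((volume : Measure (ι → T)).restrict ((fun z p ↦ φ p (z p)) '' univ.pi U) s) := by
  have hm : Measurable fun (z : ι → M) p ↦ φ p (z p) := by fun_prop
  have hinj : InjOn (fun (z : ι → M) p ↦ φ p (z p)) (univ.pi U) := fun z hz z' hz' h ↦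
    funext fun p ↦ (hφ p).injOn (hz p trivial) (hz' p trivial) (congrFun h p)
  have hUpi : MeasurableSet (univ.pi U) := MeasurableSet.univ_pi hUm
  have hfin : ∀ p, volume (φ p '' U p) ≠ ⊤ := fun p ↦ (hbd p).measure_lt_top.ne
  have : ∀ p, IsFiniteMeasure ((μHE[finrank ℝ T] : Measure M).restrict (U p)) := fun p ↦
    isFiniteMeasure_restrict_of_bilipschitzOn (hφ p) (hbd p)
  have hres := pi_restrict_eq_restrict (fun _ ↦ (μHE[finrank ℝ T] : Measure M)) hUm
  have himage : (fun (z : ι → M) p ↦ φ p (z p)) '' ((fun z p ↦ φ p (z p)) ⁻¹' s ∩ univ.pi U) =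
      s ∩ (fun z p ↦ φ p (z p)) '' univ.pi U := by
    rw [inter_comm, image_inter_preimage, inter_comm]
  rw [Measure.map_apply hm hs, hres, Measure.restrict_apply (hm hs), Measure.restrict_apply hs,
    ← himage]
  exact BilipschitzOn.eqUpTo_pi (fun _ ↦ rfl) hφ hφm hUm hfin inter_subset_right
    ((hm hs).inter hUpi)

/-- The central comparison. `W p` is the incidence relation at the single point `p`, and `E`
consists of tuples whose components satisfy these relations. The near-linearity of each `W p` makes
the `c`-slices bilipschitz to subsets of `∏ ker D_p` and the `z`-slices bilipschitz to subsets of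
`ker A`. The volumes of these model slices are `f` and `g`. Their integrals are volumes of two
images of `E`, which linear coordinates carry to nearly equal subsets of the comparison space. -/
theorem exists_local_comparison (A : X →L[ℝ] ι → Y) (hA : Function.Surjective A)
    (D : ι → T →L[ℝ] Y) (hD : ∀ p, Function.Surjective (D p)) {t : ℝ≥0} (ht : 1 < t) :
    ∃ η : ℝ, 0 < η ∧ ∀ (φ : ι → M → T) (U : ι → Set M) (W : ι → Set (X × M)),
      (∀ p, Measurable (φ p)) → (∀ p, MeasurableSet (U p)) →
      (∀ p, BilipschitzOn t (φ p) (U p)) → (∀ p, Bornology.IsBounded (φ p '' U p)) →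
      (∀ p, MeasurableSet (W p)) → (∀ p, ∀ x ∈ W p, x.2 ∈ U p) →
      (∀ p, ∀ x ∈ W p, ∀ y ∈ W p, ‖A (x.1 - y.1) p + D p (φ p x.2 - φ p y.2)‖ ≤
        η * max ‖x.1 - y.1‖ ‖φ p x.2 - φ p y.2‖) →
      ∀ E : Set (X × (ι → M)), MeasurableSet E → (∀ x ∈ E, ∀ p, (x.1, x.2 p) ∈ W p) →
      ∃ (f : X → ℝ≥0∞) (g : (ι → M) → ℝ≥0∞), Measurable f ∧ Measurable g ∧
        (∀ c, EqUpTo (∏ p, (t * t) ^ finrank ℝ (D p).ker)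
          (Measure.pi (fun p ↦ (μHE[finrank ℝ (D p).ker] : Measure M).restrict
            {x | (c, x) ∈ W p}) {z | (c, z) ∈ E}) (f c)) ∧
        (∀ z, EqUpTo (t ^ finrank ℝ A.ker) (μHE[finrank ℝ A.ker] {c | (c, z) ∈ E}) (g z)) ∧
        EqUpTo (t * ∏ _p : ι, t ^ finrank ℝ T) (∫⁻ c, f c)
          (coareaConst A volume * (∏ p, ENNReal.ofReal (sqrtDet (D p))) *
            ∫⁻ z, g z ∂Measure.pi fun p ↦ (μHE[finrank ℝ T] : Measure M).restrict (U p)) := by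
  obtain ⟨θ, hθ, hθ'⟩ := eqUpTo_addHaar_image (H := ComparisonSpace A D) volume ht
    (X × (ι → M))
  obtain ⟨κ₀, hκ₀, hκA⟩ := exists_norm_le_add_mul A hA
  choose κ₁ hκ₁ hκD using fun p ↦ exists_norm_le_add_mul (D p) (hD p)
  obtain ⟨κ, hκ0, hκ⟩ : ∃ κ, κ₀ ≤ κ ∧ ∀ p, κ₁ p ≤ κ := by
    refine ⟨κ₀ + ∑ p, κ₁ p, ?_, fun p ↦ ?_⟩
    · have := Finset.sum_nonneg fun p (_ : p ∈ Finset.univ) ↦ (hκ₁ p).le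
      linarith
    · have := Finset.single_le_sum (fun p _ ↦ (hκ₁ p).le) (Finset.mem_univ p)
      linarith
  have hκpos : 0 < κ := hκ₀.trans_le hκ0
  replace hκA : ∀ v, ‖v‖ ≤ ‖kerProj A v‖ + κ * ‖A v‖ := fun v ↦ (hκA v).trans (by gcongr)
  replace hκD : ∀ p v, ‖v‖ ≤ ‖kerProj (D p) v‖ + κ * ‖D p v‖ := fun p v ↦
    (hκD p v).trans (by gcongr; exact hκ p)
  have ht1 : (1 : ℝ) < t := by exact_mod_cast ht
  have htinv : 0 < 1 - (t : ℝ)⁻¹ := sub_pos.2 (inv_lt_one_of_one_lt₀ ht1)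
  have hη1 : 0 < min (θ / (1 + κ)) ((1 - (t : ℝ)⁻¹) / κ) := lt_min (by positivity) (by positivity)
  -- The first bound makes the two maps into the comparison space close enough for
  -- `eqUpTo_addHaar_image`; the second makes the kernel projections of the slices bilipschitz with
  -- factor `t`.
  refine ⟨min (θ / (1 + κ)) ((1 - (t : ℝ)⁻¹) / κ), hη1, ?_⟩
  set η := min (θ / (1 + κ)) ((1 - (t : ℝ)⁻¹) / κ) with hη
  have hηθ : η * (1 + κ) ≤ θ := by
    have := min_le_left (θ / (1 + κ)) ((1 - (t : ℝ)⁻¹) / κ)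
    rwa [← hη, le_div_iff₀ (by positivity)] at this
  have hηt : κ * η ≤ 1 - (t : ℝ)⁻¹ := by
    have := min_le_right (θ / (1 + κ)) ((1 - (t : ℝ)⁻¹) / κ)
    rwa [← hη, le_div_iff₀ (by positivity), mul_comm] at this
  intro φ U W hφm hUm hφ hbd hWm hWU hW E hEm hEW
  -- the slices of `E` are bilipschitz to subsets of the kernels
  have hlevel : ∀ c p, BilipschitzOn (t * t) (fun x ↦ kerProj (D p) (φ p x)) {x | (c, x) ∈ W p} := by
    intro c p x hx y hy
    refine EqUpTo.trans (eqUpTo_edist_of_norm_le ?_ ?_) (hφ p x (hWU p _ hx) y (hWU p _ hy))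
    · rw [← map_sub]
      exact (norm_kerProj_apply_le _ _).trans (le_mul_of_one_le_left (norm_nonneg _) ht1.le)
    · rw [← map_sub]
      refine norm_le_of_norm_apply_le (D p) ht (hκD p) hκpos.le hηt ?_
      have := hW p _ hx _ hy
      simpa using this
  have hpos : ∀ z, BilipschitzOn t (kerProj A) {c | (c, z) ∈ E} := by
    intro z c hc c' hc'
    refine eqUpTo_edist_of_norm_le ?_ ?_
    · rw [← map_sub]
      exact (norm_kerProj_apply_le _ _).trans (le_mul_of_one_le_left (norm_nonneg _) ht1.le)
    · rw [← map_sub]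
      -- With `z` fixed the increments of position vanish, so every component of `A (c - c')` is
      -- small compared with `c - c'` alone.
      have : ‖A (c - c')‖ ≤ η * ‖c - c'‖ := (pi_norm_le_iff_of_nonneg (by positivity)).2 fun p ↦ by
        simpa using hW p _ (hEW _ hc p) _ (hEW _ hc' p)
      have ht0 : (0 : ℝ) < t := by linarith
      have h1 : ‖c - c'‖ ≤ ‖kerProj A (c - c')‖ + (1 - (t : ℝ)⁻¹) * ‖c - c'‖ :=
        calc ‖c - c'‖ ≤ ‖kerProj A (c - c')‖ + κ * ‖A (c - c')‖ := hκA _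
          _ ≤ ‖kerProj A (c - c')‖ + κ * (η * ‖c - c'‖) := by gcongr
          _ = ‖kerProj A (c - c')‖ + κ * η * ‖c - c'‖ := by ring
          _ ≤ _ := by gcongr
      have h2 : (t : ℝ)⁻¹ * ‖c - c'‖ ≤ ‖kerProj A (c - c')‖ := by linarith
      calc ‖c - c'‖ = t * ((t : ℝ)⁻¹ * ‖c - c'‖) := by field_simp
        _ ≤ _ := by gcongr
  -- `Ψ` keeps `c` and flattens the zero sets onto the kernels of the `D p`; `Φ` keeps the positions
  -- and flattens the parameter fibre onto the kernel of `A`. Both are injective on `E` by the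
  -- bilipschitz bounds on slices.
  let Ψ : X × (ι → M) → X × (∀ p, (D p).ker) := fun x ↦ (x.1, fun p ↦ kerProj (D p) (φ p (x.2 p)))
  let Φ : X × (ι → M) → A.ker × (ι → T) := fun x ↦ (kerProj A x.1, fun p ↦ φ p (x.2 p))
  have hΨ : Measurable Ψ := by
    refine measurable_fst.prodMk (measurable_pi_lambda _ fun p ↦ ?_)
    exact (kerProj (D p)).continuous.measurable.comp
      ((hφm p).comp ((measurable_pi_apply p).comp measurable_snd))
  have hΦ : Measurable Φ := by
    refine ((kerProj A).continuous.measurable.comp measurable_fst).prodMk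
      (measurable_pi_lambda _ fun p ↦ ?_)
    exact (hφm p).comp ((measurable_pi_apply p).comp measurable_snd)
  have hΨinj : InjOn Ψ E := by
    rintro ⟨c, z⟩ hx ⟨c', z'⟩ hy hxy
    obtain rfl : c = c' := (Prod.ext_iff.1 hxy).1
    have : z = z' := funext fun p ↦
      (hlevel c p).injOn (hEW _ hx p) (hEW _ hy p) (congrFun ((Prod.ext_iff.1 hxy).2) p)
    rw [this]
  have hΦinj : InjOn Φ E := by
    rintro ⟨c, z⟩ hx ⟨c', z'⟩ hy hxy
    obtain rfl : z = z' := funext fun p ↦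
      (hφ p).injOn (hWU p _ (hEW _ hx p)) (hWU p _ (hEW _ hy p))
        (congrFun ((Prod.ext_iff.1 hxy).2) p)
    have : c = c' := (hpos z).injOn hx hy ((Prod.ext_iff.1 hxy).1)
    rw [this]
  have hΨE : MeasurableSet (Ψ '' E) := hEm.image_of_measurable_injOn hΨ hΨinj
  have hΦE : MeasurableSet (Φ '' E) := hEm.image_of_measurable_injOn hΦ hΦinj
  have hUpi : MeasurableSet (univ.pi U) := MeasurableSet.univ_pi hUm
  have hφpi : Measurable fun (z : ι → M) p ↦ φ p (z p) := by fun_prop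
  have hslice : ∀ z ∈ univ.pi U, (fun u ↦ (u, fun p ↦ φ p (z p))) ⁻¹' (Φ '' E) =
      kerProj A '' {c | (c, z) ∈ E} := by
    intro z hz
    ext u
    constructor
    · rintro ⟨⟨c, z'⟩, hx, hxu⟩
      obtain rfl : z' = z := funext fun p ↦ (hφ p).injOn (hWU p _ (hEW _ hx p)) (hz p trivial)
        (congrFun ((Prod.ext_iff.1 hxu).2) p)
      exact ⟨c, hx, (Prod.ext_iff.1 hxu).1⟩
    · rintro ⟨c, hc, rfl⟩
      exact ⟨(c, z), hc, rfl⟩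
  -- On the chart domains, `g` is the slice volume of the measurable set `Φ '' E` composed with the
  -- charts, and elsewhere it vanishes. This gives its measurability and relates its integral to the
  -- volume of `Φ '' E`.
  have hg : (fun z ↦ volume (kerProj A '' {c | (c, z) ∈ E})) = (univ.pi U).indicator fun z ↦
      volume ((fun u ↦ (u, fun p ↦ φ p (z p))) ⁻¹' (Φ '' E)) := by
    funext z
    by_cases hz : z ∈ univ.pi U
    · rw [indicator_of_mem hz, hslice z hz]
    · have : {c | (c, z) ∈ E} = ∅ := by
        refine eq_empty_of_forall_notMem fun c hc ↦ hz fun p _ ↦ hWU p _ (hEW _ hc p)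
      rw [indicator_of_notMem hz, this, image_empty, measure_empty]
  have hsec : Measurable fun y : ι → T ↦ volume ((fun u : A.ker ↦ (u, y)) ⁻¹' (Φ '' E)) :=
    measurable_measure_prodMk_right hΦE
  refine ⟨fun c ↦ volume (Prod.mk c ⁻¹' (Ψ '' E)), fun z ↦ volume (kerProj A '' {c | (c, z) ∈ E}),
    measurable_measure_prodMk_left hΨE, ?_, fun c ↦ ?_, fun z ↦ ?_, ?_⟩
  · rw [hg]
    exact (hsec.comp hφpi).indicator hUpi
  · change EqUpTo _ _ (volume (Prod.mk c ⁻¹' (Ψ '' E)))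
    have h1 : Prod.mk c ⁻¹' (Ψ '' E) =
        (fun z p ↦ kerProj (D p) (φ p (z p))) '' {z | (c, z) ∈ E} := by
      ext q
      constructor
      · rintro ⟨⟨c', z⟩, hx, hxq⟩
        obtain rfl : c' = c := (Prod.ext_iff.1 hxq).1
        exact ⟨z, hx, (Prod.ext_iff.1 hxq).2⟩
      · rintro ⟨z, hz, rfl⟩
        exact ⟨(c, z), hz, rfl⟩
    rw [h1]
    refine BilipschitzOn.eqUpTo_pi (g := fun p x ↦ kerProj (D p) (φ p x)) (fun _ ↦ rfl) (hlevel c)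
      (fun p ↦ (kerProj (D p)).continuous.measurable.comp (hφm p))
      (fun p ↦ measurable_prodMk_left (hWm p)) (fun p ↦ ?_) (fun z hz p _ ↦ hEW _ hz p)
      (measurable_prodMk_left hEm)
    have h2 : Bornology.IsBounded (kerProj (D p) '' (φ p '' U p)) :=
      (kerProj (D p)).lipschitz.isBounded_image (hbd p)
    refine ((measure_mono ?_).trans_lt h2.measure_lt_top).ne
    rw [image_image]
    exact image_mono fun x hx ↦ hWU p _ hx
  · have := (hpos z).eqUpTo_euclideanHausdorffMeasure (finrank ℝ A.ker)
    rwa [InnerProductSpace.euclideanHausdorffMeasure_eq_volume] at this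
  · have hf1 : ∫⁻ c, volume (Prod.mk c ⁻¹' (Ψ '' E)) = volume (Ψ '' E) := by
      rw [Measure.volume_eq_prod, Measure.prod_apply hΨE]
    have hf2 : volume (Ψ '' E) =
        coareaConst A volume * volume ((fun x ↦ paramLevel A D (Ψ x)) '' E) := by
      rw [volume_eq_volume_image_paramLevel hA hΨE, image_image]
    have hg1 : EqUpTo (∏ _p : ι, t ^ finrank ℝ T)
        (∫⁻ z, volume (kerProj A '' {c | (c, z) ∈ E}) ∂Measure.pi fun p ↦
          (μHE[finrank ℝ T] : Measure M).restrict (U p)) (volume (Φ '' E)) := by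
      have h1 := EqUpTo.of_measure (fun s hs ↦ map_pi_restrict_eqUpTo hφm hUm hφ hbd hs)
        fun y ↦ volume ((fun u : A.ker ↦ (u, y)) ⁻¹' (Φ '' E))
      rw [lintegral_map hsec hφpi] at h1
      -- The slices of `Φ '' E` over points outside the chart image are empty, so the restriction
      -- can be dropped.
      have h2 : ∫⁻ y in (fun (z : ι → M) p ↦ φ p (z p)) '' univ.pi U,
          volume ((fun u : A.ker ↦ (u, y)) ⁻¹' (Φ '' E)) = volume (Φ '' E) := by
        rw [Measure.volume_eq_prod, Measure.prod_apply_symm hΦE]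
        refine setLIntegral_eq_of_support_subset fun y hy ↦ ?_
        obtain ⟨u, x, hx, hxu⟩ := nonempty_of_measure_ne_zero hy
        exact ⟨x.2, fun p _ ↦ hWU p _ (hEW _ hx p), (Prod.ext_iff.1 hxu).2⟩
      rw [h2] at h1
      have : ∀ p, IsFiniteMeasure ((μHE[finrank ℝ T] : Measure M).restrict (U p)) := fun p ↦
        isFiniteMeasure_restrict_of_bilipschitzOn (hφ p) (hbd p)
      have hres := pi_restrict_eq_restrict (fun _ ↦ (μHE[finrank ℝ T] : Measure M)) hUm
      rwa [hg, lintegral_indicator hUpi, ← hres]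
    have hg2 : volume ((fun x ↦ paramPosition A D (Φ x)) '' E) =
        (∏ p, ENNReal.ofReal (sqrtDet (D p))) * volume (Φ '' E) := by
      rw [← volume_image_paramPosition hD hΦE, image_image]
    let a : X × (ι → M) → ComparisonSpace A D := fun x ↦ paramLevel A D (Ψ x)
    let b : X × (ι → M) → ComparisonSpace A D := fun x ↦ paramPosition A D (Φ x)
    have hab : EqUpTo t (volume (a '' E)) (volume (b '' E)) := by
      refine hθ' E a b fun x hx y hy ↦ ?_
      have h1 := norm_sub_paramLevel_sub_paramPosition_le (a := a x) (a' := a y) (b := b x)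
        (b' := b y) (c := x.1) (c' := y.1) (v := fun p ↦ φ p (x.2 p)) (v' := fun p ↦ φ p (y.2 p))
        hη1.le hκpos.le hκA hκD
        (fun p ↦ hW p _ (hEW _ hx p) _ (hEW _ hy p)) rfl rfl rfl rfl
      exact h1.trans (mul_le_mul_of_nonneg_right hηθ (le_max_of_le_left (norm_nonneg _)))
    rw [hf1, hf2, mul_assoc]
    refine EqUpTo.const_mul _ (hab.trans ?_)
    rw [hg2]
    exact EqUpTo.const_mul _ hg1.symm

end LocalComparison

/-! ### Nearly isometric frames and charts -/

section Frame

variable {k : ℕ} {B : Type*} [TopologicalSpace B] {V : B → Type*}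
  [TopologicalSpace (TotalSpace (EuclideanSpace ℝ (Fin k)) V)]
  [∀ x, NormedAddCommGroup (V x)] [∀ x, InnerProductSpace ℝ (V x)]
  [FiberBundle (EuclideanSpace ℝ (Fin k)) V] [VectorBundle ℝ (EuclideanSpace ℝ (Fin k)) V]

/-- The change of coordinates after which the trivialization at `x` is isometric on the fibre
over `x`. -/
theorem exists_normalizer (V : B → Type*)
    [TopologicalSpace (TotalSpace (EuclideanSpace ℝ (Fin k)) V)]
    [∀ x, NormedAddCommGroup (V x)] [∀ x, InnerProductSpace ℝ (V x)]
    [FiberBundle (EuclideanSpace ℝ (Fin k)) V] [VectorBundle ℝ (EuclideanSpace ℝ (Fin k)) V]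
    (x : B) : ∃ N : EuclideanSpace ℝ (Fin k) ≃L[ℝ] EuclideanSpace ℝ (Fin k),
      ∀ w, ‖N w‖ = ‖(trivializationAt (EuclideanSpace ℝ (Fin k)) V x).symmL ℝ x w‖ := by
  have hfd := finiteDimensional_fiber k V x
  have hx : x ∈ (trivializationAt (EuclideanSpace ℝ (Fin k)) V x).baseSet :=
    FiberBundle.mem_baseSet_trivializationAt' x
  let G := (trivializationAt (EuclideanSpace ℝ (Fin k)) V x).continuousLinearEquivAt ℝ x hx
  have hrank : finrank ℝ (V x) = k := by
    rw [G.toLinearEquiv.finrank_eq, finrank_euclideanSpace_fin]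
  let ι : V x ≃ₗᵢ[ℝ] EuclideanSpace ℝ (Fin k) := (stdOrthonormalBasis ℝ (V x)).repr.trans
    (LinearIsometryEquiv.piLpCongrLeft 2 ℝ ℝ (finCongr hrank))
  refine ⟨G.symm.trans ι.toContinuousLinearEquiv, fun w ↦ ?_⟩
  change ‖ι (G.symm w)‖ = _
  rw [ι.norm_map, Trivialization.symm_continuousLinearEquivAt_eq]

/-- The normalizing change of coordinates of the model fibre at `x`. -/
def normalizer (V : B → Type*)
    [TopologicalSpace (TotalSpace (EuclideanSpace ℝ (Fin k)) V)]
    [∀ x, NormedAddCommGroup (V x)] [∀ x, InnerProductSpace ℝ (V x)]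
    [FiberBundle (EuclideanSpace ℝ (Fin k)) V] [VectorBundle ℝ (EuclideanSpace ℝ (Fin k)) V]
    (x : B) : EuclideanSpace ℝ (Fin k) ≃L[ℝ] EuclideanSpace ℝ (Fin k) :=
  (exists_normalizer V x).choose

theorem norm_normalizer (x : B) (w : EuclideanSpace ℝ (Fin k)) : ‖normalizer V x w‖ =
    ‖(trivializationAt (EuclideanSpace ℝ (Fin k)) V x).symmL ℝ x w‖ :=
  (exists_normalizer V x).choose_spec w

theorem eventually_norm_normalizer_le [IsContinuousRiemannianBundle (EuclideanSpace ℝ (Fin k)) V]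
    (x : B) {t : ℝ} (ht : 1 < t) : ∀ᶠ y in 𝓝 x, ∀ v : V y,
      ‖normalizer V x ((trivializationAt (EuclideanSpace ℝ (Fin k)) V x).continuousLinearMapAt ℝ y v)‖
        ≤ t * ‖v‖ := by
  filter_upwards [eventually_norm_symmL_trivializationAt_self_comp_lt (EuclideanSpace ℝ (Fin k)) V x ht]
    with y hy v
  rw [norm_normalizer]
  exact ContinuousLinearMap.le_of_opNorm_le _ hy.le v

theorem eventually_norm_symmL_le [IsContinuousRiemannianBundle (EuclideanSpace ℝ (Fin k)) V]
    (x : B) {t : ℝ} (ht : 1 < t) : ∀ᶠ y in 𝓝 x, ∀ w : EuclideanSpace ℝ (Fin k),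
      ‖(trivializationAt (EuclideanSpace ℝ (Fin k)) V x).symmL ℝ y w‖ ≤ t * ‖normalizer V x w‖ := by
  have hx : x ∈ (trivializationAt (EuclideanSpace ℝ (Fin k)) V x).baseSet :=
    FiberBundle.mem_baseSet_trivializationAt' x
  filter_upwards [eventually_norm_symmL_trivializationAt_comp_self_lt (EuclideanSpace ℝ (Fin k)) V x ht]
    with y hy w
  rw [norm_normalizer]
  have := ContinuousLinearMap.le_of_opNorm_le _ hy.le
    ((trivializationAt (EuclideanSpace ℝ (Fin k)) V x).symmL ℝ x w)
  rwa [ContinuousLinearMap.comp_apply, Trivialization.continuousLinearMapAt_symmL _ hx] at this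

end Frame

/-- A σ-compact space is a countable union of compact, hence closed, subsets of its completion. It
is therefore a Borel subset of a Polish space. Completeness of the Riemannian distance is not
required. -/
theorem standardBorelSpace_of_sigmaCompact (M : Type*) [TopologicalSpace M]
    [TopologicalSpace.MetrizableSpace M] [SigmaCompactSpace M] [MeasurableSpace M] [BorelSpace M] :
    StandardBorelSpace M := by
  let : MetricSpace M := TopologicalSpace.metrizableSpaceMetric M
  let f : M → UniformSpace.Completion M := (↑)
  let : MeasurableSpace (UniformSpace.Completion M) := borel _
  have : BorelSpace (UniformSpace.Completion M) := ⟨rfl⟩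
  have hf : Topology.IsEmbedding f := (UniformSpace.Completion.isUniformEmbedding_coe M).isEmbedding
  have hr : MeasurableSet (range f) := by
    rw [← image_univ, ← iUnion_compactCovering M, image_iUnion]
    exact MeasurableSet.iUnion fun n ↦
      ((isCompact_compactCovering M n).image hf.continuous).isClosed.measurableSet
  have hfm : MeasurableEmbedding f := hf.measurableEmbedding hr
  have hS : StandardBorelSpace (range f) := hr.standardBorel
  obtain ⟨τ, hτ, hτ'⟩ := hS.polish
  let e := hfm.equivRange
  refine ⟨τ.induced e, @BorelSpace.mk M (τ.induced e) _ ?_, e.toEquiv.polishSpace_induced⟩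
  rw [borel_comap, ← hτ.measurable_eq]
  exact e.measurableEmbedding.comap_eq.symm

/-! ### Normalized charts are nearly isometric for the Riemannian distance -/

section Chart

variable {m : ℕ} {M : Type*} [EMetricSpace M]
  [ChartedSpace (EuclideanSpace ℝ (Fin m)) M] [IsManifold (𝓡 m) ∞ M]
  [RiemannianBundle (fun x : M ↦ TangentSpace (𝓡 m) x)]
  [IsContMDiffRiemannianBundle (𝓡 m) ∞ (EuclideanSpace ℝ (Fin m))
      (fun x : M ↦ TangentSpace (𝓡 m) x)]
  [IsRiemannianManifold (𝓡 m) M]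

theorem isContinuousRiemannianBundle_of_isContMDiff {k : ℕ} (V : M → Type*)
    [TopologicalSpace (TotalSpace (EuclideanSpace ℝ (Fin k)) V)]
    [∀ x, NormedAddCommGroup (V x)] [∀ x, InnerProductSpace ℝ (V x)]
    [FiberBundle (EuclideanSpace ℝ (Fin k)) V] [VectorBundle ℝ (EuclideanSpace ℝ (Fin k)) V]
    [h : IsContMDiffRiemannianBundle (𝓡 m) ∞ (EuclideanSpace ℝ (Fin k)) V] :
    IsContinuousRiemannianBundle (EuclideanSpace ℝ (Fin k)) V := by
  obtain ⟨g, hg, hg'⟩ := h.exists_contMDiff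
  exact ⟨⟨g, hg.continuous, hg'⟩⟩

instance isContinuousRiemannianBundle_tangentSpace : IsContinuousRiemannianBundle
    (EuclideanSpace ℝ (Fin m)) (fun x : M ↦ TangentSpace (𝓡 m) x) :=
  isContinuousRiemannianBundle_of_isContMDiff (m := m) _

/-- The chart at `x`, normalized so that its derivative at `x` is isometric. -/
def normalChart (x y : M) : EuclideanSpace ℝ (Fin m) :=
  normalizer (k := m) (fun x : M ↦ TangentSpace (𝓡 m) x) x (extChartAt (𝓡 m) x y)

variable (m) in
-- The distance is at most the length of the curve that is a straight segment in the chart. The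
-- segment stays in a ball on which the inverse chart stretches normalized vectors by at most `t`.
theorem eventually_edist_le_edist_normalChart (x : M) {t : ℝ≥0} (ht : 1 < t) :
    ∀ᶠ p : M × M in 𝓝 (x, x),
      edist p.1 p.2 ≤ t * edist (normalChart (m := m) x p.1) (normalChart x p.2) := by
  let N := normalizer (k := m) (fun x : M ↦ TangentSpace (𝓡 m) x) x
  have ht' : (1 : ℝ) < t := by exact_mod_cast ht
  have h1 := eventually_norm_symmL_le (k := m) (V := fun x : M ↦ TangentSpace (𝓡 m) x) x ht'
  have h1' : ∀ᶠ z in 𝓝 (extChartAt (𝓡 m) x x), ∀ w : EuclideanSpace ℝ (Fin m),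
      ‖(trivializationAt (EuclideanSpace ℝ (Fin m)) (fun x : M ↦ TangentSpace (𝓡 m) x) x).symmL ℝ
        ((extChartAt (𝓡 m) x).symm z) w‖ ≤ t * ‖N w‖ := by
    have h2 : Tendsto (extChartAt (𝓡 m) x).symm (𝓝 (extChartAt (𝓡 m) x x)) (𝓝 x) := by
      have := continuousAt_extChartAt_symm (I := 𝓡 m) x
      rwa [ContinuousAt, extChartAt_to_inv] at this
    exact h2.eventually h1
  obtain ⟨r, hr, hball⟩ : ∃ r > 0, Metric.ball (extChartAt (𝓡 m) x x) r ⊆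
      (extChartAt (𝓡 m) x).target ∩ {z | ∀ w : EuclideanSpace ℝ (Fin m),
      ‖(trivializationAt (EuclideanSpace ℝ (Fin m)) (fun x : M ↦ TangentSpace (𝓡 m) x) x).symmL ℝ
        ((extChartAt (𝓡 m) x).symm z) w‖ ≤ t * ‖N w‖} :=
    Metric.mem_nhds_iff.1 (inter_mem (extChartAt_target_mem_nhds x) h1')
  have hpre : ∀ᶠ y in 𝓝 x, extChartAt (𝓡 m) x y ∈ Metric.ball (extChartAt (𝓡 m) x x) r ∧
      y ∈ (extChartAt (𝓡 m) x).source := by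
    have hc : ContinuousAt (extChartAt (𝓡 m) x) x := continuousAt_extChartAt x
    exact (hc.eventually (Metric.ball_mem_nhds _ hr)).and (extChartAt_source_mem_nhds x)
  filter_upwards [hpre.prod_nhds hpre] with ⟨y, y'⟩ ⟨⟨hy, hys⟩, ⟨hy', hys'⟩⟩
  let η := ContinuousAffineMap.lineMap (R := ℝ) (extChartAt (𝓡 m) x y) (extChartAt (𝓡 m) x y')
  have hη : ∀ s ∈ Icc (0 : ℝ) 1, η s ∈ (extChartAt (𝓡 m) x).target ∩
      {z | ∀ w : EuclideanSpace ℝ (Fin m),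
      ‖(trivializationAt (EuclideanSpace ℝ (Fin m)) (fun x : M ↦ TangentSpace (𝓡 m) x) x).symmL ℝ
        ((extChartAt (𝓡 m) x).symm z) w‖ ≤ t * ‖N w‖} := fun s hs ↦ by
    refine hball ((convex_ball _ _).segment_subset hy hy' ?_)
    rw [segment_eq_image_lineMap]
    exact ⟨s, hs, rfl⟩
  have hη_smooth : ContMDiffOn 𝓘(ℝ, ℝ) 𝓘(ℝ, EuclideanSpace ℝ (Fin m)) 1 η (Icc 0 1) := by
    rw [contMDiffOn_iff_contDiffOn]
    exact (ContinuousAffineMap.contDiff _).contDiffOn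
  set γ := (extChartAt (𝓡 m) x).symm ∘ η with hγ
  have hγ_smooth : ContMDiffOn 𝓘(ℝ, ℝ) (𝓡 m) 1 γ (Icc 0 1) :=
    (contMDiffOn_extChartAt_symm x).comp hη_smooth fun s hs ↦ (hη s hs).1
  have hlen : edist y y' ≤ Manifold.pathELength (𝓡 m) γ 0 1 := by
    rw [IsRiemannianManifold.out (I := 𝓡 m) y y']
    refine Manifold.riemannianEDist_le_pathELength hγ_smooth ?_ ?_ zero_le_one
    · have h2 : η 0 = extChartAt (𝓡 m) x y := AffineMap.lineMap_apply_zero _ _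
      rw [hγ, Function.comp_apply, h2, (extChartAt (𝓡 m) x).left_inv hys]
    · have h2 : η 1 = extChartAt (𝓡 m) x y' := AffineMap.lineMap_apply_one _ _
      rw [hγ, Function.comp_apply, h2, (extChartAt (𝓡 m) x).left_inv hys']
  refine hlen.trans ?_
  rw [Manifold.pathELength_eq_lintegral_mfderivWithin_Icc]
  have hbound : ∀ s ∈ Icc (0 : ℝ) 1, ‖mfderivWithin 𝓘(ℝ, ℝ) (𝓡 m) γ (Icc 0 1) s 1‖ₑ ≤
      t * edist (normalChart (m := m) x y) (normalChart x y') := by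
    intro s hs
    have hsrc : γ s ∈ (chartAt (EuclideanSpace ℝ (Fin m)) x).source := by
      have := (extChartAt (𝓡 m) x).map_target (hη s hs).1
      rwa [extChartAt_source] at this
    have hcomp : mfderivWithin 𝓘(ℝ, ℝ) (𝓡 m) γ (Icc 0 1) s =
        (mfderivWithin 𝓘(ℝ, EuclideanSpace ℝ (Fin m)) (𝓡 m) (extChartAt (𝓡 m) x).symm
          (range (𝓡 m)) (η s)) ∘L
          (mfderivWithin 𝓘(ℝ, ℝ) 𝓘(ℝ, EuclideanSpace ℝ (Fin m)) η (Icc 0 1) s) := by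
      apply mfderivWithin_comp
      · exact mdifferentiableWithinAt_extChartAt_symm (hη s hs).1
      · exact hη_smooth.mdifferentiableOn one_ne_zero s hs
      · exact fun s hs ↦ extChartAt_target_subset_range x (hη s hs).1
      · rw [uniqueMDiffWithinAt_iff_uniqueDiffWithinAt]
        exact uniqueDiffOn_Icc zero_lt_one s hs
    have hderiv : mfderivWithin 𝓘(ℝ, ℝ) 𝓘(ℝ, EuclideanSpace ℝ (Fin m)) η (Icc 0 1) s 1 =
        extChartAt (𝓡 m) x y' - extChartAt (𝓡 m) x y := by
      have haux : ∀ a b : EuclideanSpace ℝ (Fin m),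
          fderiv ℝ (ContinuousAffineMap.lineMap (R := ℝ) a b) s 1 = b - a := fun a b ↦ by simp
      rw [mfderivWithin_eq_fderivWithin, fderivWithin_eq_fderiv
        (uniqueDiffOn_Icc zero_lt_one _ hs) (ContinuousAffineMap.differentiableAt _)]
      exact haux _ _
    have hsymm := TangentBundle.symmL_trivializationAt (I := 𝓡 m) hsrc
    have hinv : extChartAt (𝓡 m) x (γ s) = η s := (extChartAt (𝓡 m) x).right_inv (hη s hs).1
    rw [hinv] at hsymm
    have heq : mfderivWithin 𝓘(ℝ, ℝ) (𝓡 m) γ (Icc 0 1) s 1 =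
        (trivializationAt (EuclideanSpace ℝ (Fin m)) (fun x : M ↦ TangentSpace (𝓡 m) x) x).symmL ℝ
          (γ s) (extChartAt (𝓡 m) x y' - extChartAt (𝓡 m) x y) := by
      rw [hcomp, ← hsymm, ← hderiv]
      rfl
    rw [heq, edist_comm, edist_eq_enorm_sub, normalChart, normalChart, ← map_sub, ← enorm_norm,
      ← enorm_norm (N _)]
    have := (hη s hs).2 (extChartAt (𝓡 m) x y' - extChartAt (𝓡 m) x y)
    rw [Real.enorm_of_nonneg (norm_nonneg _), Real.enorm_of_nonneg (norm_nonneg _),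
      ← ENNReal.ofReal_coe_nnreal, ← ENNReal.ofReal_mul t.coe_nonneg]
    exact ENNReal.ofReal_le_ofReal this
  calc _ ≤ ∫⁻ _ in Icc (0 : ℝ) 1, t * edist (normalChart (m := m) x y) (normalChart x y') :=
        setLIntegral_mono' measurableSet_Icc hbound
    _ = _ := by simp

variable (m) in
-- Conversely, a nearly shortest curve between two points close to `x` cannot leave a small ball
-- around `x`, and there the normalized chart stretches tangent vectors by at most `t`. Its image is
-- a curve joining the two image points.
theorem eventually_edist_normalChart_le (x : M) {t : ℝ≥0} (ht : 1 < t) :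
    ∀ᶠ p : M × M in 𝓝 (x, x),
      edist (normalChart (m := m) x p.1) (normalChart x p.2) ≤ t * edist p.1 p.2 := by
  let N := normalizer (k := m) (fun x : M ↦ TangentSpace (𝓡 m) x) x
  have ht' : (1 : ℝ) < t := by exact_mod_cast ht
  have h1 := eventually_norm_normalizer_le (k := m) (V := fun x : M ↦ TangentSpace (𝓡 m) x) x ht'
  obtain ⟨δ, hδ, hball⟩ : ∃ δ > 0, Metric.eball x δ ⊆
      (chartAt (EuclideanSpace ℝ (Fin m)) x).source ∩ {y | ∀ v : TangentSpace (𝓡 m) y,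
        ‖N ((trivializationAt (EuclideanSpace ℝ (Fin m)) (fun x : M ↦ TangentSpace (𝓡 m) x)
          x).continuousLinearMapAt ℝ y v)‖ ≤ t * ‖v‖} :=
    EMetric.mem_nhds_iff.1 (inter_mem (chart_source_mem_nhds _ x) h1)
  -- Points within `δ / 3` of `x` are less than `2 δ / 3` apart, so a curve of length below `2 δ /
  -- 3` starting at one of them stays within `δ` of `x`.
  have hδ3 : 0 < δ / 3 := ENNReal.div_pos hδ.ne' (by simp)
  have hpre : ∀ᶠ y in 𝓝 x, edist y x < δ / 3 := Metric.eball_mem_nhds x hδ3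
  filter_upwards [hpre.prod_nhds hpre] with ⟨y, y'⟩ ⟨hy, hy'⟩
  dsimp only at hy hy' ⊢
  have hyy' : edist y y' < δ / 3 + δ / 3 := by
    refine (edist_triangle y x y').trans_lt ?_
    rw [edist_comm x y']
    exact ENNReal.add_lt_add hy hy'
  have hsum : δ / 3 + (δ / 3 + δ / 3) = δ := by
    rw [← add_assoc]
    exact ENNReal.add_thirds δ
  have ht0 : (t : ℝ≥0∞) ≠ 0 := by
    have : t ≠ 0 := (zero_lt_one.trans ht).ne'
    exact_mod_cast this
  -- The distance is an infimum that need not be attained, so a slightly larger `r` is used as a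
  -- bound on the length of a curve.
  suffices h : ∀ r, edist y y' < r → r < δ / 3 + δ / 3 →
      edist (normalChart (m := m) x y) (normalChart x y') ≤ t * r by
    rw [← ENNReal.div_le_iff' ht0 ENNReal.coe_ne_top]
    by_contra! hlt
    obtain ⟨r, hr, hr'⟩ := exists_between (lt_min hlt hyy')
    have h2 := h r hr (hr'.trans_le (min_le_right _ _))
    rw [← ENNReal.div_le_iff' ht0 ENNReal.coe_ne_top] at h2
    exact absurd (hr'.trans_le (min_le_left _ _)) h2.not_gt
  intro r hr hrδ
  rw [IsRiemannianManifold.out (I := 𝓡 m) y y'] at hr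
  obtain ⟨γ, hγ0, hγ1, hγ_smooth, hγr⟩ := Manifold.exists_lt_of_riemannianEDist_lt hr
  have hγ_mem : ∀ s ∈ Icc (0 : ℝ) 1, γ s ∈ Metric.eball x δ := by
    intro s hs
    have h2 : edist y (γ s) ≤ Manifold.pathELength (𝓡 m) γ 0 s := by
      rw [IsRiemannianManifold.out (I := 𝓡 m) y (γ s)]
      exact Manifold.riemannianEDist_le_pathELength
        (hγ_smooth.mono (Icc_subset_Icc_right hs.2)) hγ0 rfl hs.1
    have h3 : Manifold.pathELength (𝓡 m) γ 0 s ≤ Manifold.pathELength (𝓡 m) γ 0 1 :=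
      Manifold.pathELength_mono le_rfl hs.2
    have h4 : edist (γ s) y < δ / 3 + δ / 3 := by
      rw [edist_comm]
      exact ((h2.trans h3).trans_lt hγr).trans hrδ
    rw [Metric.mem_eball, ← hsum]
    refine (edist_triangle _ y _).trans_lt ?_
    rw [add_comm]
    exact ENNReal.add_lt_add hy h4
  let γ' : ℝ → EuclideanSpace ℝ (Fin m) := extChartAt (𝓡 m) x ∘ γ
  have hγ'_smooth : ContMDiffOn 𝓘(ℝ, ℝ) 𝓘(ℝ, EuclideanSpace ℝ (Fin m)) 1 γ' (Icc 0 1) :=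
    contMDiffOn_extChartAt.comp (I' := 𝓡 m)
      (t := (chartAt (EuclideanSpace ℝ (Fin m)) x).source) hγ_smooth
      fun s hs ↦ (hball (hγ_mem s hs)).1
  rw [contMDiffOn_iff_contDiffOn] at hγ'_smooth
  have hNγ' : ContDiffOn ℝ 1 (N ∘ γ') (Icc 0 1) := N.contDiff.comp_contDiffOn hγ'_smooth
  calc edist (normalChart (m := m) x y) (normalChart x y')
      = ‖(N ∘ γ') 1 - (N ∘ γ') 0‖ₑ := by
        rw [edist_comm, edist_eq_enorm_sub]
        simp only [Function.comp, γ', hγ0, hγ1]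
        rfl
    _ ≤ ∫⁻ s in Icc (0 : ℝ) 1, ‖derivWithin (N ∘ γ') (Icc 0 1) s‖ₑ :=
        enorm_sub_le_lintegral_derivWithin_Icc_of_contDiffOn_Icc hNγ' zero_le_one
    _ ≤ ∫⁻ s in Icc (0 : ℝ) 1, t * ‖mfderivWithin 𝓘(ℝ, ℝ) (𝓡 m) γ (Icc 0 1) s 1‖ₑ := by
        refine setLIntegral_mono' measurableSet_Icc fun s hs ↦ ?_
        have huniq := uniqueDiffOn_Icc (zero_lt_one (α := ℝ)) s hs
        have hcomp : mfderivWithin 𝓘(ℝ, ℝ) 𝓘(ℝ, EuclideanSpace ℝ (Fin m)) γ' (Icc 0 1) s =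
            (mfderiv (𝓡 m) 𝓘(ℝ, EuclideanSpace ℝ (Fin m)) (extChartAt (𝓡 m) x) (γ s)) ∘L
              (mfderivWithin 𝓘(ℝ, ℝ) (𝓡 m) γ (Icc 0 1) s) := by
          apply mfderiv_comp_mfderivWithin
          · exact mdifferentiableAt_extChartAt (hball (hγ_mem s hs)).1
          · exact hγ_smooth.mdifferentiableOn one_ne_zero s hs
          · rwa [uniqueMDiffWithinAt_iff_uniqueDiffWithinAt]
        have heq : derivWithin (N ∘ γ') (Icc 0 1) s =
            N ((trivializationAt (EuclideanSpace ℝ (Fin m)) (fun x : M ↦ TangentSpace (𝓡 m) x)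
              x).continuousLinearMapAt ℝ (γ s)
              (mfderivWithin 𝓘(ℝ, ℝ) (𝓡 m) γ (Icc 0 1) s 1)) := by
          have h2 := TangentBundle.continuousLinearMapAt_trivializationAt (I := 𝓡 m)
            (hball (hγ_mem s hs)).1
          have h3 : derivWithin (N ∘ γ') (Icc 0 1) s = N (derivWithin γ' (Icc 0 1) s) := by
            have h4 := (N.toContinuousLinearMap.hasFDerivAt.comp_hasDerivWithinAt s
              (hγ'_smooth.differentiableOn one_ne_zero s hs).hasDerivWithinAt)
            exact h4.derivWithin huniq
          rw [h3, ← fderivWithin_derivWithin, ← mfderivWithin_eq_fderivWithin, hcomp, h2]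
          rfl
        rw [heq, ← enorm_norm, ← enorm_norm (mfderivWithin _ _ _ _ _ _),
          Real.enorm_of_nonneg (norm_nonneg _), Real.enorm_of_nonneg (norm_nonneg _),
          ← ENNReal.ofReal_coe_nnreal, ← ENNReal.ofReal_mul t.coe_nonneg]
        exact ENNReal.ofReal_le_ofReal ((hball (hγ_mem s hs)).2 _)
    _ = t * Manifold.pathELength (𝓡 m) γ 0 1 := by
        rw [lintegral_const_mul' _ _ ENNReal.coe_ne_top,
          Manifold.pathELength_eq_lintegral_mfderivWithin_Icc]
    _ ≤ t * r := by gcongr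

end Chart

/-! ### Sections in nearly isometric frames -/

section Frames

variable {k : ℕ} {B : Type*} [TopologicalSpace B] {V : B → Type*}
  [TopologicalSpace (TotalSpace (EuclideanSpace ℝ (Fin k)) V)]
  [∀ x, NormedAddCommGroup (V x)] [∀ x, InnerProductSpace ℝ (V x)]
  [FiberBundle (EuclideanSpace ℝ (Fin k)) V] [VectorBundle ℝ (EuclideanSpace ℝ (Fin k)) V]

/-- The trivialization at `x₀`, normalized so as to be isometric on the fibre over `x₀`. -/
def frameMap (x₀ x : B) : V x →L[ℝ] EuclideanSpace ℝ (Fin k) :=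
  (normalizer V x₀).toContinuousLinearMap ∘L
    (trivializationAt (EuclideanSpace ℝ (Fin k)) V x₀).continuousLinearMapAt ℝ x

/-- The map `frameMap x₀ x` as an equivalence. -/
def frameEquiv {x₀ x : B} (hx : x ∈ (trivializationAt (EuclideanSpace ℝ (Fin k)) V x₀).baseSet) :
    V x ≃L[ℝ] EuclideanSpace ℝ (Fin k) :=
  ((trivializationAt (EuclideanSpace ℝ (Fin k)) V x₀).continuousLinearEquivAt ℝ x hx).trans
    (normalizer V x₀)

theorem coe_frameEquiv {x₀ x : B}
    (hx : x ∈ (trivializationAt (EuclideanSpace ℝ (Fin k)) V x₀).baseSet) :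
    (frameEquiv hx : V x →L[ℝ] EuclideanSpace ℝ (Fin k)) = frameMap x₀ x := by
  ext1 v
  simp [frameEquiv, frameMap, Trivialization.coe_linearMapAt_of_mem _ hx]

theorem frameEquiv_apply {x₀ x : B}
    (hx : x ∈ (trivializationAt (EuclideanSpace ℝ (Fin k)) V x₀).baseSet) (v : V x) :
    frameEquiv hx v = frameMap x₀ x v := by
  rw [← coe_frameEquiv hx]
  rfl

theorem frameMap_apply {x₀ x : B}
    (hx : x ∈ (trivializationAt (EuclideanSpace ℝ (Fin k)) V x₀).baseSet) (v : V x) :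
    frameMap x₀ x v =
      normalizer V x₀ (trivializationAt (EuclideanSpace ℝ (Fin k)) V x₀ ⟨x, v⟩).2 := by
  simp [frameMap, Trivialization.coe_linearMapAt_of_mem _ hx]

theorem eventually_norm_frameMap [IsContinuousRiemannianBundle (EuclideanSpace ℝ (Fin k)) V]
    (x₀ : B) {t : ℝ} (ht : 1 < t) : ∀ᶠ x in 𝓝 x₀, ∀ v : V x,
      ‖frameMap (k := k) x₀ x v‖ ≤ t * ‖v‖ ∧ ‖v‖ ≤ t * ‖frameMap (k := k) x₀ x v‖ := by
  have hx₀ : x₀ ∈ (trivializationAt (EuclideanSpace ℝ (Fin k)) V x₀).baseSet :=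
    FiberBundle.mem_baseSet_trivializationAt' x₀
  filter_upwards [eventually_norm_normalizer_le (k := k) (V := V) x₀ ht,
    eventually_norm_symmL_le (k := k) (V := V) x₀ ht,
    (trivializationAt (EuclideanSpace ℝ (Fin k)) V x₀).open_baseSet.mem_nhds hx₀] with x h1 h2 h3 v
  refine ⟨h1 v, ?_⟩
  have := h2 ((trivializationAt (EuclideanSpace ℝ (Fin k)) V x₀).continuousLinearMapAt ℝ x v)
  rwa [Trivialization.symmL_continuousLinearMapAt _ h3] at this

end Frames

/-! ### The derivative at a zero is independent of the connection -/

section ZeroDerivative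

variable {m k : ℕ} {M : Type*} [EMetricSpace M]
  [ChartedSpace (EuclideanSpace ℝ (Fin m)) M] [IsManifold (𝓡 m) ∞ M]
  {V : M → Type*} [TopologicalSpace (TotalSpace (EuclideanSpace ℝ (Fin k)) V)]
  [∀ x, NormedAddCommGroup (V x)] [∀ x, InnerProductSpace ℝ (V x)]
  [FiberBundle (EuclideanSpace ℝ (Fin k)) V] [VectorBundle ℝ (EuclideanSpace ℝ (Fin k)) V]
  [ContMDiffVectorBundle ∞ (EuclideanSpace ℝ (Fin k)) V (𝓡 m)]

theorem mvfderiv_congr {F : Type*} [NormedAddCommGroup F] [NormedSpace ℝ F] {f g : M → F} {x : M}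
    (h : f =ᶠ[𝓝 x] g) : mvfderiv (𝓡 m) f x = mvfderiv (𝓡 m) g x := by
  ext v
  have h' : mfderiv (𝓡 m) 𝓘(ℝ, F) f x = mfderiv (𝓡 m) 𝓘(ℝ, F) g x := h.mfderiv_eq
  exact DFunLike.congr_fun h' v

/-- The differentiation of sections in the trivialization at `x₀`. -/
theorem isCovariantDerivativeOn_trivializationAt (x₀ : M) :
    IsCovariantDerivativeOn (I := 𝓡 m) (EuclideanSpace ℝ (Fin k))
      (fun (σ : ∀ x, V x) x ↦ (trivializationAt (EuclideanSpace ℝ (Fin k)) V x₀).symmL ℝ x ∘L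
        mvfderiv (𝓡 m) (fun y ↦ (trivializationAt (EuclideanSpace ℝ (Fin k)) V x₀ ⟨y, σ y⟩).2) x)
      (trivializationAt (EuclideanSpace ℝ (Fin k)) V x₀).baseSet where
  add {σ σ' x} hσ hσ' hx := by
    set e := trivializationAt (EuclideanSpace ℝ (Fin k)) V x₀
    have : ContMDiffVectorBundle 1 (EuclideanSpace ℝ (Fin k)) V (𝓡 m) := inferInstance
    rw [e.mdifferentiableAt_section_iff (𝓡 m) _ hx] at hσ hσ'
    have h1 : (fun y ↦ (e ⟨y, (σ + σ') y⟩).2) =ᶠ[𝓝 x]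
        (fun y ↦ (e ⟨y, σ y⟩).2) + fun y ↦ (e ⟨y, σ' y⟩).2 := by
      filter_upwards [e.open_baseSet.mem_nhds hx] with y hy
      simpa using (e.linear ℝ hy).map_add (σ y) (σ' y)
    rw [mvfderiv_congr h1, mvfderiv_add hσ hσ', ContinuousLinearMap.comp_add]
  leibniz {σ g x} hσ hg hx := by
    set e := trivializationAt (EuclideanSpace ℝ (Fin k)) V x₀
    have : ContMDiffVectorBundle 1 (EuclideanSpace ℝ (Fin k)) V (𝓡 m) := inferInstance
    rw [e.mdifferentiableAt_section_iff (𝓡 m) _ hx] at hσ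
    have h1 : (fun y ↦ (e ⟨y, (g • σ) y⟩).2) =ᶠ[𝓝 x] g • fun y ↦ (e ⟨y, σ y⟩).2 := by
      filter_upwards [e.open_baseSet.mem_nhds hx] with y hy
      simpa using (e.linear ℝ hy).map_smul (g y) (σ y)
    have h2 : e.symmL ℝ x (e ⟨x, σ x⟩).2 = σ x := by
      have := Trivialization.symmL_continuousLinearMapAt (R := ℝ) e hx (σ x)
      rwa [e.continuousLinearMapAt_apply ℝ, e.coe_linearMapAt_of_mem (R := ℝ) hx] at this
    rw [mvfderiv_congr h1, mvfderiv_smul hg hσ]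
    ext v
    simp only [ContinuousLinearMap.comp_apply, add_apply,
      smul_apply, ContinuousLinearMap.smulRight_apply, map_add, map_smul]
    exact congrArg₂ _ rfl (congrArg _ h2)

/-- The difference of two connections is tensorial: at `x` it depends only on the value of the
section there, so it vanishes at a zero. The comparison is with differentiation in the
trivialization. -/
theorem cov_apply_of_eq_zero (cov : CovariantDerivative (𝓡 m) (EuclideanSpace ℝ (Fin k)) V)
    (x₀ : M) {σ : ∀ x, V x} {x : M}
    (hσ : MDifferentiableAt (𝓡 m) ((𝓡 m).prod 𝓘(ℝ, EuclideanSpace ℝ (Fin k)))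
      (fun y ↦ TotalSpace.mk' (EuclideanSpace ℝ (Fin k)) y (σ y)) x)
    (hx : x ∈ (trivializationAt (EuclideanSpace ℝ (Fin k)) V x₀).baseSet) (h0 : σ x = 0)
    (v : TangentSpace (𝓡 m) x) :
    (trivializationAt (EuclideanSpace ℝ (Fin k)) V x₀).continuousLinearMapAt ℝ x (cov σ x v) =
      mvfderiv (𝓡 m) (fun y ↦ (trivializationAt (EuclideanSpace ℝ (Fin k)) V x₀ ⟨y, σ y⟩).2) x v := by
  have : ContMDiffVectorBundle 1 (EuclideanSpace ℝ (Fin k)) V (𝓡 m) := inferInstance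
  have h := IsCovariantDerivativeOn.difference_apply cov.isCovariantDerivativeOn
    (isCovariantDerivativeOn_trivializationAt (m := m) (V := V) x₀) hx hσ
  rw [h0, ContinuousLinearMap.map_zero, eq_comm, sub_eq_zero] at h
  rw [h, ContinuousLinearMap.comp_apply, Trivialization.continuousLinearMapAt_symmL _ hx]

end ZeroDerivative

/-! ### Local expressions of the sections near a point -/

section LocalModel

variable {m k d : ℕ} {M : Type*} [EMetricSpace M]
  [ChartedSpace (EuclideanSpace ℝ (Fin m)) M] [IsManifold (𝓡 m) ∞ M]
  [RiemannianBundle (fun x : M ↦ TangentSpace (𝓡 m) x)]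
  {V : M → Type*} [TopologicalSpace (TotalSpace (EuclideanSpace ℝ (Fin k)) V)]
  [∀ x, NormedAddCommGroup (V x)] [∀ x, InnerProductSpace ℝ (V x)]
  [FiberBundle (EuclideanSpace ℝ (Fin k)) V] [VectorBundle ℝ (EuclideanSpace ℝ (Fin k)) V]
  [ContMDiffVectorBundle ∞ (EuclideanSpace ℝ (Fin k)) V (𝓡 m)]

/-- The section `σ` in the normalized trivialization at `x₀`. -/
def sectionRep (x₀ : M) (σ : ∀ x, V x) (y : M) : EuclideanSpace ℝ (Fin k) :=
  frameMap x₀ y (σ y)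

theorem contMDiffOn_sectionRep (x₀ : M) (s : Cₛ^∞⟮𝓡 m; EuclideanSpace ℝ (Fin k), V⟯) :
    ContMDiffOn (𝓡 m) 𝓘(ℝ, EuclideanSpace ℝ (Fin k)) ∞ (sectionRep (k := k) x₀ s)
      (trivializationAt (EuclideanSpace ℝ (Fin k)) V x₀).baseSet := by
  have h := ((trivializationAt (EuclideanSpace ℝ (Fin k)) V x₀).contMDiffOn_section_baseSet_iff
    (IB := 𝓡 m) (n := ∞) (s := s)).1 s.contMDiff.contMDiffOn
  have h2 := (normalizer (k := k) V x₀ : EuclideanSpace ℝ (Fin k) →L[ℝ]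
    EuclideanSpace ℝ (Fin k)).contMDiff (n := ∞) |>.comp_contMDiffOn h
  exact h2.congr fun x hx ↦ frameMap_apply hx _

theorem frameMap_cov_of_eq_zero (cov : CovariantDerivative (𝓡 m) (EuclideanSpace ℝ (Fin k)) V)
    (x₀ : M) (s : Cₛ^∞⟮𝓡 m; EuclideanSpace ℝ (Fin k), V⟯) {x : M}
    (hx : x ∈ (trivializationAt (EuclideanSpace ℝ (Fin k)) V x₀).baseSet) (h0 : s x = 0)
    (v : TangentSpace (𝓡 m) x) :
    frameMap (k := k) x₀ x (cov s x v) = mvfderiv (𝓡 m) (sectionRep (k := k) x₀ s) x v := by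
  have hs : MDifferentiableAt (𝓡 m) ((𝓡 m).prod 𝓘(ℝ, EuclideanSpace ℝ (Fin k)))
      (fun y ↦ TotalSpace.mk' (EuclideanSpace ℝ (Fin k)) y (s y)) x :=
    s.contMDiff.mdifferentiable (by simp) x
  have h1 := cov_apply_of_eq_zero cov x₀ hs hx h0 v
  have : ContMDiffVectorBundle 1 (EuclideanSpace ℝ (Fin k)) V (𝓡 m) := inferInstance
  rw [(trivializationAt (EuclideanSpace ℝ (Fin k)) V x₀).mdifferentiableAt_section_iff
    (𝓡 m) _ hx] at hs
  have h2 : sectionRep (k := k) x₀ s =ᶠ[𝓝 x] (normalizer (k := k) V x₀ : EuclideanSpace ℝ (Fin k) →L[ℝ]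
      EuclideanSpace ℝ (Fin k)) ∘
        fun y ↦ (trivializationAt (EuclideanSpace ℝ (Fin k)) V x₀ ⟨y, s y⟩).2 := by
    filter_upwards [(trivializationAt (EuclideanSpace ℝ (Fin k)) V x₀).open_baseSet.mem_nhds hx]
      with y hy
    exact frameMap_apply hy _
  have h3 := ((normalizer (k := k) V x₀ : EuclideanSpace ℝ (Fin k) →L[ℝ]
      EuclideanSpace ℝ (Fin k)).hasMFDerivAt.comp x hs.hasMFDerivAt).mfderiv
  rw [mvfderiv_congr h2]
  refine Eq.trans ?_ (DFunLike.congr_fun h3 v).symm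
  refine (congrArg (normalizer (k := k) V x₀) h1).trans rfl

/-- The inverse of the normalized chart at `x₀`. -/
def normalChartSymm (x₀ : M) (u : EuclideanSpace ℝ (Fin m)) : M :=
  (extChartAt (𝓡 m) x₀).symm
    ((normalizer (k := m) (fun x : M ↦ TangentSpace (𝓡 m) x) x₀).symm u)

theorem normalChartSymm_normalChart {x₀ x : M} (hx : x ∈ (extChartAt (𝓡 m) x₀).source) :
    normalChartSymm (m := m) x₀ (normalChart x₀ x) = x := by
  rw [normalChartSymm, normalChart, ContinuousLinearEquiv.symm_apply_apply,
    PartialEquiv.left_inv _ hx]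

theorem contMDiffAt_normalChartSymm (x₀ : M) :
    ContMDiffAt 𝓘(ℝ, EuclideanSpace ℝ (Fin m)) (𝓡 m) ∞ (normalChartSymm (m := m) x₀)
      (normalChart (m := m) x₀ x₀) := by
  have h1 : ContMDiffAt 𝓘(ℝ, EuclideanSpace ℝ (Fin m)) (𝓡 m) ∞ (extChartAt (𝓡 m) x₀).symm
      ((normalizer (k := m) (fun x : M ↦ TangentSpace (𝓡 m) x) x₀).symm
        (normalChart (m := m) x₀ x₀)) := by
    rw [normalChart, ContinuousLinearEquiv.symm_apply_apply]
    exact (contMDiffOn_extChartAt_symm x₀).contMDiffAt (extChartAt_target_mem_nhds x₀)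
  exact h1.comp _ ((normalizer (k := m) (fun x : M ↦ TangentSpace (𝓡 m) x) x₀).symm :
    EuclideanSpace ℝ (Fin m) →L[ℝ] EuclideanSpace ℝ (Fin m)).contMDiff.contMDiffAt

theorem hasMFDerivAt_normalChart {x₀ x : M} (hx : x ∈ (extChartAt (𝓡 m) x₀).source) :
    HasMFDerivAt (𝓡 m) 𝓘(ℝ, EuclideanSpace ℝ (Fin m)) (normalChart (m := m) x₀) x
      (frameMap (k := m) (V := fun x : M ↦ TangentSpace (𝓡 m) x) x₀ x) := by
  rw [extChartAt_source] at hx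
  have h1 := (mdifferentiableAt_extChartAt (I := 𝓡 m) hx).hasMFDerivAt
  have h2 := TangentBundle.continuousLinearMapAt_trivializationAt (I := 𝓡 m) hx
  have h3 := (normalizer (k := m) (fun x : M ↦ TangentSpace (𝓡 m) x) x₀ : EuclideanSpace ℝ (Fin m)
    →L[ℝ] EuclideanSpace ℝ (Fin m)).hasMFDerivAt.comp x h1
  rw [← h2] at h3
  exact h3

theorem continuousAt_normalChart (x₀ : M) : ContinuousAt (normalChart (m := m) x₀) x₀ :=
  (hasMFDerivAt_normalChart (mem_extChartAt_source x₀)).continuousAt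

/-- The sections of a linear family as functions of the parameter and of the coordinates at
`x₀`. -/
def modelFun (s : EuclideanSpace ℝ (Fin d) →ₗ[ℝ] Cₛ^∞⟮𝓡 m; EuclideanSpace ℝ (Fin k), V⟯) (x₀ : M)
    (p : EuclideanSpace ℝ (Fin d) × EuclideanSpace ℝ (Fin m)) : EuclideanSpace ℝ (Fin k) :=
  sectionRep x₀ (s p.1) (normalChartSymm x₀ p.2)

/-- The value of the sections of a linear family in the normalized trivialization. -/
def sectionEval (s : EuclideanSpace ℝ (Fin d) →ₗ[ℝ] Cₛ^∞⟮𝓡 m; EuclideanSpace ℝ (Fin k), V⟯)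
    (x₀ x : M) : EuclideanSpace ℝ (Fin d) →L[ℝ] EuclideanSpace ℝ (Fin k) :=
  LinearMap.toContinuousLinearMap
    { toFun := fun c ↦ sectionRep x₀ (s c) x
      map_add' := fun c c' ↦ by
        simp only [sectionRep, map_add, ContMDiffSection.coe_add, Pi.add_apply]
      map_smul' := fun r c ↦ by
        simp only [sectionRep, map_smul, ContMDiffSection.coe_smul, Pi.smul_apply, RingHom.id_apply] }

variable (s : EuclideanSpace ℝ (Fin d) →ₗ[ℝ] Cₛ^∞⟮𝓡 m; EuclideanSpace ℝ (Fin k), V⟯)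

theorem sectionEval_apply (x₀ x : M) (c : EuclideanSpace ℝ (Fin d)) :
    sectionEval s x₀ x c = frameMap (k := k) x₀ x (s c x) := rfl

theorem sectionEval_eq_sum (x₀ x : M) (c : EuclideanSpace ℝ (Fin d)) :
    sectionEval s x₀ x c = ∑ i, c i • sectionRep x₀ (s (EuclideanSpace.basisFun (Fin d) ℝ i)) x := by
  conv_lhs => rw [← (EuclideanSpace.basisFun (Fin d) ℝ).sum_repr c, map_sum]
  refine Finset.sum_congr rfl fun i _ ↦ ?_
  rw [map_smul]
  rfl

theorem modelFun_normalChart {x₀ x : M} (hx : x ∈ (extChartAt (𝓡 m) x₀).source)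
    (c : EuclideanSpace ℝ (Fin d)) :
    modelFun s x₀ (c, normalChart x₀ x) = sectionRep x₀ (s c) x := by
  rw [modelFun, normalChartSymm_normalChart hx]

/-- Linearity in the parameter reduces joint smoothness to the smoothness of the finitely many basis
sections. -/
theorem contDiffAt_modelFun (x₀ : M) (c₀ : EuclideanSpace ℝ (Fin d)) :
    ContDiffAt ℝ ∞ (modelFun s x₀) (c₀, normalChart x₀ x₀) := by
  have h1 : modelFun s x₀ = fun p ↦ ∑ i, p.1 i •
      (sectionRep x₀ (s (EuclideanSpace.basisFun (Fin d) ℝ i)) ∘ normalChartSymm x₀) p.2 :=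
    funext fun p ↦ sectionEval_eq_sum s x₀ _ p.1
  rw [h1]
  refine ContDiffAt.sum fun i _ ↦ ContDiffAt.fun_smul ?_ ?_
  · exact ((EuclideanSpace.proj (𝕜 := ℝ) i).contDiff.comp contDiff_fst).contDiffAt
  · refine ContDiffAt.comp (x := (c₀, normalChart x₀ x₀))
      (g := sectionRep x₀ (s (EuclideanSpace.basisFun (Fin d) ℝ i)) ∘ normalChartSymm x₀)
      (f := Prod.snd) ?_ contDiff_snd.contDiffAt
    rw [← contMDiffAt_iff_contDiffAt]
    refine ContMDiffAt.comp (I' := 𝓡 m) _ ?_ (contMDiffAt_normalChartSymm x₀)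
    rw [normalChartSymm_normalChart (mem_extChartAt_source x₀)]
    exact (contMDiffOn_sectionRep x₀ _).contMDiffAt
      ((trivializationAt (EuclideanSpace ℝ (Fin k)) V x₀).open_baseSet.mem_nhds
        (FiberBundle.mem_baseSet_trivializationAt' x₀))

theorem tendsto_prodMk_normalChart (x₀ : M) (c₀ : EuclideanSpace ℝ (Fin d)) :
    Tendsto (fun p : EuclideanSpace ℝ (Fin d) × M ↦ (p.1, normalChart (m := m) x₀ p.2))
      (𝓝 (c₀, x₀)) (𝓝 (c₀, normalChart x₀ x₀)) := by
  rw [nhds_prod_eq, nhds_prod_eq]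
  exact tendsto_id.prodMap (continuousAt_normalChart x₀)

theorem eventually_mvfderiv_sectionRep (x₀ : M) (c₀ : EuclideanSpace ℝ (Fin d)) :
    ∀ᶠ p : EuclideanSpace ℝ (Fin d) × M in 𝓝 (c₀, x₀), ∀ v : TangentSpace (𝓡 m) p.2,
      mvfderiv (𝓡 m) (sectionRep (k := k) x₀ (s p.1)) p.2 v =
        fderiv ℝ (modelFun s x₀) (p.1, normalChart x₀ p.2)
          (0, frameMap (k := m) (V := fun x : M ↦ TangentSpace (𝓡 m) x) x₀ p.2 v) := by
  have h1 : ∀ᶠ q in 𝓝 (c₀, normalChart (m := m) x₀ x₀), ContDiffAt ℝ 1 (modelFun s x₀) q :=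
    ((contDiffAt_modelFun s x₀ c₀).of_le (by exact_mod_cast le_top)).eventually (by simp)
  have h2 : ∀ᶠ p : EuclideanSpace ℝ (Fin d) × M in 𝓝 (c₀, x₀),
      p.2 ∈ (extChartAt (𝓡 m) x₀).source :=
    continuous_snd.continuousAt.eventually (extChartAt_source_mem_nhds x₀)
  filter_upwards [(tendsto_prodMk_normalChart x₀ c₀).eventually h1, h2] with ⟨c, x⟩ hc hx v
  have h3 : sectionRep (k := k) x₀ (s c) =ᶠ[𝓝 x]
      (fun u ↦ modelFun s x₀ (c, u)) ∘ normalChart x₀ := by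
    filter_upwards [(isOpen_extChartAt_source x₀).mem_nhds hx] with y hy
    exact (modelFun_normalChart s hy c).symm
  have h4 : HasFDerivAt (fun u ↦ modelFun s x₀ (c, u))
      (fderiv ℝ (modelFun s x₀) (c, normalChart x₀ x) ∘L ContinuousLinearMap.inr ℝ _ _)
      (normalChart x₀ x) :=
    ((hc.differentiableAt one_ne_zero).hasFDerivAt).comp _ (hasFDerivAt_prodMk_right c _)
  have h5 := (h4.hasMFDerivAt.comp x (hasMFDerivAt_normalChart hx)).mfderiv
  rw [mvfderiv_congr h3]
  exact DFunLike.congr_fun h5 v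

end LocalModel

/-! ### Linearisation of the relation `s_c(x) = 0` -/

section LocalEstimates

variable {m k d : ℕ} {M : Type*} [EMetricSpace M]
  [ChartedSpace (EuclideanSpace ℝ (Fin m)) M] [IsManifold (𝓡 m) ∞ M]
  [RiemannianBundle (fun x : M ↦ TangentSpace (𝓡 m) x)]
  {V : M → Type*} [TopologicalSpace (TotalSpace (EuclideanSpace ℝ (Fin k)) V)]
  [∀ x, NormedAddCommGroup (V x)] [∀ x, InnerProductSpace ℝ (V x)]
  [FiberBundle (EuclideanSpace ℝ (Fin k)) V] [VectorBundle ℝ (EuclideanSpace ℝ (Fin k)) V]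
  [ContMDiffVectorBundle ∞ (EuclideanSpace ℝ (Fin k)) V (𝓡 m)]
  (s : EuclideanSpace ℝ (Fin d) →ₗ[ℝ] Cₛ^∞⟮𝓡 m; EuclideanSpace ℝ (Fin k), V⟯)

/-- The derivative at `x₀`, in normalized coordinates, of the section with parameter `c₀`. -/
def localDeriv (x₀ : M) (c₀ : EuclideanSpace ℝ (Fin d)) :
    EuclideanSpace ℝ (Fin m) →L[ℝ] EuclideanSpace ℝ (Fin k) :=
  fderiv ℝ (modelFun s x₀) (c₀, normalChart x₀ x₀) ∘L ContinuousLinearMap.inr ℝ _ _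

/-- The model function is linear in `c`, so its partial derivative in `c` is the evaluation at `x₀`
itself. -/
theorem fderiv_modelFun_apply (x₀ : M) (c₀ c : EuclideanSpace ℝ (Fin d))
    (u : EuclideanSpace ℝ (Fin m)) :
    fderiv ℝ (modelFun s x₀) (c₀, normalChart x₀ x₀) (c, u) =
      sectionEval s x₀ x₀ c + localDeriv s x₀ c₀ u := by
  have h1 : (c, u) = (c, 0) + (0, u) := by simp
  have h0 : HasFDerivAt (modelFun s x₀) (fderiv ℝ (modelFun s x₀) (c₀, normalChart x₀ x₀))
      (c₀, normalChart x₀ x₀) :=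
    ((contDiffAt_modelFun s x₀ c₀).differentiableAt (by simp)).hasFDerivAt
  have h2 : HasFDerivAt (fun c ↦ modelFun s x₀ (c, normalChart x₀ x₀))
      (fderiv ℝ (modelFun s x₀) (c₀, normalChart x₀ x₀) ∘L ContinuousLinearMap.inl ℝ _ _) c₀ :=
    HasFDerivAt.comp (g := modelFun s x₀)
      (g' := fderiv ℝ (modelFun s x₀) (c₀, normalChart x₀ x₀)) c₀ h0
      (hasFDerivAt_prodMk_left (𝕜 := ℝ) c₀ (normalChart (m := m) x₀ x₀))
  have h3 : (fun c ↦ modelFun s x₀ (c, normalChart x₀ x₀)) = sectionEval s x₀ x₀ :=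
    funext fun c ↦ modelFun_normalChart s (mem_extChartAt_source x₀) c
  rw [h3] at h2
  have h4 := h2.unique (sectionEval s x₀ x₀).hasFDerivAt
  rw [h1, map_add, ← h4]
  rfl

/-- Between two zeros the model function does not change, so its derivative at the base point nearly
kills the increment. Both points vary, and this is why strict differentiability is used. -/
theorem eventually_norm_sectionEval_add_le (x₀ : M) (c₀ : EuclideanSpace ℝ (Fin d)) {η : ℝ}
    (hη : 0 < η) : ∀ᶠ p : (EuclideanSpace ℝ (Fin d) × M) × (EuclideanSpace ℝ (Fin d) × M) in
      𝓝 ((c₀, x₀), (c₀, x₀)), s p.1.1 p.1.2 = 0 → s p.2.1 p.2.2 = 0 →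
        ‖sectionEval s x₀ x₀ (p.1.1 - p.2.1) +
          localDeriv s x₀ c₀ (normalChart x₀ p.1.2 - normalChart x₀ p.2.2)‖ ≤
        η * max ‖p.1.1 - p.2.1‖ ‖normalChart (m := m) x₀ p.1.2 - normalChart x₀ p.2.2‖ := by
  have h1 := ((contDiffAt_modelFun s x₀ c₀).hasStrictFDerivAt (by simp)).isLittleO.def hη
  have h2 := tendsto_prodMk_normalChart (m := m) x₀ c₀
  have h3 := h2.prodMap h2
  rw [← nhds_prod_eq, ← nhds_prod_eq] at h3
  have h4 : ∀ᶠ p : EuclideanSpace ℝ (Fin d) × M in 𝓝 (c₀, x₀),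
      p.2 ∈ (extChartAt (𝓡 m) x₀).source :=
    continuous_snd.continuousAt.eventually (extChartAt_source_mem_nhds x₀)
  filter_upwards [h3.eventually h1, h4.prod_nhds h4] with ⟨⟨c, x⟩, ⟨c', x'⟩⟩ h ⟨hx, hx'⟩ hc hc'
  dsimp only [Prod.map_apply] at h hx hx' hc hc' ⊢
  rw [modelFun_normalChart s hx, modelFun_normalChart s hx', Prod.mk_sub_mk,
    fderiv_modelFun_apply, sectionRep, sectionRep, hc, hc', map_zero, map_zero, sub_zero, zero_sub,
    norm_neg] at h
  exact h

variable (cov : CovariantDerivative (𝓡 m) (EuclideanSpace ℝ (Fin k)) V)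

theorem eventually_frameMap_cov (x₀ : M) (c₀ : EuclideanSpace ℝ (Fin d)) :
    ∀ᶠ p : EuclideanSpace ℝ (Fin d) × M in 𝓝 (c₀, x₀), s p.1 p.2 = 0 →
      ∀ v : TangentSpace (𝓡 m) p.2, frameMap (k := k) x₀ p.2 (cov (s p.1) p.2 v) =
        fderiv ℝ (modelFun s x₀) (p.1, normalChart x₀ p.2)
          (0, frameMap (k := m) (V := fun x : M ↦ TangentSpace (𝓡 m) x) x₀ p.2 v) := by
  have h2 : ∀ᶠ p : EuclideanSpace ℝ (Fin d) × M in 𝓝 (c₀, x₀),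
      p.2 ∈ (trivializationAt (EuclideanSpace ℝ (Fin k)) V x₀).baseSet :=
    continuous_snd.continuousAt.eventually
      ((trivializationAt (EuclideanSpace ℝ (Fin k)) V x₀).open_baseSet.mem_nhds
        (FiberBundle.mem_baseSet_trivializationAt' x₀))
  filter_upwards [eventually_mvfderiv_sectionRep s x₀ c₀, h2] with p h hp h0 v
  rw [frameMap_cov_of_eq_zero cov x₀ _ hp h0, h]

theorem surjective_localDeriv {x₀ : M} {c₀ : EuclideanSpace ℝ (Fin d)} (h0 : s c₀ x₀ = 0)
    (h : Function.Surjective (cov (s c₀) x₀)) : Function.Surjective (localDeriv s x₀ c₀) := by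
  intro w
  have hx : x₀ ∈ (trivializationAt (EuclideanSpace ℝ (Fin k)) V x₀).baseSet :=
    FiberBundle.mem_baseSet_trivializationAt' x₀
  obtain ⟨v, hv⟩ := h ((frameEquiv hx).symm w)
  refine ⟨frameMap (k := m) (V := fun x : M ↦ TangentSpace (𝓡 m) x) x₀ x₀ v, ?_⟩
  have h1 := (eventually_frameMap_cov s cov x₀ c₀).self_of_nhds h0 v
  rw [hv, ← frameEquiv_apply hx, ContinuousLinearEquiv.apply_symm_apply] at h1
  exact h1.symm

/-- At a zero, `cov` is the derivative of the model function conjugated by frames of `V` and of the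
tangent bundle that are nearly isometric near `x₀`. That derivative varies continuously with the
point. -/
theorem eventually_eqUpTo_sqrtDet_cov [IsContinuousRiemannianBundle (EuclideanSpace ℝ (Fin k)) V]
    [IsContinuousRiemannianBundle (EuclideanSpace ℝ (Fin m)) (fun x : M ↦ TangentSpace (𝓡 m) x)]
    {x₀ : M} {c₀ : EuclideanSpace ℝ (Fin d)} (hD : Function.Surjective (localDeriv s x₀ c₀))
    {t : ℝ≥0} (ht : 1 < t) :
    have := finiteDimensional_fiber k V
    ∀ᶠ p : EuclideanSpace ℝ (Fin d) × M in 𝓝 (c₀, x₀), s p.1 p.2 = 0 →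
      EqUpTo t (ENNReal.ofReal (sqrtDet (cov (s p.1) p.2)))
        (ENNReal.ofReal (sqrtDet (localDeriv s x₀ c₀))) := by
  intro hfd
  -- The two frames cost `(u ^ 2) ^ k`, and the continuity of the derivative costs one more factor.
  obtain ⟨u, hu, hut⟩ := exists_one_lt_pow_le (2 * k + 1) ht
  have hu' : (1 : ℝ) < u := by exact_mod_cast hu
  have h1 : ContinuousAt (fun q ↦ sqrtDet (fderiv ℝ (modelFun s x₀) q ∘L
      ContinuousLinearMap.inr ℝ (EuclideanSpace ℝ (Fin d)) (EuclideanSpace ℝ (Fin m))))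
      (c₀, normalChart x₀ x₀) := by
    have h2 : ContinuousAt (fderiv ℝ (modelFun s x₀)) (c₀, normalChart x₀ x₀) :=
      ((contDiffAt_modelFun s x₀ c₀).fderiv_right (m := 0) (by simp)).continuousAt
    exact continuous_sqrtDet.continuousAt.comp (h2.clm_comp continuousAt_const)
  have h2 := eventually_eqUpTo (sqrtDet_pos _ hD)
    (Tendsto.comp h1 (tendsto_prodMk_normalChart x₀ c₀)) hu
  have h3 : ∀ᶠ p : EuclideanSpace ℝ (Fin d) × M in 𝓝 (c₀, x₀),
      p.2 ∈ (trivializationAt (EuclideanSpace ℝ (Fin k)) V x₀).baseSet :=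
    continuous_snd.continuousAt.eventually
      ((trivializationAt (EuclideanSpace ℝ (Fin k)) V x₀).open_baseSet.mem_nhds
        (FiberBundle.mem_baseSet_trivializationAt' x₀))
  have h4 : ∀ᶠ p : EuclideanSpace ℝ (Fin d) × M in 𝓝 (c₀, x₀),
      p.2 ∈ (trivializationAt (EuclideanSpace ℝ (Fin m))
        (fun x : M ↦ TangentSpace (𝓡 m) x) x₀).baseSet :=
    continuous_snd.continuousAt.eventually
      ((trivializationAt (EuclideanSpace ℝ (Fin m))
        (fun x : M ↦ TangentSpace (𝓡 m) x) x₀).open_baseSet.mem_nhds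
        (FiberBundle.mem_baseSet_trivializationAt' x₀))
  have h5 : ∀ᶠ p : EuclideanSpace ℝ (Fin d) × M in 𝓝 (c₀, x₀), _ :=
    continuous_snd.continuousAt.eventually (eventually_norm_frameMap (k := k) (V := V) x₀ hu')
  have h6 : ∀ᶠ p : EuclideanSpace ℝ (Fin d) × M in 𝓝 (c₀, x₀), _ :=
    continuous_snd.continuousAt.eventually (eventually_norm_frameMap (k := m)
      (V := fun x : M ↦ TangentSpace (𝓡 m) x) x₀ hu')
  filter_upwards [eventually_frameMap_cov s cov x₀ c₀, h2, h3, h4, h5, h6]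
    with ⟨c, x⟩ e1 e2 e3 e4 e5 e6 h0
  dsimp only at e1 e2 e3 e4 e5 e6 h0 ⊢
  have h7 := eqUpTo_sqrtDet_comp_comp (zero_lt_one.trans hu) (frameEquiv e4) (frameEquiv e3).symm
    (fun v ↦ by rw [frameEquiv_apply]; exact (e6 v).1)
    (fun w ↦ by
      have := (e6 ((frameEquiv e4).symm w)).2
      rwa [← frameEquiv_apply e4, ContinuousLinearEquiv.apply_symm_apply] at this)
    (fun w ↦ by
      have := (e5 ((frameEquiv e3).symm w)).2
      rwa [← frameEquiv_apply e3, ContinuousLinearEquiv.apply_symm_apply] at this)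
    (fun v ↦ by
      rw [ContinuousLinearEquiv.symm_symm, frameEquiv_apply]; exact (e5 v).1)
    (fderiv ℝ (modelFun s x₀) (c, normalChart x₀ x) ∘L ContinuousLinearMap.inr ℝ _ _)
  have h8 : ((frameEquiv e3).symm : EuclideanSpace ℝ (Fin k) →L[ℝ] V x) ∘L
      (fderiv ℝ (modelFun s x₀) (c, normalChart x₀ x) ∘L ContinuousLinearMap.inr ℝ _ _) ∘L
      (frameEquiv e4 : TangentSpace (𝓡 m) x →L[ℝ] EuclideanSpace ℝ (Fin m)) = cov (s c) x := by
    ext1 v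
    apply (frameEquiv e3).injective
    rw [frameEquiv_apply e3 (cov (s c) x v), e1 h0 v, ← frameEquiv_apply e4]
    exact (frameEquiv e3).apply_symm_apply _
  rw [h8, finrank_euclideanSpace_fin] at h7
  refine (h7.trans e2).mono ?_
  refine le_trans (le_of_eq ?_) hut
  ring

end LocalEstimates

/-! ### The regular zeros and the Riemannian volume -/

section RegularZeros

variable {m k d : ℕ} {M : Type*} [EMetricSpace M]
  [ChartedSpace (EuclideanSpace ℝ (Fin m)) M] [IsManifold (𝓡 m) ∞ M]
  [RiemannianBundle (fun x : M ↦ TangentSpace (𝓡 m) x)]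
  {V : M → Type*} [TopologicalSpace (TotalSpace (EuclideanSpace ℝ (Fin k)) V)]
  [∀ x, NormedAddCommGroup (V x)] [∀ x, InnerProductSpace ℝ (V x)]
  [FiberBundle (EuclideanSpace ℝ (Fin k)) V] [VectorBundle ℝ (EuclideanSpace ℝ (Fin k)) V]
  [ContMDiffVectorBundle ∞ (EuclideanSpace ℝ (Fin k)) V (𝓡 m)]
  (cov : CovariantDerivative (𝓡 m) (EuclideanSpace ℝ (Fin k)) V)
  (s : EuclideanSpace ℝ (Fin d) →ₗ[ℝ] Cₛ^∞⟮𝓡 m; EuclideanSpace ℝ (Fin k), V⟯)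

/-- The pairs of a parameter `c` and a regular zero of the corresponding section. -/
def regularZeros : Set (EuclideanSpace ℝ (Fin d) × M) :=
  {p | s p.1 p.2 = 0 ∧ Function.Surjective (cov (s p.1) p.2)}

theorem continuousAt_sectionRep (σ : Cₛ^∞⟮𝓡 m; EuclideanSpace ℝ (Fin k), V⟯) (x₀ : M) :
    ContinuousAt (sectionRep (k := k) x₀ σ) x₀ :=
  (contMDiffOn_sectionRep (m := m) x₀ σ).continuousOn.continuousAt
    ((trivializationAt (EuclideanSpace ℝ (Fin k)) V x₀).open_baseSet.mem_nhds
      (FiberBundle.mem_baseSet_trivializationAt' x₀))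

theorem continuousAt_sectionEval (x₀ : M) : ContinuousAt (sectionEval s x₀) x₀ :=
  continuousAt_clm_apply.2 fun c ↦ continuousAt_sectionRep (s c) x₀

theorem isClosed_zeros : IsClosed {p : EuclideanSpace ℝ (Fin d) × M | s p.1 p.2 = 0} := by
  rw [← isOpen_compl_iff, isOpen_iff_mem_nhds]
  rintro ⟨c, x⟩ hcx
  have hx : x ∈ (trivializationAt (EuclideanSpace ℝ (Fin k)) V x).baseSet :=
    FiberBundle.mem_baseSet_trivializationAt' x
  have h1 : ContinuousAt (fun p : EuclideanSpace ℝ (Fin d) × M ↦ sectionEval s x p.2 p.1) (c, x) :=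
    (ContinuousAt.comp (f := Prod.snd) (x := (c, x)) (continuousAt_sectionEval s x)
      continuousAt_snd).clm_apply continuousAt_fst
  have h2 : sectionEval s x x c ≠ 0 := by
    rw [sectionEval_apply, ← frameEquiv_apply hx]
    exact fun h ↦ hcx ((frameEquiv hx).map_eq_zero_iff.1 h)
  filter_upwards [h1.eventually_ne h2] with p hp h0
  refine hp ?_
  rw [sectionEval_apply, show s p.1 p.2 = 0 from h0, map_zero]

variable [IsContMDiffRiemannianBundle (𝓡 m) ∞ (EuclideanSpace ℝ (Fin m))
      (fun x : M ↦ TangentSpace (𝓡 m) x)]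
  [IsRiemannianManifold (𝓡 m) M] [IsContinuousRiemannianBundle (EuclideanSpace ℝ (Fin k)) V]

/-- Near a regular zero, `sqrtDet` of the derivative at zeros stays comparable to a positive number,
and positivity implies surjectivity. The regular zeros are thus relatively open in the closed set of
all zeros. -/
theorem eventually_mem_regularZeros {p : EuclideanSpace ℝ (Fin d) × M}
    (hp : p ∈ regularZeros cov s) : ∀ᶠ q in 𝓝 p, s q.1 q.2 = 0 → q ∈ regularZeros cov s := by
  have hfd := finiteDimensional_fiber k V
  have hD := surjective_localDeriv s cov hp.1 hp.2
  filter_upwards [eventually_eqUpTo_sqrtDet_cov s cov hD one_lt_two] with q hq h0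
  refine ⟨h0, surjective_of_sqrtDet_ne_zero fun h ↦ ?_⟩
  have h1 := (hq h0).2
  rw [h, ENNReal.ofReal_zero, mul_zero, nonpos_iff_eq_zero, ENNReal.ofReal_eq_zero] at h1
  exact absurd (sqrtDet_pos _ hD) h1.not_gt

theorem measurableSet_regularZeros [SecondCountableTopology M] [MeasurableSpace M] [BorelSpace M] :
    MeasurableSet (regularZeros cov s) := by
  have h : regularZeros cov s = {p | s p.1 p.2 = 0} ∩
      interior {q | s q.1 q.2 = 0 → q ∈ regularZeros cov s} := by
    ext p
    exact ⟨fun hp ↦ ⟨hp.1, mem_interior_iff_mem_nhds.2 (eventually_mem_regularZeros cov s hp)⟩,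
      fun hp ↦ interior_subset hp.2 hp.1⟩
  rw [h]
  exact (isClosed_zeros s).measurableSet.inter isOpen_interior.measurableSet

end RegularZeros

/-! ### Bilipschitz neighbourhoods and σ-finiteness of the Riemannian volume -/

section RiemannianVolume

variable {m : ℕ} {M : Type*} [EMetricSpace M]
  [ChartedSpace (EuclideanSpace ℝ (Fin m)) M] [IsManifold (𝓡 m) ∞ M]
  [RiemannianBundle (fun x : M ↦ TangentSpace (𝓡 m) x)]
  [IsContMDiffRiemannianBundle (𝓡 m) ∞ (EuclideanSpace ℝ (Fin m))
      (fun x : M ↦ TangentSpace (𝓡 m) x)]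
  [IsRiemannianManifold (𝓡 m) M] [MeasurableSpace M] [BorelSpace M] [StandardBorelSpace M]

variable (m) in
theorem exists_measurable_eqOn_normalChart (x₀ : M) :
    ∃ φ : M → EuclideanSpace ℝ (Fin m), Measurable φ ∧ EqOn φ (normalChart x₀)
      (extChartAt (𝓡 m) x₀).source := by
  classical
  refine ⟨(extChartAt (𝓡 m) x₀).source.piecewise (normalChart x₀) 0, ?_, fun x hx ↦
    piecewise_eq_of_mem _ _ _ hx⟩
  refine ContinuousOn.measurable_piecewise (fun x hx ↦ ?_) continuousOn_const
    (isOpen_extChartAt_source x₀).measurableSet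
  exact (hasMFDerivAt_normalChart hx).continuousAt.continuousWithinAt

variable (m) in
theorem exists_isOpen_bilipschitzOn (x₀ : M) {t : ℝ≥0} (ht : 1 < t) {N : Set M} (hN : N ∈ 𝓝 x₀) :
    ∃ U : Set M, IsOpen U ∧ x₀ ∈ U ∧ U ⊆ N ∧ U ⊆ (extChartAt (𝓡 m) x₀).source ∧
      BilipschitzOn t (normalChart (m := m) x₀) U ∧
        Bornology.IsBounded (normalChart (m := m) x₀ '' U) := by
  have h1 := (eventually_edist_le_edist_normalChart m x₀ ht).and
    (eventually_edist_normalChart_le m x₀ ht)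
  rw [nhds_prod_eq] at h1
  obtain ⟨P, hP, hPP⟩ := mem_prod_self_iff.1 h1
  have h2 : normalChart (m := m) x₀ ⁻¹' Metric.ball (normalChart x₀ x₀) 1 ∈ 𝓝 x₀ :=
    continuousAt_normalChart x₀ (Metric.ball_mem_nhds _ one_pos)
  obtain ⟨U, hU, hUo, hxU⟩ := mem_nhds_iff.1 (inter_mem (inter_mem hN hP)
    (inter_mem h2 (extChartAt_source_mem_nhds (I := 𝓡 m) x₀)))
  refine ⟨U, hUo, hxU, fun x hx ↦ (hU hx).1.1, fun x hx ↦ (hU hx).2.2, fun x hx y hy ↦ ?_, ?_⟩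
  · have h := hPP (mk_mem_prod (hU hx).1.2 (hU hy).1.2)
    exact ⟨h.2, h.1⟩
  · exact Metric.isBounded_ball.subset (image_subset_iff.2 fun x hx ↦ (hU hx).2.1)

theorem isLocallyFiniteMeasure_riemannianVolume :
    IsLocallyFiniteMeasure (μHE[m] : Measure M) := by
  refine ⟨fun x ↦ ?_⟩
  obtain ⟨U, hUo, hxU, -, -, hU, hbd⟩ := exists_isOpen_bilipschitzOn m x one_lt_two univ_mem
  have h := isFiniteMeasure_restrict_of_bilipschitzOn hU hbd
  rw [finrank_euclideanSpace_fin] at h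
  refine ⟨U, hUo.mem_nhds hxU, ?_⟩
  rw [← Measure.restrict_apply_univ]
  exact measure_lt_top _ _

theorem sigmaFinite_riemannianVolume [SecondCountableTopology M] :
    SigmaFinite (μHE[m] : Measure M) := by
  have := isLocallyFiniteMeasure_riemannianVolume (m := m) (M := M)
  infer_instance


end RiemannianVolume

/-! ### The evaluation map at several points -/

section CoareaConst

variable {X Y Y' : Type*} [NormedAddCommGroup X] [InnerProductSpace ℝ X] [FiniteDimensional ℝ X]
  [NormedAddCommGroup Y] [NormedSpace ℝ Y] [FiniteDimensional ℝ Y] [MeasurableSpace Y]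
  [BorelSpace Y] [NormedAddCommGroup Y'] [NormedSpace ℝ Y'] [FiniteDimensional ℝ Y']
  [MeasurableSpace Y'] [BorelSpace Y']

theorem coareaConst_comp (A : X →L[ℝ] Y) (Φ : Y ≃L[ℝ] Y') (ν : Measure Y') :
    coareaConst ((Φ : Y →L[ℝ] Y') ∘L A) ν = coareaConst A (ν.map Φ.symm) := by
  have h : ν.map Φ.symm (A '' Metric.ball 0 1) =
      ν (((Φ : Y →L[ℝ] Y') ∘L A) '' Metric.ball 0 1) := by
    have := Φ.symm.toHomeomorph.toMeasurableEquiv.map_apply (μ := ν) (A '' Metric.ball 0 1)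
    refine this.trans (congrArg ν ?_)
    rw [ContinuousLinearMap.coe_comp, image_comp]
    exact (Φ.toEquiv.image_eq_preimage_symm _).symm
  have h' : ∀ {i j : ℕ}, i = j → volume (Metric.ball (0 : EuclideanSpace ℝ (Fin i)) 1) =
      volume (Metric.ball (0 : EuclideanSpace ℝ (Fin j)) 1) := by
    rintro i _ rfl
    rfl
  rw [coareaConst, coareaConst, h, h' Φ.toLinearEquiv.finrank_eq]

theorem eqUpTo_coareaConst {t : ℝ≥0} (ht : t ≠ 0) (A : X →L[ℝ] Y) {ν ν' : Measure Y}
    (h : ∀ S, EqUpTo t (ν S) (ν' S)) : EqUpTo t (coareaConst A ν) (coareaConst A ν') := by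
  rw [coareaConst, coareaConst, ENNReal.div_eq_inv_mul, ENNReal.div_eq_inv_mul]
  exact ((h _).inv ht).mul_const _

/-- If `A` is not surjective, the image of the ball lies in a proper subspace and the constant is
infinite. A finite bound on the constant therefore shows that surjectivity persists under small
perturbations. -/
theorem surjective_of_coareaConst_ne_top {A : X →L[ℝ] Y} {ν : Measure Y} [ν.IsAddHaarMeasure]
    (h : coareaConst A ν ≠ ⊤) : Function.Surjective A := by
  by_contra hA
  have h1 : ν (A '' Metric.ball 0 1) = 0 := by
    refine measure_mono_null (image_subset_range A _) ?_
    exact Measure.addHaar_submodule ν (LinearMap.range (A : X →ₗ[ℝ] Y))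
      fun h ↦ hA (LinearMap.range_eq_top.1 h)
  rw [coareaConst, h1, ENNReal.div_zero (Metric.measure_ball_pos _ _ one_pos).ne'] at h
  exact h rfl

end CoareaConst

theorem eqUpTo_map_symm_volume {E F : Type*} [NormedAddCommGroup E] [InnerProductSpace ℝ E]
    [FiniteDimensional ℝ E] [MeasurableSpace E] [BorelSpace E]
    [NormedAddCommGroup F] [InnerProductSpace ℝ F] [FiniteDimensional ℝ F] [MeasurableSpace F]
    [BorelSpace F] {t : ℝ≥0} (ψ : E ≃L[ℝ] F) (h : ∀ v, ‖ψ v‖ ≤ t * ‖v‖ ∧ ‖v‖ ≤ t * ‖ψ v‖)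
    (S : Set E) : EqUpTo (t ^ finrank ℝ E) (volume S) ((volume : Measure F).map ψ.symm S) := by
  have h1 : BilipschitzOn t ψ S := fun x _ y _ ↦ eqUpTo_edist_of_norm_le
    (by rw [← map_sub]; exact (h _).1) (by rw [← map_sub]; exact (h _).2)
  have h2 : (volume : Measure F).map ψ.symm S = volume (ψ '' S) := by
    refine (ψ.symm.toHomeomorph.toMeasurableEquiv.map_apply (μ := volume) S).trans
      (congrArg volume ?_)
    exact (ψ.toEquiv.image_eq_preimage_symm _).symm
  have h3 := h1.eqUpTo_euclideanHausdorffMeasure (finrank ℝ E)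
  rw [InnerProductSpace.euclideanHausdorffMeasure_eq_volume, ψ.toLinearEquiv.finrank_eq,
    InnerProductSpace.euclideanHausdorffMeasure_eq_volume] at h3
  rwa [h2, ψ.toLinearEquiv.finrank_eq]

section Evaluation

variable {m k n d : ℕ} {M : Type*} [EMetricSpace M]
  [ChartedSpace (EuclideanSpace ℝ (Fin m)) M] [IsManifold (𝓡 m) ∞ M]
  [RiemannianBundle (fun x : M ↦ TangentSpace (𝓡 m) x)]
  {V : M → Type*} [TopologicalSpace (TotalSpace (EuclideanSpace ℝ (Fin k)) V)]
  [∀ x, NormedAddCommGroup (V x)] [∀ x, InnerProductSpace ℝ (V x)]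
  [FiberBundle (EuclideanSpace ℝ (Fin k)) V] [VectorBundle ℝ (EuclideanSpace ℝ (Fin k)) V]
  [ContMDiffVectorBundle ∞ (EuclideanSpace ℝ (Fin k)) V (𝓡 m)]
  (cov : CovariantDerivative (𝓡 m) (EuclideanSpace ℝ (Fin k)) V)
  (s : EuclideanSpace ℝ (Fin d) →ₗ[ℝ] Cₛ^∞⟮𝓡 m; EuclideanSpace ℝ (Fin k), V⟯)

/-- The evaluation of the sections of a linear family at the points `z p`. -/
def evalMap (z : Fin n → M) : EuclideanSpace ℝ (Fin d) →L[ℝ] (p : Fin n) → V (z p) :=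
  LinearMap.toContinuousLinearMap
    { toFun := fun c p ↦ s c (z p)
      map_add' := fun c c' ↦ funext fun p ↦ by
        simp only [map_add, ContMDiffSection.coe_add, Pi.add_apply]
      map_smul' := fun r c ↦ funext fun p ↦ by
        simp only [map_smul, ContMDiffSection.coe_smul, Pi.smul_apply, RingHom.id_apply] }

/-- The derivatives of the sections of a linear family at the points `z p`. -/
def derivMap (z : Fin n → M) :
    EuclideanSpace ℝ (Fin d) →L[ℝ] (p : Fin n) → TangentSpace (𝓡 m) (z p) →L[ℝ] V (z p) :=
  LinearMap.toContinuousLinearMap (LinearMap.snd ℝ _ _ ∘ₗ jet cov z ∘ₗ s)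

/-- The evaluation at the points `z p` in the normalized trivializations at the points `z₀ p`. -/
def frameEval (z₀ z : Fin n → M) :
    EuclideanSpace ℝ (Fin d) →L[ℝ] Fin n → EuclideanSpace ℝ (Fin k) :=
  ContinuousLinearMap.pi fun p ↦ sectionEval s (z₀ p) (z p)

theorem continuousAt_frameEval (z₀ : Fin n → M) : ContinuousAt (frameEval s z₀) z₀ := by
  refine continuousAt_clm_apply.2 fun c ↦ continuousAt_pi.2 fun p ↦ ?_
  exact ContinuousAt.comp (f := fun z : Fin n → M ↦ z p) (x := z₀)
    (continuousAt_sectionRep (s c) (z₀ p)) (continuous_apply p).continuousAt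

theorem eventually_forall_apply {z₀ : Fin n → M} {P : Fin n → M → Prop}
    (h : ∀ p, ∀ᶠ x in 𝓝 (z₀ p), P p x) : ∀ᶠ z in 𝓝 z₀, ∀ p, P p (z p) :=
  eventually_all.2 fun p ↦ (continuous_apply p).continuousAt.eventually (h p)

theorem mem_baseSet_of_nhds (z₀ : Fin n → M) : ∀ᶠ z in 𝓝 z₀,
    ∀ p, z p ∈ (trivializationAt (EuclideanSpace ℝ (Fin k)) V (z₀ p)).baseSet :=
  eventually_forall_apply fun p ↦
    (trivializationAt (EuclideanSpace ℝ (Fin k)) V (z₀ p)).open_baseSet.mem_nhds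
      (FiberBundle.mem_baseSet_trivializationAt' (z₀ p))

/-- The product of the normalized frames. -/
def piFrameEquiv {z₀ z : Fin n → M}
    (hz : ∀ p, z p ∈ (trivializationAt (EuclideanSpace ℝ (Fin k)) V (z₀ p)).baseSet) :
    ((p : Fin n) → V (z p)) ≃L[ℝ] Fin n → EuclideanSpace ℝ (Fin k) :=
  ContinuousLinearEquiv.piCongrRight fun p ↦ frameEquiv (hz p)

theorem piFrameEquiv_comp_evalMap {z₀ z : Fin n → M}
    (hz : ∀ p, z p ∈ (trivializationAt (EuclideanSpace ℝ (Fin k)) V (z₀ p)).baseSet) :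
    (piFrameEquiv hz : ((p : Fin n) → V (z p)) →L[ℝ] _) ∘L evalMap s z = frameEval s z₀ z := by
  ext1 c
  funext p
  exact frameEquiv_apply (hz p) _

theorem surjective_frameEval {z₀ : Fin n → M} (h : Function.Surjective (evalMap s z₀)) :
    Function.Surjective (frameEval s z₀ z₀) := by
  rw [← piFrameEquiv_comp_evalMap s
    fun p ↦ FiberBundle.mem_baseSet_trivializationAt' (z₀ p)]
  exact (piFrameEquiv _).surjective.comp h

theorem finrank_ker_evalMap {z : Fin n → M} (h : Function.Surjective (evalMap s z)) :
    finrank ℝ (evalMap s z).ker = d - n * k := by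
  have hfd := finiteDimensional_fiber k V
  have h1 := LinearMap.finrank_range_add_finrank_ker
    (evalMap s z : EuclideanSpace ℝ (Fin d) →ₗ[ℝ] (p : Fin n) → V (z p))
  have h2 := (piFrameEquiv (V := V) (k := k)
    fun p ↦ FiberBundle.mem_baseSet_trivializationAt' (z p)).toLinearEquiv.finrank_eq
  rw [LinearMap.range_eq_top.2 h, finrank_top, finrank_euclideanSpace_fin, h2,
    finrank_pi_fintype] at h1
  simp only [finrank_euclideanSpace_fin, Finset.sum_const, Finset.card_univ, Fintype.card_fin,
    smul_eq_mul] at h1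
  exact Nat.eq_sub_of_add_eq' h1

theorem finrank_ker_frameEval {z₀ : Fin n → M} (h : Function.Surjective (evalMap s z₀)) :
    finrank ℝ (frameEval s z₀ z₀).ker = d - n * k := by
  have h1 := LinearMap.finrank_range_add_finrank_ker
    (frameEval s z₀ z₀ : EuclideanSpace ℝ (Fin d) →ₗ[ℝ] Fin n → EuclideanSpace ℝ (Fin k))
  rw [LinearMap.range_eq_top.2 (surjective_frameEval s h), finrank_top, finrank_euclideanSpace_fin,
    finrank_pi_fintype] at h1
  simp only [finrank_euclideanSpace_fin, Finset.sum_const, Finset.card_univ, Fintype.card_fin,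
    smul_eq_mul] at h1
  exact Nat.eq_sub_of_add_eq' h1

variable [∀ x, MeasurableSpace (V x)] [∀ x, BorelSpace (V x)]

/-- The target of `evalMap s z` changes with `z`. Frames centred at the points `z₀ p` bring all
these maps to one fixed space with little distortion of volume, and there the coarea constant is
continuous. -/
theorem eventually_eqUpTo_coareaConst_evalMap
    [IsContinuousRiemannianBundle (EuclideanSpace ℝ (Fin k)) V] {z₀ : Fin n → M}
    (h : Function.Surjective (evalMap s z₀)) {t : ℝ≥0} (ht : 1 < t) :
    ∀ᶠ z in 𝓝 z₀, Function.Surjective (evalMap s z) ∧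
      EqUpTo t (coareaConst (evalMap s z) (valueVolume k V z))
        (coareaConst (frameEval s z₀ z₀) volume) := by
  have hfd := finiteDimensional_fiber k V
  -- Each of the `n` frames distorts volume by `u ^ k`, and continuity of the constant costs one
  -- more factor.
  obtain ⟨u, hu, hut⟩ := exists_one_lt_pow_le (k * n + 1) ht
  have hu' : (1 : ℝ) < u := by exact_mod_cast hu
  have h1 := (continuousAt_frameEval s z₀).eventually
    (eventually_eqUpTo_coareaConst _ (surjective_frameEval s h) volume hu)
  have h2 : ∀ᶠ z in 𝓝 z₀, ∀ p, _ := eventually_forall_apply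
    fun p ↦ eventually_norm_frameMap (k := k) (V := V) (z₀ p) hu'
  filter_upwards [h1, h2, mem_baseSet_of_nhds (k := k) (V := V) z₀] with z e1 e2 e3
  have e4 := surjective_of_coareaConst_ne_top (ne_top_of_le_ne_top (ENNReal.mul_ne_top
    ENNReal.coe_ne_top (coareaConst_pos_and_lt_top _ (surjective_frameEval s h) volume).2) e1.1)
  have e5 := piFrameEquiv_comp_evalMap s e3
  refine ⟨fun y ↦ ?_, ?_⟩
  · obtain ⟨c, hc⟩ := e4 (piFrameEquiv e3 y)
    rw [← e5] at hc
    exact ⟨c, (piFrameEquiv e3).injective hc⟩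
  rw [← e5, coareaConst_comp] at e1
  have e6 : (volume : Measure (Fin n → EuclideanSpace ℝ (Fin k))).map (piFrameEquiv e3).symm =
      Measure.pi fun p ↦ (volume : Measure (EuclideanSpace ℝ (Fin k))).map (frameEquiv (e3 p)).symm := by
    rw [volume_pi]
    exact Measure.pi_map_pi fun p ↦ (frameEquiv (e3 p)).symm.continuous.measurable.aemeasurable
  rw [e6] at e1
  have e7 : ∀ p, Measure.IsAddHaarMeasure ((volume : Measure (EuclideanSpace ℝ (Fin k))).map
      (frameEquiv (e3 p)).symm) := fun p ↦ (frameEquiv (e3 p)).symm.isAddHaarMeasure_map _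
  have e8 := eqUpTo_coareaConst (t := ∏ _p : Fin n, u ^ k)  (Finset.prod_ne_zero_iff.2
    fun _ _ ↦ pow_ne_zero _ (zero_lt_one.trans hu).ne') (evalMap s z)
    (eqUpTo_pi (μ := fun p ↦ (volume : Measure (V (z p)))) (t := fun _ ↦ u ^ k) fun p S _ ↦ by
      have := eqUpTo_map_symm_volume (frameEquiv (e3 p))
        (fun v ↦ by rw [frameEquiv_apply]; exact e2 p v) S
      rwa [(frameEquiv (e3 p)).toLinearEquiv.finrank_eq, finrank_euclideanSpace_fin] at this)
  refine (e8.trans e1).mono (le_trans (le_of_eq ?_) hut)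
  rw [Finset.prod_const, Finset.card_univ, Fintype.card_fin, pow_succ, pow_mul]

end Evaluation

/-! ### The density of the jet map and the correlation function as fibre integrals -/

theorem addHaar_pi_basis {ι : Type*} [Fintype ι] {κ : ι → Type*} [∀ i, Fintype (κ i)]
    {E : ι → Type*} [∀ i, NormedAddCommGroup (E i)] [∀ i, NormedSpace ℝ (E i)]
    [∀ i, MeasurableSpace (E i)] [∀ i, BorelSpace (E i)] [∀ i, FiniteDimensional ℝ (E i)]
    (B : ∀ i, Basis (κ i) ℝ (E i)) :
    (Pi.basis B).addHaar = Measure.pi fun i ↦ (B i).addHaar := by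
  classical
  have h : parallelepiped (Pi.basis B) = univ.pi fun i ↦ parallelepiped (B i) := by
    ext x
    simp only [parallelepiped_basis_eq, mem_ofPred_eq, mem_univ_pi, Sigma.forall, Pi.basis_repr]
  rw [Basis.addHaar_eq_iff, Basis.coe_parallelepiped, h, Measure.pi_pi]
  exact Finset.prod_eq_one fun i _ ↦ (B i).addHaar_self

theorem lintegral_fiberDensity_prod {d : ℕ} {Y₁ Y₂ κ₁ κ₂ : Type*} [Fintype κ₁] [DecidableEq κ₁]
    [Fintype κ₂] [DecidableEq κ₂] [NormedAddCommGroup Y₁] [NormedSpace ℝ Y₁]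
    [FiniteDimensional ℝ Y₁] [MeasurableSpace Y₁] [BorelSpace Y₁] [NormedAddCommGroup Y₂]
    [NormedSpace ℝ Y₂] [FiniteDimensional ℝ Y₂] [MeasurableSpace Y₂] [BorelSpace Y₂]
    (B₁ : Basis κ₁ ℝ Y₁) (B₂ : Basis κ₂ ℝ Y₂) (A₁ : EuclideanSpace ℝ (Fin d) →L[ℝ] Y₁)
    (A₂ : EuclideanSpace ℝ (Fin d) →L[ℝ] Y₂) (hA : Function.Surjective (A₁.prod A₂))
    {ρ : EuclideanSpace ℝ (Fin d) → ℝ} (hρ : Measurable ρ) (y : Y₁) {h : Y₂ → ℝ≥0∞}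
    (hh : Measurable h) :
    ∫⁻ ξ, fiberDensity (B₁.prod B₂)
        ((A₁ : EuclideanSpace ℝ (Fin d) →ₗ[ℝ] Y₁).prod (A₂ : EuclideanSpace ℝ (Fin d) →ₗ[ℝ] Y₂))
        ρ (y, ξ) * h ξ ∂B₂.addHaar =
      coareaConst A₁ B₁.addHaar * ∫⁻ c in A₁ ⁻¹' {y}, ENNReal.ofReal (ρ c) * h (A₂ c)
        ∂μHE[finrank ℝ A₁.ker] := by
  rw [← lintegral_coareaConst_prod A₁ A₂ hA B₁.addHaar B₂.addHaar y hρ.ennreal_ofReal hh]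
  refine lintegral_congr fun ξ ↦ congrArg (· * _) ?_
  rw [← Basis.prod_addHaar]
  exact fiberDensity_eq (B₁.prod B₂) (A₁.prod A₂) hA ρ (y, ξ)

theorem map_prod_withDensity {d : ℕ} {Y₁ Y₂ κ₁ κ₂ : Type*} [Fintype κ₁] [DecidableEq κ₁]
    [Fintype κ₂] [DecidableEq κ₂] [NormedAddCommGroup Y₁] [NormedSpace ℝ Y₁]
    [FiniteDimensional ℝ Y₁] [MeasurableSpace Y₁] [BorelSpace Y₁] [NormedAddCommGroup Y₂]
    [NormedSpace ℝ Y₂] [FiniteDimensional ℝ Y₂] [MeasurableSpace Y₂] [BorelSpace Y₂]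
    (B₁ : Basis κ₁ ℝ Y₁) (B₂ : Basis κ₂ ℝ Y₂) (A₁ : EuclideanSpace ℝ (Fin d) →L[ℝ] Y₁)
    (A₂ : EuclideanSpace ℝ (Fin d) →L[ℝ] Y₂) (hA : Function.Surjective (A₁.prod A₂))
    {ρ : EuclideanSpace ℝ (Fin d) → ℝ} (hρ : Measurable ρ) :
    (volume.withDensity fun c ↦ ENNReal.ofReal (ρ c)).map (fun c ↦ (A₁ c, A₂ c)) =
      (B₁.addHaar.prod B₂.addHaar).withDensity fun y ↦ fiberDensity (B₁.prod B₂)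
        ((A₁ : EuclideanSpace ℝ (Fin d) →ₗ[ℝ] Y₁).prod (A₂ : EuclideanSpace ℝ (Fin d) →ₗ[ℝ] Y₂))
        ρ (y.1, y.2) := by
  rw [← Basis.prod_addHaar]
  exact map_withDensity_eq_withDensity_fiberDensity (B₁.prod B₂) (A₁.prod A₂) hA hρ

section Correlation

variable {m k n d : ℕ} {M : Type*} [EMetricSpace M]
  [ChartedSpace (EuclideanSpace ℝ (Fin m)) M] [IsManifold (𝓡 m) ∞ M]
  [RiemannianBundle (fun x : M ↦ TangentSpace (𝓡 m) x)]
  {V : M → Type*} [TopologicalSpace (TotalSpace (EuclideanSpace ℝ (Fin k)) V)]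
  [∀ x, NormedAddCommGroup (V x)] [∀ x, InnerProductSpace ℝ (V x)]
  [FiberBundle (EuclideanSpace ℝ (Fin k)) V] [VectorBundle ℝ (EuclideanSpace ℝ (Fin k)) V]
  [ContMDiffVectorBundle ∞ (EuclideanSpace ℝ (Fin k)) V (𝓡 m)]
  [∀ x, MeasurableSpace (V x)] [∀ x, BorelSpace (V x)]
  (cov : CovariantDerivative (𝓡 m) (EuclideanSpace ℝ (Fin k)) V)

variable (k V) in
theorem valueVolume_eq (z : Fin n → M) :
    have := finiteDimensional_fiber k V
    valueVolume k V z =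
      (Pi.basis fun p ↦ (stdOrthonormalBasis ℝ (V (z p))).toBasis).addHaar := by
  intro hfd
  rw [addHaar_pi_basis]
  simp_rw [OrthonormalBasis.addHaar_eq_volume]
  rfl

variable (m k V) in
theorem derivVolume_eq (z : Fin n → M) :
    have := finiteDimensional_fiber k V
    derivVolume m k V z =
      (Pi.basis fun p ↦ homBasis (TangentSpace (𝓡 m) (z p)) (V (z p))).addHaar := by
  intro hfd
  rw [addHaar_pi_basis]
  rfl

variable {S : Submodule ℝ Cₛ^∞⟮𝓡 m; EuclideanSpace ℝ (Fin k), V⟯} (b : Basis (Fin d) ℝ S)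
  {ρ : EuclideanSpace ℝ (Fin d) → ℝ} (hρ : Measurable ρ) {z : Fin n → M}
  (hz : Function.Surjective (jet cov z ∘ₗ randomSection b))

include hρ hz

theorem map_jet_withDensity :
    (volume.withDensity fun c ↦ ENNReal.ofReal (ρ c)).map (jet cov z ∘ₗ randomSection b) =
      ((valueVolume k V z).prod (derivVolume m k V z)).withDensity
        fun y ↦ nPointDensity cov b ρ z y.1 y.2 := by
  have hfd := finiteDimensional_fiber k V
  rw [valueVolume_eq, derivVolume_eq]
  exact map_prod_withDensity (Pi.basis fun p ↦ (stdOrthonormalBasis ℝ (V (z p))).toBasis)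
    (Pi.basis fun p ↦ homBasis (TangentSpace (𝓡 m) (z p)) (V (z p)))
    (evalMap (randomSection b) z) (derivMap cov (randomSection b) z) hz hρ

/-- Integrating out `ξ` undoes the disintegration along the derivatives. What remains is an integral
over the parameters vanishing at `z`, normalised by the value map alone, which is the form that the
geometric comparison produces. -/
theorem zeroCorrelation_eq : zeroCorrelation cov b ρ z =
    coareaConst (evalMap (randomSection b) z) (valueVolume k V z) *
      ∫⁻ c in evalMap (randomSection b) z ⁻¹' {0}, ENNReal.ofReal (ρ c) *
        (have := finiteDimensional_fiber k V
        ∏ p, ENNReal.ofReal (sqrtDet (cov (randomSection b c) (z p)))) ∂μHE[d - n * k] := by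
  have hfd := finiteDimensional_fiber k V
  have hh : Measurable fun ξ : (p : Fin n) → TangentSpace (𝓡 m) (z p) →L[ℝ] V (z p) ↦
      ∏ p, ENNReal.ofReal (sqrtDet (ξ p)) :=
    Finset.measurable_fun_prod _ fun p _ ↦
      (continuous_sqrtDet.measurable.comp (measurable_pi_apply p)).ennreal_ofReal
  have hsurj : Function.Surjective (evalMap (randomSection b) z) := fun y ↦ by
    obtain ⟨c, hc⟩ := hz (y, 0)
    exact ⟨c, (Prod.ext_iff.1 hc).1⟩
  have h := lintegral_fiberDensity_prod
    (Pi.basis fun p ↦ (stdOrthonormalBasis ℝ (V (z p))).toBasis)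
    (Pi.basis fun p ↦ homBasis (TangentSpace (𝓡 m) (z p)) (V (z p)))
    (evalMap (randomSection b) z) (derivMap cov (randomSection b) z) hz hρ 0 hh
  rw [finrank_ker_evalMap (k := k) (randomSection b) hsurj, ← valueVolume_eq k,
    ← derivVolume_eq m k] at h
  exact h

end Correlation

/-! ### Comparison near a tuple of regular zeros -/

section LocalPiece

variable {m k n d : ℕ} {M : Type*} [EMetricSpace M]
  [ChartedSpace (EuclideanSpace ℝ (Fin m)) M] [IsManifold (𝓡 m) ∞ M]
  [RiemannianBundle (fun x : M ↦ TangentSpace (𝓡 m) x)]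
  {V : M → Type*} [TopologicalSpace (TotalSpace (EuclideanSpace ℝ (Fin k)) V)]
  [∀ x, NormedAddCommGroup (V x)] [∀ x, InnerProductSpace ℝ (V x)]
  [FiberBundle (EuclideanSpace ℝ (Fin k)) V] [VectorBundle ℝ (EuclideanSpace ℝ (Fin k)) V]
  [ContMDiffVectorBundle ∞ (EuclideanSpace ℝ (Fin k)) V (𝓡 m)]
  [∀ x, MeasurableSpace (V x)] [∀ x, BorelSpace (V x)]
  (cov : CovariantDerivative (𝓡 m) (EuclideanSpace ℝ (Fin k)) V)
  (s : EuclideanSpace ℝ (Fin d) →ₗ[ℝ] Cₛ^∞⟮𝓡 m; EuclideanSpace ℝ (Fin k), V⟯)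
  (ρ : EuclideanSpace ℝ (Fin d) → ℝ)

/-- The part of the fibre integral for the correlation function at `z` that comes from the set
`E` of pairs of a parameter and a tuple of points. -/
def fiberMass (E : Set (EuclideanSpace ℝ (Fin d) × (Fin n → M))) (z : Fin n → M) : ℝ≥0∞ :=
  have := finiteDimensional_fiber k V
  coareaConst (evalMap s z) (valueVolume k V z) * ∫⁻ c in {c | (c, z) ∈ E},
    ENNReal.ofReal (ρ c) * ∏ p, ENNReal.ofReal (sqrtDet (cov (s c) (z p))) ∂μHE[d - n * k]

theorem finrank_ker_of_surjective {D : EuclideanSpace ℝ (Fin m) →L[ℝ] EuclideanSpace ℝ (Fin k)}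
    (hD : Function.Surjective D) : finrank ℝ D.ker = m - k := by
  have h := LinearMap.finrank_range_add_finrank_ker
    (D : EuclideanSpace ℝ (Fin m) →ₗ[ℝ] EuclideanSpace ℝ (Fin k))
  rw [LinearMap.range_eq_top.2 hD, finrank_top, finrank_euclideanSpace_fin,
    finrank_euclideanSpace_fin] at h
  exact Nat.eq_sub_of_add_eq' h

/-- Lets the local comparison, which only sees the zeros in the small sets `W p`, compute the
product of the full zero measures. -/
theorem pi_restrict_apply_of_subset {ι α : Type*} [Fintype ι] [MeasurableSpace α] (μ : Measure α)
    (R : Set α) [SigmaFinite (μ.restrict R)] {S : ι → Set α} (hS : ∀ i, MeasurableSet (S i))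
    (hSR : ∀ i, S i ⊆ R) {E : Set (ι → α)} (hE : E ⊆ univ.pi S) :
    Measure.pi (fun i ↦ μ.restrict (S i)) E = Measure.pi (fun _ ↦ μ.restrict R) E := by
  have h : ∀ i, μ.restrict (S i) = (μ.restrict R).restrict (S i) := fun i ↦ by
    rw [Measure.restrict_restrict (hS i), inter_eq_left.2 (hSR i)]
  simp_rw [h]
  rw [← Measure.restrict_pi_pi, Measure.restrict_apply' (MeasurableSet.univ_pi hS),
    inter_eq_left.2 hE]

variable [IsContMDiffRiemannianBundle (𝓡 m) ∞ (EuclideanSpace ℝ (Fin m))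
      (fun x : M ↦ TangentSpace (𝓡 m) x)] [IsRiemannianManifold (𝓡 m) M]
  [SecondCountableTopology M] [MeasurableSpace M] [BorelSpace M] [StandardBorelSpace M]
  [IsContinuousRiemannianBundle (EuclideanSpace ℝ (Fin k)) V]

/-- When all factors are nearly constant on the slice, the fibre mass is nearly a constant times its
Hausdorff measure. The error is `u` for the coarea constant, `u` for `ρ` and `u ^ n` for the
determinants. -/
theorem eqUpTo_fiberMass {t u : ℝ≥0} (hut : u * (u * u ^ n) ≤ t) {C : ℝ≥0∞} {r : ℝ} {a : Fin n → ℝ}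
    {E : Set (EuclideanSpace ℝ (Fin d) × (Fin n → M))} (hE : MeasurableSet E) {z : Fin n → M}
    (hC : ∀ c, (c, z) ∈ E → EqUpTo u (coareaConst (evalMap s z) (valueVolume k V z)) C)
    (hr : ∀ c, (c, z) ∈ E → EqUpTo u (ENNReal.ofReal (ρ c)) (ENNReal.ofReal r))
    (ha : have := finiteDimensional_fiber k V
      ∀ c, (c, z) ∈ E → ∀ p, EqUpTo u (ENNReal.ofReal (sqrtDet (cov (s c) (z p))))
        (ENNReal.ofReal (a p))) :
    EqUpTo t (fiberMass cov s ρ E z) (C * (ENNReal.ofReal r * ∏ p, ENNReal.ofReal (a p)) *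
      μHE[d - n * k] {c | (c, z) ∈ E}) := by
  have hfd := finiteDimensional_fiber k V
  have hEz : MeasurableSet {c | (c, z) ∈ E} := measurable_prodMk_right hE
  rcases {c | (c, z) ∈ E}.eq_empty_or_nonempty with h | ⟨c, hc⟩
  · rw [fiberMass, h]
    simp [EqUpTo]
  refine EqUpTo.mono ?_ hut
  rw [mul_assoc, ← setLIntegral_const]
  refine (hC c hc).mul (EqUpTo.lintegral (ae_restrict_of_forall_mem hEz fun c hc ↦ ?_))
  refine (hr c hc).mul ?_
  have := EqUpTo.prod (s := Finset.univ) fun p _ ↦ ha c hc p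
  rwa [Finset.prod_const, Finset.card_univ, Fintype.card_fin] at this

/-- The comparison on small sets near a tuple of regular zeros. -/
theorem exists_nhds_eqUpTo (hρ : Continuous ρ) {c₀ : EuclideanSpace ℝ (Fin d)} {z₀ : Fin n → M}
    (hz₀ : Function.Surjective (evalMap s z₀)) (hreg : ∀ p, (c₀, z₀ p) ∈ regularZeros cov s)
    (hρ₀ : 0 < ρ c₀) {t : ℝ≥0} (ht : 1 < t) :
    ∃ Q ∈ 𝓝 (c₀, z₀), ∀ E, MeasurableSet E → E ⊆ Q →
      (∀ x ∈ E, ∀ p, (x.1, x.2 p) ∈ regularZeros cov s) →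
      ∃ (f : EuclideanSpace ℝ (Fin d) → ℝ≥0∞) (g : (Fin n → M) → ℝ≥0∞), Measurable f ∧
        Measurable g ∧
        (∀ c, ({z | (c, z) ∈ E}.Nonempty → SigmaFinite (zeroMeasure cov (s c))) →
          EqUpTo t (ENNReal.ofReal (ρ c) * zeroMeasurePow cov (s c) n {z | (c, z) ∈ E}) (f c)) ∧
        (∀ z, EqUpTo t (fiberMass cov s ρ E z) (g z)) ∧
        EqUpTo t (∫⁻ c, f c) (∫⁻ z, g z ∂productVolume m n M) := by
  have hfd := finiteDimensional_fiber k V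
  -- The exponent dominates the three errors met below: `1 + 2 * (m * n)` for the slices in `z`, `2
  -- + n + d` for the slices in `c`, and `1 + m * n` for the integrals.
  obtain ⟨u, hu, hut⟩ := exists_one_lt_pow_le (3 * (m * n) + n + d + 2) ht
  have hut' : ∀ i, i ≤ 3 * (m * n) + n + d + 2 → u ^ i ≤ t := fun i hi ↦
    (pow_le_pow_right₀ hu.le hi).trans hut
  set D := fun p ↦ localDeriv s (z₀ p) c₀ with hDdef
  have hD : ∀ p, Function.Surjective (D p) := fun p ↦
    surjective_localDeriv s cov (hreg p).1 (hreg p).2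
  set A := frameEval s z₀ z₀ with hAdef
  have hA : Function.Surjective A := surjective_frameEval s hz₀
  obtain ⟨η, hη, hcore⟩ := exists_local_comparison (M := M) A hA D hD hu
  choose φ hφm hφ using fun p ↦ exists_measurable_eqOn_normalChart m (z₀ p)
  choose U hUo hzU _ hUs hUb hUbd using fun p ↦
    exists_isOpen_bilipschitzOn m (z₀ p) hu (univ_mem (f := 𝓝 (z₀ p)))
  have hφU : ∀ p, ∀ x ∈ U p, φ p x = normalChart (z₀ p) x := fun p x hx ↦ hφ p (hUs p hx)
  have hest : ∀ p, ∃ P : Set (EuclideanSpace ℝ (Fin d) × M), IsOpen P ∧ (c₀, z₀ p) ∈ P ∧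
      (∀ x ∈ P, ∀ y ∈ P, s x.1 x.2 = 0 → s y.1 y.2 = 0 →
        ‖sectionEval s (z₀ p) (z₀ p) (x.1 - y.1) +
          D p (normalChart (z₀ p) x.2 - normalChart (z₀ p) y.2)‖ ≤
        η * max ‖x.1 - y.1‖ ‖normalChart (m := m) (z₀ p) x.2 - normalChart (z₀ p) y.2‖) ∧
      (∀ x ∈ P, s x.1 x.2 = 0 → EqUpTo u (ENNReal.ofReal (sqrtDet (cov (s x.1) x.2)))
        (ENNReal.ofReal (sqrtDet (D p)))) := by
    intro p
    have h1 := eventually_norm_sectionEval_add_le s (z₀ p) c₀ hη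
    rw [nhds_prod_eq] at h1
    obtain ⟨P₁, hP₁, hP₁'⟩ := mem_prod_self_iff.1 h1
    have h2 := eventually_eqUpTo_sqrtDet_cov s cov (hD p) hu
    obtain ⟨P, hP, hPo, hzP⟩ := mem_nhds_iff.1 (inter_mem hP₁ h2)
    exact ⟨P, hPo, hzP, fun x hx y hy ↦ hP₁' (mk_mem_prod (hP hx).1 (hP hy).1),
      fun x hx ↦ (hP hx).2⟩
  choose P hPo hzP hPest hPdet using hest
  have hQ1 : ∀ᶠ x in 𝓝 (c₀, z₀), EqUpTo u (ENNReal.ofReal (ρ x.1)) (ENNReal.ofReal (ρ c₀)) :=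
    eventually_eqUpTo hρ₀ ((hρ.comp continuous_fst).tendsto (c₀, z₀)) hu
  have hQ2 : ∀ᶠ x : EuclideanSpace ℝ (Fin d) × (Fin n → M) in 𝓝 (c₀, z₀), _ :=
    continuous_snd.continuousAt.eventually (eventually_eqUpTo_coareaConst_evalMap s hz₀ hu)
  have hQ3 : ∀ᶠ x : EuclideanSpace ℝ (Fin d) × (Fin n → M) in 𝓝 (c₀, z₀), ∀ p,
      (x.1, x.2 p) ∈ P p ∧ x.2 p ∈ U p := by
    refine eventually_all.2 fun p ↦ ?_
    have hc : Continuous fun x : EuclideanSpace ℝ (Fin d) × (Fin n → M) ↦ (x.1, x.2 p) := by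
      fun_prop
    exact (hc.continuousAt.eventually ((hPo p).mem_nhds (hzP p))).and
      ((continuous_snd.comp hc).continuousAt.eventually ((hUo p).mem_nhds (hzU p)))
  refine ⟨_, hQ1.and (hQ2.and hQ3), fun E hE hEQ hER ↦ ?_⟩
  have hEQ1 := fun x hx ↦ (hEQ (a := x) hx).1
  have hEQ2 := fun x hx ↦ (hEQ (a := x) hx).2.1
  have hEQ3 := fun x hx ↦ (hEQ (a := x) hx).2.2
  set W : Fin n → Set (EuclideanSpace ℝ (Fin d) × M) := fun p ↦
    regularZeros cov s ∩ (P p ∩ Prod.snd ⁻¹' U p) with hW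
  have hWm : ∀ p, MeasurableSet (W p) := fun p ↦ (measurableSet_regularZeros cov s).inter
    ((hPo p).measurableSet.inter (measurable_snd (hUo p).measurableSet))
  have hEW : ∀ x ∈ E, ∀ p, (x.1, x.2 p) ∈ W p := fun x hx p ↦ ⟨hER x hx p, hEQ3 x hx p⟩
  obtain ⟨f, g, hf, hg, hcf, hzg, hfg⟩ := hcore φ U W hφm (fun p ↦ (hUo p).measurableSet)
    (fun p x hx y hy ↦ by rw [hφU p x hx, hφU p y hy]; exact hUb p x hx y hy)
    (fun p ↦ by rw [image_congr (hφU p)]; exact hUbd p) hWm (fun p x hx ↦ hx.2.2)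
    (fun p x hx y hy ↦ by
      rw [hφU p x.2 hx.2.2, hφU p y.2 hy.2.2]
      exact hPest p x hx.2.1 y hy.2.1 hx.1.1 hy.1.1) E hE hEW
  have hker : ∀ p, finrank ℝ (D p).ker = m - k := fun p ↦ finrank_ker_of_surjective (hD p)
  have hkerA : finrank ℝ A.ker = d - n * k := finrank_ker_frameEval s hz₀
  simp only [hker, hkerA, finrank_euclideanSpace_fin, Finset.prod_const, Finset.card_univ,
    Fintype.card_fin] at hcf hzg hfg
  -- The slowly varying factors are frozen at the base point: `ρ` on one side, and the coarea
  -- constant, `ρ` and the determinants on the other.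
  refine ⟨fun c ↦ ENNReal.ofReal (ρ c₀) * f c,
    fun z ↦ coareaConst A volume * (ENNReal.ofReal (ρ c₀) *
      ∏ p, ENNReal.ofReal (sqrtDet (D p))) * g z, hf.const_mul _, hg.const_mul _,
    fun c hc ↦ ?_, fun z ↦ ?_, ?_⟩
  · rcases {z | (c, z) ∈ E}.eq_empty_or_nonempty with h | ⟨z, hz⟩
    · have h1 := (hcf c).2
      rw [h, measure_empty, mul_zero, nonpos_iff_eq_zero] at h1
      simp [h, h1, EqUpTo]
    -- σ-finiteness of the zero measure enters here. It is only required when the slice is nonempty.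
    have h2 : zeroMeasurePow cov (s c) n {z | (c, z) ∈ E} =
        Measure.pi (fun p ↦ (μHE[m - k] : Measure M).restrict {x | (c, x) ∈ W p})
          {z | (c, z) ∈ E} := by
      have : SigmaFinite ((μHE[m - k] : Measure M).restrict
        {x | s c x = 0 ∧ Function.Surjective (cov (s c) x)}) := hc ⟨z, hz⟩
      exact (pi_restrict_apply_of_subset (μHE[m - k] : Measure M) _
        (fun p ↦ measurable_prodMk_left (hWm p)) (fun p x hx ↦ hx.1)
        (fun z hz p _ ↦ hEW (c, z) hz p)).symm
    rw [h2]
    refine ((hEQ1 _ hz).mul (hcf c)).mono (le_trans ?_ (hut' (1 + 2 * (m * n)) (by omega)))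
    rw [← pow_two, ← pow_mul, ← pow_mul, pow_add, pow_one]
    gcongr
    · exact hu.le
    · exact Nat.sub_le m k
  · refine ((eqUpTo_fiberMass cov s ρ le_rfl hE (fun c hc ↦ (hEQ2 _ hc).2)
      (fun c hc ↦ hEQ1 _ hc) (fun c hc p ↦ hPdet p _ (hEQ3 _ hc p).1 (hER _ hc p).1)).trans
      ((hzg z).const_mul _)).mono (le_trans ?_ (hut' (2 + n + d) (by omega)))
    calc u * (u * u ^ n) * u ^ (d - n * k) = u ^ (2 + n) * u ^ (d - n * k) := by ring
      _ ≤ u ^ (2 + n) * u ^ d := by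
        gcongr
        · exact hu.le
        · exact Nat.sub_le _ _
      _ = _ := by ring
  · have hsf := sigmaFinite_riemannianVolume (m := m) (M := M)
    have h1 : Measure.pi (fun p ↦ (μHE[m] : Measure M).restrict (U p)) =
        (productVolume m n M).restrict (univ.pi U) := by
      rw [productVolume, Measure.restrict_pi_pi]
    -- For `z` outside the chart domains the slice of `E` is empty, and `g z`, comparable to its
    -- measure, vanishes.
    have h2 : ∫⁻ z in univ.pi U, g z ∂productVolume m n M = ∫⁻ z, g z ∂productVolume m n M := by
      rw [← lintegral_indicator (MeasurableSet.univ_pi fun p ↦ (hUo p).measurableSet)]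
      refine congrArg _ (indicator_eq_self.2 fun z hz ↦ ?_)
      by_contra hzU
      refine hz ?_
      have h3 : {c | (c, z) ∈ E} = ∅ :=
        eq_empty_of_forall_notMem fun c hc ↦ hzU fun p _ ↦ (hEQ3 _ hc p).2
      have h4 := (hzg z).2
      rwa [h3, measure_empty, mul_zero, nonpos_iff_eq_zero] at h4
    rw [h1, h2] at hfg
    rw [lintegral_const_mul _ hf, lintegral_const_mul _ hg]
    refine ((hfg.const_mul (ENNReal.ofReal (ρ c₀))).mono
      (le_trans (le_of_eq ?_) (hut' (1 + m * n) (by omega)))).trans (EqUpTo.of_eq le_rfl ?_) |>.mono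
        (mul_one _).le
    · ring
    · ring

end LocalPiece

/-! ### From the local comparison to an exact equality -/

section Global

variable {m k n d : ℕ} {M : Type*} [EMetricSpace M]
  [ChartedSpace (EuclideanSpace ℝ (Fin m)) M] [IsManifold (𝓡 m) ∞ M]
  [RiemannianBundle (fun x : M ↦ TangentSpace (𝓡 m) x)]
  {V : M → Type*} [TopologicalSpace (TotalSpace (EuclideanSpace ℝ (Fin k)) V)]
  [∀ x, NormedAddCommGroup (V x)] [∀ x, InnerProductSpace ℝ (V x)]
  [FiberBundle (EuclideanSpace ℝ (Fin k)) V] [VectorBundle ℝ (EuclideanSpace ℝ (Fin k)) V]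
  [ContMDiffVectorBundle ∞ (EuclideanSpace ℝ (Fin k)) V (𝓡 m)]
  [∀ x, MeasurableSpace (V x)] [∀ x, BorelSpace (V x)]
  (cov : CovariantDerivative (𝓡 m) (EuclideanSpace ℝ (Fin k)) V)
  (s : EuclideanSpace ℝ (Fin d) →ₗ[ℝ] Cₛ^∞⟮𝓡 m; EuclideanSpace ℝ (Fin k), V⟯)
  {ρ : EuclideanSpace ℝ (Fin d) → ℝ}
  [IsContMDiffRiemannianBundle (𝓡 m) ∞ (EuclideanSpace ℝ (Fin m))
      (fun x : M ↦ TangentSpace (𝓡 m) x)] [IsRiemannianManifold (𝓡 m) M]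
  [SecondCountableTopology M] [MeasurableSpace M] [BorelSpace M] [StandardBorelSpace M]
  [IsContinuousRiemannianBundle (EuclideanSpace ℝ (Fin k)) V]

theorem fiberMass_iUnion {E : ℕ → Set (EuclideanSpace ℝ (Fin d) × (Fin n → M))}
    (hE : ∀ i, MeasurableSet (E i)) (hd : Pairwise (Function.onFun Disjoint E)) (z : Fin n → M) :
    fiberMass cov s ρ (⋃ i, E i) z = ∑' i, fiberMass cov s ρ (E i) z := by
  have hfd := finiteDimensional_fiber k V
  have h : {c | (c, z) ∈ ⋃ i, E i} = ⋃ i, {c | (c, z) ∈ E i} := by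
    ext c
    simp only [mem_iUnion, mem_ofPred_eq]
  have hm : ∀ i, MeasurableSet {c | (c, z) ∈ E i} := fun i ↦ measurable_prodMk_right (hE i)
  have hd' : Pairwise (Function.onFun Disjoint fun i ↦ {c | (c, z) ∈ E i}) :=
    fun i j hij ↦ (hd hij).preimage fun c ↦ (c, z)
  simp only [fiberMass]
  rw [h, lintegral_iUnion hm hd', ENNReal.tsum_mul_left]

/-- By second countability, countably many of the given neighbourhoods cover `E`; they are then made
disjoint and intersected with `E`. -/
theorem exists_countable_decomposition {α : Type*} [TopologicalSpace α] [SecondCountableTopology α]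
    [MeasurableSpace α] [OpensMeasurableSpace α] {E : Set α} (hE : MeasurableSet E)
    (hne : E.Nonempty) {Q : α → Set α} (hQ : ∀ x ∈ E, Q x ∈ 𝓝 x) :
    ∃ (q : ℕ → α) (F : ℕ → Set α), (∀ i, q i ∈ E) ∧ (∀ i, MeasurableSet (F i)) ∧
      (∀ i, F i ⊆ Q (q i)) ∧ (∀ i, F i ⊆ E) ∧ Pairwise (Function.onFun Disjoint F) ∧
      ⋃ i, F i = E := by
  obtain ⟨T, hTE, hT, hET⟩ := TopologicalSpace.countable_cover_nhdsWithin
    (f := fun x ↦ interior (Q x)) (s := E)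
    fun x hx ↦ mem_nhdsWithin_of_mem_nhds (interior_mem_nhds.2 (hQ x hx))
  have hTne : T.Nonempty := by
    by_contra h
    rw [not_nonempty_iff_eq_empty.1 h, biUnion_empty] at hET
    exact hne.ne_empty (subset_empty_iff.1 hET)
  obtain ⟨q, rfl⟩ := hT.exists_eq_range hTne
  rw [biUnion_range] at hET
  refine ⟨q, fun i ↦ E ∩ disjointed (fun i ↦ interior (Q (q i))) i, fun i ↦ hTE (mem_range_self i),
    fun i ↦ hE.inter (MeasurableSet.disjointed (fun i ↦ isOpen_interior.measurableSet) i),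
    fun i ↦ (inter_subset_right.trans (disjointed_le _ i)).trans interior_subset,
    fun i ↦ inter_subset_left, fun i j hij ↦ ?_, ?_⟩
  · exact (disjoint_disjointed _ hij).mono inter_subset_right inter_subset_right
  · rw [← inter_iUnion, iUnion_disjointed, inter_eq_left.2 hET]

/-- For each `t`, the local comparisons hold with the same factor on all pieces of a countable
partition of `E`, so they may be summed. Since `t > 1` is arbitrary, equality and measurability
follow. -/
theorem lintegral_zeroMeasurePow_eq (hρ : Continuous ρ)
    {E : Set (EuclideanSpace ℝ (Fin d) × (Fin n → M))} (hE : MeasurableSet E)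
    (hreg : ∀ x ∈ E, ∀ p, (x.1, x.2 p) ∈ regularZeros cov s) (hpos : ∀ x ∈ E, 0 < ρ x.1)
    (hsurj : ∀ x ∈ E, Function.Surjective (evalMap s x.2))
    (hfin : ∀ᵐ c, 0 < ρ c → SigmaFinite (zeroMeasure cov (s c))) :
    AEMeasurable (fun c ↦ ENNReal.ofReal (ρ c) * zeroMeasurePow cov (s c) n {z | (c, z) ∈ E}) ∧
      AEMeasurable (fiberMass cov s ρ E) (productVolume m n M) ∧
      ∫⁻ c, ENNReal.ofReal (ρ c) * zeroMeasurePow cov (s c) n {z | (c, z) ∈ E} =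
        ∫⁻ z, fiberMass cov s ρ E z ∂productVolume m n M := by
  have hfd := finiteDimensional_fiber k V
  rcases E.eq_empty_or_nonempty with rfl | hne
  · have h : fiberMass cov s ρ (∅ : Set (EuclideanSpace ℝ (Fin d) × (Fin n → M))) = 0 :=
      funext fun z ↦ by simp [fiberMass]
    simp only [h, mem_empty_iff_false, ofPred_false, measure_empty, mul_zero, lintegral_zero,
      Pi.zero_apply, and_true]
    exact ⟨aemeasurable_const, aemeasurable_const⟩
  refine lintegral_eq_of_forall_eqUpTo fun t ht ↦ ?_
  have h1 : ∀ x ∈ E, ∃ Q ∈ 𝓝 x, _ := fun x hx ↦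
    exists_nhds_eqUpTo cov s ρ hρ (hsurj x hx) (hreg x hx) (hpos x hx) ht
  choose! Q hQ hQE using h1
  obtain ⟨q, F, hqE, hFm, hFQ, hFE, hFd, hFU⟩ := exists_countable_decomposition hE hne hQ
  choose f g hf hg hcf hzg hfg using fun i ↦ hQE (q i) (hqE i) (F i) (hFm i) (hFQ i)
    fun x hx ↦ hreg x (hFE i hx)
  refine ⟨fun c ↦ ∑' i, f i c, fun z ↦ ∑' i, g i z,
    (Measurable.tsum hf).aemeasurable, (Measurable.tsum hg).aemeasurable,
    hfin.mono fun c hc ↦ ?_, Eventually.of_forall fun z ↦ ?_, ?_⟩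
  · have h : {z | (c, z) ∈ E} = ⋃ i, {z | (c, z) ∈ F i} := by
      ext z
      simp only [← hFU, mem_iUnion, mem_ofPred_eq]
    have hm : ∀ i, MeasurableSet {z | (c, z) ∈ F i} := fun i ↦ measurable_prodMk_left (hFm i)
    have hd : Pairwise (Function.onFun Disjoint fun i ↦ {z | (c, z) ∈ F i}) :=
      fun i j hij ↦ (hFd hij).preimage fun z ↦ (c, z)
    rw [h, measure_iUnion hd hm, ← ENNReal.tsum_mul_left]
    exact EqUpTo.tsum fun i ↦ hcf i c fun ⟨z, hz⟩ ↦ hc (hpos _ (hFE i hz))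
  · rw [← hFU, fiberMass_iUnion cov s hFm hFd]
    exact EqUpTo.tsum fun i ↦ hzg i z
  · rw [lintegral_tsum fun i ↦ (hf i).aemeasurable, lintegral_tsum fun i ↦ (hg i).aemeasurable]
    exact EqUpTo.tsum hfg

end Global

/-! ### The expected zero measure -/

section Expectation

variable {m k n d : ℕ} {M : Type*} [EMetricSpace M]
  [ChartedSpace (EuclideanSpace ℝ (Fin m)) M] [IsManifold (𝓡 m) ∞ M]
  [RiemannianBundle (fun x : M ↦ TangentSpace (𝓡 m) x)]
  {V : M → Type*} [TopologicalSpace (TotalSpace (EuclideanSpace ℝ (Fin k)) V)]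
  [∀ x, NormedAddCommGroup (V x)] [∀ x, InnerProductSpace ℝ (V x)]
  [FiberBundle (EuclideanSpace ℝ (Fin k)) V] [VectorBundle ℝ (EuclideanSpace ℝ (Fin k)) V]
  [MeasurableSpace M] [BorelSpace M] [SecondCountableTopology M]
  (cov : CovariantDerivative (𝓡 m) (EuclideanSpace ℝ (Fin k)) V)
  (s : EuclideanSpace ℝ (Fin d) →ₗ[ℝ] Cₛ^∞⟮𝓡 m; EuclideanSpace ℝ (Fin k), V⟯)
  {ρ : EuclideanSpace ℝ (Fin d) → ℝ} {μ : Measure (EuclideanSpace ℝ (Fin d))}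

theorem isOpen_puncturedProduct : IsOpen (puncturedProduct M n) := by
  simp only [puncturedProduct, ofPred_forall]
  exact isOpen_iInter_of_finite fun p ↦ isOpen_iInter_of_finite fun q ↦
    isOpen_iInter_of_finite fun _ ↦ isOpen_ne_fun (continuous_apply p) (continuous_apply q)

/-- Countably many of the given neighbourhoods cover `M`, so one null set of parameters suffices.
Outside it the zero measure is locally finite, hence σ-finite. -/
theorem ae_sigmaFinite_zeroMeasure
    (hZ : ∀ x : M, ∃ U ∈ 𝓝 x, ∃ C : ℝ≥0, ∀ᵐ c ∂μ, zeroMeasure cov (s c) U ≤ C) :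
    ∀ᵐ c ∂μ, SigmaFinite (zeroMeasure cov (s c)) := by
  choose U hU C hC using hZ
  obtain ⟨T, hT, hTU⟩ := TopologicalSpace.countable_cover_nhds
    (f := fun x ↦ interior (U x)) fun x ↦ interior_mem_nhds.2 (hU x)
  filter_upwards [(ae_ball_iff hT).2 fun x _ ↦ hC x] with c hc
  have : IsLocallyFiniteMeasure (zeroMeasure cov (s c)) := by
    refine ⟨fun y ↦ ?_⟩
    have hy : y ∈ ⋃ x ∈ T, interior (U x) := hTU ▸ mem_univ y
    simp only [mem_iUnion] at hy
    obtain ⟨x, hx, hy⟩ := hy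
    exact ⟨U x, mem_interior_iff_mem_nhds.1 hy, (hc x hx).trans_lt ENNReal.coe_lt_top⟩
  infer_instance

/-- A compact set of tuples is covered by finitely many boxes of the given neighbourhoods, and the
product measure of each box is almost surely bounded by a product of the constants. -/
theorem lintegral_zeroMeasurePow_lt_top [IsProbabilityMeasure μ]
    (hZ : ∀ x : M, ∃ U ∈ 𝓝 x, ∃ C : ℝ≥0, ∀ᵐ c ∂μ, zeroMeasure cov (s c) U ≤ C)
    {B : Set (Fin n → M)} (hB : IsCompact B) :
    ∫⁻ c, zeroMeasurePow cov (s c) n B ∂μ < ⊤ := by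
  have hsf := ae_sigmaFinite_zeroMeasure cov s hZ
  choose U hU C hC using hZ
  obtain ⟨T, -, hBT⟩ := hB.elim_nhds_subcover (fun z ↦ univ.pi fun p ↦ U (z p))
    fun z _ ↦ set_pi_mem_nhds finite_univ fun p _ ↦ hU (z p)
  have hbound : ∀ᵐ c ∂μ, zeroMeasurePow cov (s c) n B ≤ ∑ z ∈ T, ∏ p, (C (z p) : ℝ≥0∞) := by
    have h1 : ∀ᵐ c ∂μ, ∀ z ∈ T, ∀ p, zeroMeasure cov (s c) (U (z p)) ≤ C (z p) :=
      (ae_ball_iff T.countable_toSet).2 fun z _ ↦ ae_all_iff.2 fun p ↦ hC (z p)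
    filter_upwards [h1, hsf] with c hc hσ
    refine (measure_mono hBT).trans ((measure_biUnion_finset_le T _).trans
      (Finset.sum_le_sum fun z hz ↦ ?_))
    rw [zeroMeasurePow, Measure.pi_pi]
    exact Finset.prod_le_prod' fun p _ ↦ hc z hz p
  refine (lintegral_mono_ae hbound).trans_lt ?_
  rw [lintegral_const, measure_univ, mul_one]
  exact ENNReal.sum_lt_top.2 fun z _ ↦ ENNReal.prod_lt_top fun p _ ↦ ENNReal.coe_lt_top

variable [ContMDiffVectorBundle ∞ (EuclideanSpace ℝ (Fin k)) V (𝓡 m)]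
  [IsContMDiffRiemannianBundle (𝓡 m) ∞ (EuclideanSpace ℝ (Fin m))
      (fun x : M ↦ TangentSpace (𝓡 m) x)] [IsRiemannianManifold (𝓡 m) M]
  [IsContinuousRiemannianBundle (EuclideanSpace ℝ (Fin k)) V]

/-- The pairs of a parameter of positive density and a tuple in `B` of regular zeros. -/
def regularTuples (ρ : EuclideanSpace ℝ (Fin d) → ℝ) (B : Set (Fin n → M)) :
    Set (EuclideanSpace ℝ (Fin d) × (Fin n → M)) :=
  {x | x.2 ∈ B ∧ (∀ p, (x.1, x.2 p) ∈ regularZeros cov s) ∧ 0 < ρ x.1}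

theorem measurableSet_regularTuples (hρ : Measurable ρ) {B : Set (Fin n → M)}
    (hB : MeasurableSet B) : MeasurableSet (regularTuples cov s ρ B) := by
  have h : regularTuples cov s ρ B = Prod.snd ⁻¹' B ∩
      ((⋂ p, (fun x ↦ (x.1, x.2 p)) ⁻¹' regularZeros cov s) ∩ {x | 0 < ρ x.1}) := by
    ext x
    simp only [regularTuples, mem_inter_iff, mem_preimage, mem_iInter, mem_ofPred_eq]
  rw [h]
  refine (measurable_snd hB).inter (MeasurableSet.inter (MeasurableSet.iInter fun p ↦ ?_) ?_)
  · have h : Measurable fun x : EuclideanSpace ℝ (Fin d) × (Fin n → M) ↦ (x.1, x.2 p) := by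
      fun_prop
    exact h (measurableSet_regularZeros cov s)
  · exact measurableSet_lt measurable_const (hρ.comp measurable_fst)

/-- The zero measure is carried by the regular zeros, so tuples with some component elsewhere form a
null set for the product. -/
theorem zeroMeasurePow_regularTuples {c : EuclideanSpace ℝ (Fin d)} (hc : 0 < ρ c)
    [SigmaFinite (zeroMeasure cov (s c))] (B : Set (Fin n → M)) :
    zeroMeasurePow cov (s c) n {z | (c, z) ∈ regularTuples cov s ρ B} =
      zeroMeasurePow cov (s c) n B := by
  refine (measure_mono fun z hz ↦ hz.1).antisymm ?_
  have hR : zeroMeasure cov (s c) {x | (c, x) ∈ regularZeros cov s}ᶜ = 0 := by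
    have hm : MeasurableSet {x | (c, x) ∈ regularZeros cov s} :=
      measurable_prodMk_left (measurableSet_regularZeros cov s)
    rw [zeroMeasure, Measure.restrict_apply hm.compl]
    exact measure_mono_null (fun x hx ↦ hx.1 hx.2) measure_empty
  have h0 : zeroMeasurePow cov (s c) n
      (⋃ p, Function.eval p ⁻¹' {x | (c, x) ∈ regularZeros cov s}ᶜ) = 0 :=
    measure_iUnion_null fun p ↦ Measure.pi_eval_preimage_null _ hR
  refine (measure_mono (t := {z | (c, z) ∈ regularTuples cov s ρ B} ∪
    ⋃ p, Function.eval p ⁻¹' {x | (c, x) ∈ regularZeros cov s}ᶜ) fun z hz ↦ ?_).trans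
    ((measure_union_le _ _).trans (by rw [h0, add_zero]))
  by_cases h : ∀ p, (c, z p) ∈ regularZeros cov s
  · exact Or.inl ⟨hz, h, hc⟩
  · push Not at h
    obtain ⟨p, hp⟩ := h
    exact Or.inr (mem_iUnion.2 ⟨p, hp⟩)

end Expectation

/-! ### Identification of the fibre mass with the correlation function -/

section Correlation

variable {m k n d : ℕ} {M : Type*} [EMetricSpace M]
  [ChartedSpace (EuclideanSpace ℝ (Fin m)) M] [IsManifold (𝓡 m) ∞ M]
  [RiemannianBundle (fun x : M ↦ TangentSpace (𝓡 m) x)]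
  {V : M → Type*} [TopologicalSpace (TotalSpace (EuclideanSpace ℝ (Fin k)) V)]
  [∀ x, NormedAddCommGroup (V x)] [∀ x, InnerProductSpace ℝ (V x)]
  [FiberBundle (EuclideanSpace ℝ (Fin k)) V] [VectorBundle ℝ (EuclideanSpace ℝ (Fin k)) V]
  [ContMDiffVectorBundle ∞ (EuclideanSpace ℝ (Fin k)) V (𝓡 m)]
  [IsContMDiffRiemannianBundle (𝓡 m) ∞ (EuclideanSpace ℝ (Fin m))
      (fun x : M ↦ TangentSpace (𝓡 m) x)] [IsRiemannianManifold (𝓡 m) M]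
  [SecondCountableTopology M] [MeasurableSpace M] [BorelSpace M]
  [IsContinuousRiemannianBundle (EuclideanSpace ℝ (Fin k)) V]
  [∀ x, MeasurableSpace (V x)] [∀ x, BorelSpace (V x)]
  (cov : CovariantDerivative (𝓡 m) (EuclideanSpace ℝ (Fin k)) V)
  {S : Submodule ℝ Cₛ^∞⟮𝓡 m; EuclideanSpace ℝ (Fin k), V⟯} (b : Basis (Fin d) ℝ S)
  {ρ : EuclideanSpace ℝ (Fin d) → ℝ}
  (hJ : ∀ z ∈ puncturedProduct M n, Function.Surjective (jet cov z ∘ₗ randomSection b))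

include hJ

theorem surjective_evalMap {z : Fin n → M} (hz : z ∈ puncturedProduct M n) :
    Function.Surjective (evalMap (randomSection b) z) := fun y ↦ by
  obtain ⟨c, hc⟩ := hJ z hz (y, 0)
  exact ⟨c, (Prod.ext_iff.1 hc).1⟩

/-- The integrand of `zeroCorrelation_eq` vanishes where `ρ` is not positive or some derivative is
not surjective, so restricting the fibre to regular tuples loses nothing. No Sard-type argument
about critical zeros is needed. -/
theorem fiberMass_regularTuples (hρ : Measurable ρ) {B : Set (Fin n → M)} (hBm : MeasurableSet B)
    (hB : B ⊆ puncturedProduct M n) :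
    fiberMass cov (randomSection b) ρ (regularTuples cov (randomSection b) ρ B) =
      B.indicator (zeroCorrelation cov b ρ) := by
  have hfd := finiteDimensional_fiber k V
  funext z
  by_cases hz : z ∈ B
  swap
  · have h : {c | (c, z) ∈ regularTuples cov (randomSection b) ρ B} = ∅ :=
      eq_empty_of_forall_notMem fun c hc ↦ hz hc.1
    rw [indicator_of_notMem hz, fiberMass, h, Measure.restrict_empty, lintegral_zero_measure,
      mul_zero]
  rw [indicator_of_mem hz, zeroCorrelation_eq cov b hρ (hJ z (hB hz)), fiberMass]
  congr 1
  have h1 : MeasurableSet {c | (c, z) ∈ regularTuples cov (randomSection b) ρ B} :=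
    measurable_prodMk_right (measurableSet_regularTuples cov (randomSection b) hρ hBm)
  have h2 : MeasurableSet (evalMap (randomSection b) z ⁻¹' {0}) :=
    (isClosed_singleton.preimage (evalMap (randomSection b) z).continuous).measurableSet
  rw [← lintegral_indicator h1, ← lintegral_indicator h2]
  refine lintegral_congr fun c ↦ ?_
  by_cases hc : (c, z) ∈ regularTuples cov (randomSection b) ρ B
  · rw [indicator_of_mem (show c ∈ {c | (c, z) ∈ regularTuples cov (randomSection b) ρ B} from hc),
      indicator_of_mem]
    exact funext fun p ↦ (hc.2.1 p).1
  · rw [indicator_of_notMem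
      (show c ∉ {c | (c, z) ∈ regularTuples cov (randomSection b) ρ B} from hc)]
    symm
    refine indicator_apply_eq_zero.2 fun h0 ↦ ?_
    by_contra hne
    obtain ⟨hρc, hdet⟩ := mul_ne_zero_iff.1 hne
    refine hc ⟨hz, fun p ↦ ⟨congrFun h0 p, surjective_of_sqrtDet_ne_zero fun h ↦ ?_⟩, ?_⟩
    · have := Finset.prod_ne_zero_iff.1 hdet p (Finset.mem_univ p)
      exact this (by rw [h, ENNReal.ofReal_zero])
    · exact ENNReal.ofReal_pos.1 (pos_iff_ne_zero.2 hρc)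

theorem lintegral_zeroMeasurePow_eq_setLIntegral [StandardBorelSpace M] (hρ : Continuous ρ)
    {μ : Measure (EuclideanSpace ℝ (Fin d))}
    (hμ : μ = volume.withDensity fun c ↦ ENNReal.ofReal (ρ c))
    (hZ : ∀ x : M, ∃ U ∈ 𝓝 x, ∃ C : ℝ≥0, ∀ᵐ c ∂μ,
      zeroMeasure cov (randomSection b c) U ≤ C)
    {B : Set (Fin n → M)} (hBm : MeasurableSet B) (hB : B ⊆ puncturedProduct M n) :
    AEMeasurable (zeroCorrelation cov b ρ) ((productVolume m n M).restrict B) ∧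
      AEMeasurable (fun c ↦ zeroMeasurePow cov (randomSection b c) n B) μ ∧
      ∫⁻ c, zeroMeasurePow cov (randomSection b c) n B ∂μ =
        ∫⁻ z in B, zeroCorrelation cov b ρ z ∂productVolume m n M := by
  have hρm : Measurable fun c ↦ ENNReal.ofReal (ρ c) := hρ.measurable.ennreal_ofReal
  -- A `μ`-null set is Lebesgue null only within `{ρ > 0}`, so σ-finiteness is available just there.
  -- Elsewhere the weight `ρ` kills both sides.
  have hfin : ∀ᵐ c, 0 < ρ c → SigmaFinite (zeroMeasure cov (randomSection b c)) := by
    have h := ae_sigmaFinite_zeroMeasure cov (randomSection b) hZ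
    rw [hμ, ae_withDensity_iff hρm] at h
    exact h.mono fun c hc hpos ↦ hc (ENNReal.ofReal_pos.2 hpos).ne'
  obtain ⟨h1, h2, h3⟩ := lintegral_zeroMeasurePow_eq cov (randomSection b) hρ
    (measurableSet_regularTuples cov (randomSection b) hρ.measurable hBm)
    (fun x hx ↦ hx.2.1) (fun x hx ↦ hx.2.2) (fun x hx ↦ surjective_evalMap cov b hJ (hB hx.1)) hfin
  have h4 : (fun c ↦ ENNReal.ofReal (ρ c) * zeroMeasurePow cov (randomSection b c) n
      {z | (c, z) ∈ regularTuples cov (randomSection b) ρ B}) =ᵐ[volume]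
      fun c ↦ ENNReal.ofReal (ρ c) * zeroMeasurePow cov (randomSection b c) n B := by
    filter_upwards [hfin] with c hc
    rcases lt_or_ge 0 (ρ c) with hpos | hneg
    · have := hc hpos
      rw [zeroMeasurePow_regularTuples cov (randomSection b) hpos]
    · rw [ENNReal.ofReal_of_nonpos hneg, zero_mul, zero_mul]
  rw [fiberMass_regularTuples cov b hJ hρ.measurable hBm hB] at h2 h3
  have h5 : AEMeasurable (fun c ↦ zeroMeasurePow cov (randomSection b c) n B) μ := by
    rw [hμ]
    exact (aemeasurable_withDensity_ennreal_iff hρ.measurable.real_toNNReal).2 (h1.congr h4)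
  refine ⟨(aemeasurable_indicator_iff hBm).1 h2, h5, ?_⟩
  rw [← lintegral_indicator hBm, ← h3, lintegral_congr_ae h4]
  rw [hμ] at h5 ⊢
  exact lintegral_withDensity_eq_lintegral_mul₀' hρm.aemeasurable h5

end Correlation

end ZeroCorrelation

end

theorem theorem2p2 {m k d n : ℕ}
    -- a `C^∞` Riemannian manifold `M` of dimension `m`
    {M : Type*} [EMetricSpace M] [ChartedSpace (EuclideanSpace ℝ (Fin m)) M]
    [IsManifold (𝓡 m) ∞ M] [RiemannianBundle (fun x : M ↦ TangentSpace (𝓡 m) x)]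
    [IsContMDiffRiemannianBundle (𝓡 m) ∞ (EuclideanSpace ℝ (Fin m))
      (fun x : M ↦ TangentSpace (𝓡 m) x)]
    [IsRiemannianManifold (𝓡 m) M] [SecondCountableTopology M]
    [MeasurableSpace M] [BorelSpace M]
    -- a `C^∞` real vector bundle `V` of rank `k` over `M`, with a metric and a connection
    {V : M → Type*} [TopologicalSpace (TotalSpace (EuclideanSpace ℝ (Fin k)) V)]
    [∀ x, NormedAddCommGroup (V x)] [∀ x, InnerProductSpace ℝ (V x)]
    [FiberBundle (EuclideanSpace ℝ (Fin k)) V] [VectorBundle ℝ (EuclideanSpace ℝ (Fin k)) V]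
    [ContMDiffVectorBundle ∞ (EuclideanSpace ℝ (Fin k)) V (𝓡 m)]
    [IsContMDiffRiemannianBundle (𝓡 m) ∞ (EuclideanSpace ℝ (Fin k)) V]
    [∀ x, MeasurableSpace (V x)] [∀ x, BorelSpace (V x)]
    (cov : CovariantDerivative (𝓡 m) (EuclideanSpace ℝ (Fin k)) V)
    -- a finite dimensional space `S` of sections, with linear coordinates `c ∈ ℝ^d`
    (S : Submodule ℝ Cₛ^∞⟮𝓡 m; EuclideanSpace ℝ (Fin k), V⟯) (b : Basis (Fin d) ℝ S)
    -- a probability measure `μ = ρ dc` on `S`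
    (ρ : EuclideanSpace ℝ (Fin d) → ℝ) (hρ : Continuous ρ) (hρ_nonneg : ∀ c, 0 ≤ ρ c)
    (hρ_pos : 0 < ρ 0)
    (μ : Measure (EuclideanSpace ℝ (Fin d))) [IsProbabilityMeasure μ]
    (hμ : μ = volume.withDensity fun c ↦ ENNReal.ofReal (ρ c))
    -- the jet map is surjective
    (hJ : ∀ z ∈ ZeroCorrelation.puncturedProduct M n,
      Function.Surjective (ZeroCorrelation.jet cov z ∘ₗ ZeroCorrelation.randomSection b))
    -- the volumes `|Z_s|` are locally uniformly bounded above
    (hZ : ∀ x : M, ∃ U ∈ 𝓝 x, ∃ C : ℝ≥0, ∀ᵐ c ∂μ,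
      ZeroCorrelation.zeroMeasure cov (ZeroCorrelation.randomSection b c) U ≤ C) :
    -- `D_n` is the density of the law of `(s(z), ∇s(z))`
    (∀ z ∈ ZeroCorrelation.puncturedProduct M n,
      μ.map (ZeroCorrelation.jet cov z ∘ₗ ZeroCorrelation.randomSection b) =
        ((ZeroCorrelation.valueVolume k V z).prod
          (ZeroCorrelation.derivVolume m k V z)).withDensity
            fun y ↦ ZeroCorrelation.nPointDensity cov b ρ z y.1 y.2) ∧
    -- `E |Z_s|^n = K_n(z) dz` on `M_n`
    AEMeasurable (fun z ↦ ZeroCorrelation.zeroCorrelation cov b ρ z)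
      ((ZeroCorrelation.productVolume m n M).restrict (ZeroCorrelation.puncturedProduct M n)) ∧
    (∀ B : Set (Fin n → M), MeasurableSet B → B ⊆ ZeroCorrelation.puncturedProduct M n →
      AEMeasurable (fun c ↦
        ZeroCorrelation.zeroMeasurePow cov (ZeroCorrelation.randomSection b c) n B) μ ∧
      ∫⁻ c, ZeroCorrelation.zeroMeasurePow cov (ZeroCorrelation.randomSection b c) n B ∂μ =
        ∫⁻ z in B, ZeroCorrelation.zeroCorrelation cov b ρ z
          ∂(ZeroCorrelation.productVolume m n M)) ∧
    -- this measure is finite on the compact subsets of `M_n`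
    (∀ B : Set (Fin n → M), IsCompact B → B ⊆ ZeroCorrelation.puncturedProduct M n →
      ∫⁻ z in B, ZeroCorrelation.zeroCorrelation cov b ρ z
        ∂(ZeroCorrelation.productVolume m n M) < ⊤) := by
  have hlc : LocallyCompactSpace M :=
    -- Local compactness together with second countability gives the σ-compactness behind the
    -- standard Borel structure.
    ChartedSpace.locallyCompactSpace (EuclideanSpace ℝ (Fin m)) M
  have hsb : StandardBorelSpace M := ZeroCorrelation.standardBorelSpace_of_sigmaCompact M
  have hcr : IsContinuousRiemannianBundle (EuclideanSpace ℝ (Fin k)) V :=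
    ZeroCorrelation.isContinuousRiemannianBundle_of_isContMDiff (m := m) V
  have hopen : IsOpen (ZeroCorrelation.puncturedProduct M n) :=
    ZeroCorrelation.isOpen_puncturedProduct
  refine ⟨fun z hz ↦ ?_, ?_, fun B hBm hB ↦ ?_, fun B hBc hB ↦ ?_⟩
  · rw [hμ]
    exact ZeroCorrelation.map_jet_withDensity cov b hρ.measurable (hJ z hz)
  · exact (ZeroCorrelation.lintegral_zeroMeasurePow_eq_setLIntegral cov b hJ hρ hμ hZ
      hopen.measurableSet Subset.rfl).1
  · exact (ZeroCorrelation.lintegral_zeroMeasurePow_eq_setLIntegral cov b hJ hρ hμ hZ hBm hB).2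
  -- Finiteness is read off from the expectation side, where the bound on the zero volumes applies
  -- directly.
  · rw [← (ZeroCorrelation.lintegral_zeroMeasurePow_eq_setLIntegral cov b hJ hρ hμ hZ
      hBc.measurableSet hB).2.2]
    exact ZeroCorrelation.lintegral_zeroMeasurePow_lt_top cov (ZeroCorrelation.randomSection b) hZ hBc
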